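/- **RNN Boosting.** *Language models and distinguishers.* Let $\Sigma=\{0,\dots,m-1\}$ be a finite alphabet and $n\ge 1$. A language model $q$ for texts in $\Sigma^n$ assigns to every prefix $s\in\Sigma^{<n}$ a probability distribution $q(\cdot\mid s)$ on $\Sigma$; its text distribution is $\bar q(x)=\prod_{i=1}^n q(x_i\mid x_1\cdots x_{i-1})$. For a fixed language model $p$ (the training distribution) the next-token loss of $q$ is $$L(q)=-\mathbb E_{x\sim\bar p}\Big[\tfrac1n\sum_{i=1}^n\log q(x_i\mid x_1\cdots x_{i-1})\Big]\in[0,\infty].$$ For $k\ge 1$, a next-$k$-token distinguisher is a family of functions $d_i:\Sigma^n\to\{0,1\}$, $1\le i\le n$, such that $d_i(x)$ depends only on the tokens $x_j$ with $j<i+k$. Its advantage is $$\alpha=\mathbb E_{y\sim\bar p}\Big[\tfrac1n\sum_{i=1}^n\Big(\mathbb E_{x\sim\bar q}\big[d_i(x)\mid x_1\cdots x_{i-1}=y_1\cdots y_{i-1}\big]-d_i(y)\Big)\Big],$$ where the conditional expectation is formed with the next-token probabilities of $q$. *RNNs.* A transition function is a composition of functions of the three types $\max(0,w^\top z)$, $\prod_i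 z_i$ and $1/w^\top z$ (with nonzero denominator); its cost is the number of functions composed. An RNN $Q$ has a finite set of real-valued nodes (their number is the size $|Q|$), some of which are input nodes, an output node, initial values, a transition function for each non-input node, an RNN-time $\mathcal T_Q\ge 1$ and a hidden node set $H_Q$ of non-input nodes. At each time step all non-input nodes are updated simultaneously by their transition functions from the node values one step before. Each element of the input sequence is held at the input nodes for $\mathcal T_Q$ steps, and the output on a sequence of length $l$ is the value of the output node in the last of these $l\mathcal T_Q$ steps. The hidden nodes are updated from input nodes and hidden nodes only, and they suffice for the output: whenever a new input element arrives, if the hidden nodes keep their values and the other non-input nodes are given arbitrary values, then running $Q$ on the remaining inputs still gives the same output. In all these computations no denominator vanishes. $Q$ represents the language model $q$ if on input $x_1,\dots,x_i$ it outputs $q(x_i\mid x_1\cdots x_{i-1})$, for all $x\in\Sigma^n$ and $1\le i\le n$. An RNN $D$ represents the distinguisher $d$ if for all $x\in\Sigma^n$ and $1\le i\le n$ it outputs $d_i(x)$ after reading the tokens $x_1,x_2,\dots,x_{\min(i+k-1,n)}$, where a second input gives $D$ the index $i$ from the token $x_i$ on and is $0$ before. *Statement.* Let $k\ge1$. Suppose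 that a language model $q$ is represented by an RNN $Q$ and that a next-$k$-token distinguisher $d$ with advantage $\alpha$ is represented by an RNN $D$. Then there is a language model $q'$, represented by an RNN $Q'$, such that $$|Q'|=|Q|+|H_Q|+|D|+|H_D|+7k+25,\qquad |H_{Q'}|=|H_Q|+|H_D|+6k+17,$$ $$\mathcal T_{Q'}=(|\Sigma|^k+1)\,k\,(\max\{\mathcal T_Q,\mathcal T_D\}+4),$$ and the next-token loss decreases by at least $\alpha^2/4k$: $$L(q')+\frac{\alpha^2}{4k}\le L(q).$$ Moreover, if all transition functions of $Q$ and $D$ have cost at most $c$, then those of $Q'$ have cost at most $C$, where $C$ depends only on $k$ and $c$. -/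

import Mathlib

/-! ## Transition functions -/

/-- Compositions of the three elementary functions (ReLU of a linear form, product, reciprocal of
a linear form), with the values of the nodes in `V` as arguments.  The empty product is `1`. -/
inductive TransExpr (V : Type) : Type
  | node (v : V) : TransExpr V
  | relu {r : ℕ} (w : Fin r → ℝ) (e : Fin r → TransExpr V) : TransExpr V
  | prod {r : ℕ} (e : Fin r → TransExpr V) : TransExpr V
  | recip {r : ℕ} (w : Fin r → ℝ) (e : Fin r → TransExpr V) : TransExpr V

namespace TransExpr

/-- The value of a composition. -/
noncomputable def eval {V : Type} (s : V → ℝ) : TransExpr V → ℝ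
  | node v => s v
  | relu w e => max 0 (∑ i, w i * (e i).eval s)
  | prod e => ∏ i, (e i).eval s
  | recip w e => 1 / ∑ i, w i * (e i).eval s

/-- No reciprocal of zero is taken in the evaluation at `s`. -/
def Defined {V : Type} (s : V → ℝ) : TransExpr V → Prop
  | node _ => True
  | relu _ e => ∀ i, (e i).Defined s
  | prod e => ∀ i, (e i).Defined s
  | recip w e => (∀ i, (e i).Defined s) ∧ ∑ i, w i * (e i).eval s ≠ 0

/-- The number of elementary functions in a composition. -/
def cost {V : Type} : TransExpr V → ℕ
  | node _ => 0
  | relu _ e => 1 + ∑ i, (e i).cost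
  | prod e => 1 + ∑ i, (e i).cost
  | recip _ e => 1 + ∑ i, (e i).cost

/-- The nodes whose values the composition uses. -/
def nodes {V : Type} : TransExpr V → Set V
  | node v => {v}
  | relu _ e => ⋃ i, (e i).nodes
  | prod e => ⋃ i, (e i).nodes
  | recip _ e => ⋃ i, (e i).nodes

end TransExpr

/-! ## Recurrent neural networks -/

/-- A recurrent neural network with node set `V` and input channels `ι`.  The size is the number
of nodes.  The edges into a node `v` come from the nodes occurring in `trans v`. -/
structure RNN (ι V : Type) where
  /-- `input v = some c`: `v` is an input node, set externally to the value of channel `c`. -/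
  input : V → Option ι
  /-- the output node -/
  out : V
  /-- the transition functions (irrelevant at input nodes) -/
  trans : V → TransExpr V
  /-- the initial values (irrelevant at input nodes) -/
  init : V → ℝ
  /-- the RNN-time: every element of the input sequence is held for `time` steps -/
  time : ℕ
  time_pos : 0 < time
  /-- the hidden node set -/
  hidden : Finset V
  hidden_not_input : ∀ v ∈ hidden, input v = none
  /-- hidden nodes are updated from input nodes and hidden nodes only -/
  hidden_closed : ∀ v ∈ hidden, ∀ u ∈ (trans v).nodes, u ∈ hidden ∨ input u ≠ none

namespace RNN

variable {ι V : Type}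

/-- All transition functions are compositions of at most `c` elementary functions. -/
def CostLE (Q : RNN ι V) (c : ℕ) : Prop :=
  ∀ v, Q.input v = none → (Q.trans v).cost ≤ c

/-- The node values when the non-input nodes have the values `s` and the input is `ξ`. -/
def view (Q : RNN ι V) (ξ : ι → ℝ) (s : V → ℝ) (v : V) : ℝ :=
  match Q.input v with
  | some c => ξ c
  | none => s v

/-- One simultaneous update of all nodes. -/
noncomputable def step (Q : RNN ι V) (ξ : ι → ℝ) (s : V → ℝ) : V → ℝ :=
  fun v => (Q.trans v).eval (Q.view ξ s)

/-- The next update takes no reciprocal of zero. -/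
def StepDefined (Q : RNN ι V) (ξ : ι → ℝ) (s : V → ℝ) : Prop :=
  ∀ v, Q.input v = none → (Q.trans v).Defined (Q.view ξ s)

/-- The state after `t` updates from the state `s`, on the input sequence `ξ 0, ξ 1, …`, each
element of which is held for `Q.time` steps. -/
noncomputable def runFrom (Q : RNN ι V) (ξ : ℕ → ι → ℝ) (s : V → ℝ) : ℕ → V → ℝ
  | 0 => s
  | t + 1 => Q.step (ξ (t / Q.time)) (Q.runFrom ξ s t)

/-- Started in the state `s`, the network shows `y` at its output node in the last of the
`l * Q.time` time steps in which it is given `ξ 0, …, ξ (l - 1)`, and until then takes no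
reciprocal of zero. -/
def Yields (Q : RNN ι V) (ξ : ℕ → ι → ℝ) (s : V → ℝ) (l : ℕ) (y : ℝ) : Prop :=
  (∀ t, t + 1 < l * Q.time → Q.StepDefined (ξ (t / Q.time)) (Q.runFrom ξ s t)) ∧
    Q.view (ξ (l - 1)) (Q.runFrom ξ s (l * Q.time - 1)) Q.out = y

/-- The RNN function takes the value `y` on the sequence `ξ 0, …, ξ (l - 1)`, and the hidden node
set is sufficient on it: at the arrival of any element `ξ j`, the values of the hidden nodes and
the remaining inputs determine the result, whatever values the other nodes are given then. -/
def Computes (Q : RNN ι V) (ξ : ℕ → ι → ℝ) (l : ℕ) (y : ℝ) : Prop :=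
  Q.Yields ξ Q.init l y ∧
    ∀ j < l, ∀ s : V → ℝ, (∀ v ∈ Q.hidden, s v = Q.runFrom ξ Q.init (j * Q.time) v) →
      Q.Yields (fun a => ξ (j + a)) s (l - j) y

end RNN

/-! ## Language models -/

/-- A language model for texts of length `n` over the alphabet `{0, …, m - 1}`: `prob s y` is the
probability of the token `y` after the prefix `s` (meaningful for prefixes shorter than `n`). -/
structure LangModel (m n : ℕ) where
  prob : List (Fin m) → Fin m → ℝ
  nonneg : ∀ s, s.length < n → ∀ y, 0 ≤ prob s y
  sum_eq_one : ∀ s, s.length < n → ∑ y, prob s y = 1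

/-- The first `i` tokens of a text. -/
def textPrefix {m n : ℕ} (x : Fin n → Fin m) (i : ℕ) : List (Fin m) :=
  (List.ofFn x).take i

/-- `-log r` for a probability `r`, infinite at `r = 0`. -/
noncomputable def negLog (r : ℝ) : ENNReal :=
  if r = 0 then ⊤ else ENNReal.ofReal (-Real.log r)

namespace LangModel

variable {m n : ℕ}

/-- The probability that the model gives to the token of the text `x` at position `i`, given the
tokens of `x` before it. -/
def next (q : LangModel m n) (x : Fin n → Fin m) (i : Fin n) : ℝ :=
  q.prob (textPrefix x i) (x i)

/-- The text distribution of a language model. -/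
noncomputable def text (q : LangModel m n) (x : Fin n → Fin m) : ℝ :=
  ∏ i, q.next x i

/-- The next-token loss of `q` when the texts are drawn from the distribution of `p`; it is
infinite if `q` excludes a text that `p` does not exclude. -/
noncomputable def loss (p q : LangModel m n) : ENNReal :=
  ∑ x : Fin n → Fin m, ENNReal.ofReal (p.text x) * ((∑ i, negLog (q.next x i)) / (n : ENNReal))

/-- The conditional expectation of `f` under the text distribution of `q`, given that the tokens
before position `i` are those of `y`. -/
noncomputable def condExp (q : LangModel m n) (i : Fin n) (y : Fin n → Fin m)
    (f : (Fin n → Fin m) → ℝ) : ℝ :=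
  ∑ x : Fin n → Fin m with ∀ j < i, x j = y j,
    (∏ j : Fin n with i ≤ j, q.next x j) * f x

end LangModel

/-! ## Next-`k`-token distinguishers -/

/-- A next-`k`-token distinguisher; the value at position `i` of a text depends only on the tokens
before position `i` and on the window of (at most) `k` tokens that starts there. -/
structure Distinguisher (m n k : ℕ) where
  val : Fin n → (Fin n → Fin m) → ℝ
  zero_or_one : ∀ i x, val i x = 0 ∨ val i x = 1
  window : ∀ (i : Fin n) (x y : Fin n → Fin m),
    (∀ j : Fin n, (j : ℕ) < (i : ℕ) + k → x j = y j) → val i x = val i y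

/-- The advantage of `d` in distinguishing the text distributions of `p` and `q`. -/
noncomputable def Distinguisher.advantage {m n k : ℕ} (d : Distinguisher m n k)
    (p q : LangModel m n) : ℝ :=
  ∑ y : Fin n → Fin m, p.text y *
    ((1 / (n : ℝ)) * ∑ i, (q.condExp i y (d.val i) - d.val i y))

/-! ## Language models and distinguishers given by networks -/

/-- The number fed to a network for the token at position `a` of the text `x`. -/
def tokenValue {m n : ℕ} (x : Fin n → Fin m) (a : ℕ) : ℝ :=
  if h : a < n then ((x ⟨a, h⟩ : ℕ) : ℝ) else 0

/-- The network `Q` represents the language model `q`: having read a token, it outputs the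
probability that `q` gives to that token after the tokens read before. -/
def RNN.RepresentsLM {m n : ℕ} {V : Type} (Q : RNN Unit V) (q : LangModel m n) : Prop :=
  ∀ (x : Fin n → Fin m) (i : Fin n),
    Q.Computes (fun a _ => tokenValue x a) ((i : ℕ) + 1) (q.next x i)

/-- The inputs of a network for a distinguisher: the text and the index of the window. -/
inductive DistInput : Type
  | token
  | index

/-- The input sequence for the pair `(i, x)`: the tokens of `x`, and the index (counted from `1`)
from the first token of the window on; before the window the index input is `0`. -/
def distStream {m n : ℕ} (i : Fin n) (x : Fin n → Fin m) (a : ℕ) : DistInput → ℝ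
  | DistInput.token => tokenValue x a
  | DistInput.index => if a < (i : ℕ) then 0 else (i : ℝ) + 1

/-- The network `D` represents the distinguisher `d`: for every index `i` and text `x` it outputs
`d i x` when it has read `x` up to the end of the window at `i` (or the end of the text). -/
def RNN.RepresentsDist {m n k : ℕ} {V : Type} (D : RNN DistInput V)
    (d : Distinguisher m n k) : Prop :=
  ∀ (i : Fin n) (x : Fin n → Fin m),
    D.Computes (distStream i x) (min ((i : ℕ) + k) n) (d.val i x)

/-! The gain. Let `β = α / 2` and `g_i = exp (-β d_i)`. If the tokens of the window at `i` are drawn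
from `q` with density proportional to `g_i`, the log-likelihood of a text `x` changes by `log g_i(x)
- log E_q[g_i | x_{<i}]`. Since `log t ≤ t - 1` and `exp (-β) ≤ 1 - β + β²`, this is at least `β
(E_q[d_i | x_{<i}] - d_i(x)) - β²`. Averaged over `i` and over the texts of `p` this gives `βα - β²
= α² / 4`. Overlapping windows cannot be reweighted independently, but windows whose starts agree
modulo `k` are disjoint, and some residue class `o` has at least the share `α² / 4k`. The model `q'`
reweights the blocks that start at `o`, `o + k`, …. Its next-token probability is that of `q` times
a quotient of consecutive conditional expectations of `g_i`, so that the product over a block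
telescopes (`sum_log_blockWeight`, `exists_loss_reweight_le`).

The network. The two conditional expectations are sums over windows, and these can be enumerated
within the time for one token: one round for each of the `m ^ k` windows, with a slot for each of
its tokens. The hidden nodes of `Q` and `D` at the start of the block are kept in saved copies. In
every round, running copies are loaded from them, with `0` at all other nodes; by sufficiency of the
hidden nodes the outputs are still right. They read the known tokens of the block and then the
window of the round. The product of the probabilities and the weight is added to a denominator and,
if the window agrees with the token received, to a numerator. Digits of the window that play no role
multiply both sums by the same power of `m` (`sum_windowTerm_div`). One further round outputs the
quotient and, at the end of a block, takes the saved copies through it.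

Two obstacles come from the form of transition functions. An idle copy may hold values at which the
simulated network divides by zero; `guard` turns such denominators into `1`. A ReLU is nonnegative
while node values need not be; `lin` recovers a value `v` as `|v| |v - ε| / (v - ε)`, which is right
if `v ≤ 0` or `v > ε`. Only finitely many texts, times and nodes occur, so a suitable `ε` exists
(`exists_gap`).

Correctness is proved by induction on time with the invariants `HiddenOK` and `VisibleOK`. The
second is vacuous when a token arrives, which is why the hidden nodes of the new network suffice. -/

namespace TransExpr

variable {V W : Type}

/-! ### Elementary functions of lists of arguments -/

/-- ReLU of a linear form given as a list of weighted arguments. -/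
noncomputable def reluL (l : List (ℝ × TransExpr V)) : TransExpr V :=
  relu (fun i : Fin l.length => (l.get i).1) (fun i => (l.get i).2)

/-- The product of a list of arguments. -/
noncomputable def prodL (l : List (TransExpr V)) : TransExpr V :=
  prod (fun i : Fin l.length => l.get i)

/-- The reciprocal of a linear form given as a list of weighted arguments. -/
noncomputable def recipL (l : List (ℝ × TransExpr V)) : TransExpr V :=
  recip (fun i : Fin l.length => (l.get i).1) (fun i => (l.get i).2)

/-- The value of a linear form given as a list of weighted arguments. -/
noncomputable def linVal (s : V → ℝ) (l : List (ℝ × TransExpr V)) : ℝ :=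
  (l.map fun p => p.1 * p.2.eval s).sum

/-- The total cost of the arguments of a linear form. -/
def linCost (l : List (ℝ × TransExpr V)) : ℕ := (l.map fun p => p.2.cost).sum

theorem sum_get {α M : Type*} [AddCommMonoid M] (l : List α) (f : α → M) :
    ∑ i : Fin l.length, f (l.get i) = (l.map f).sum := by
  induction l with
  | nil => simp
  | cons a l ih =>
    rw [List.map_cons, List.sum_cons, ← ih]
    exact Fin.sum_univ_succ (n := l.length) fun i => f ((a :: l).get i)

theorem prod_get {α M : Type*} [CommMonoid M] (l : List α) (f : α → M) :
    ∏ i : Fin l.length, f (l.get i) = (l.map f).prod := by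
  induction l with
  | nil => simp
  | cons a l ih =>
    rw [List.map_cons, List.prod_cons, ← ih]
    exact Fin.prod_univ_succ (n := l.length) fun i => f ((a :: l).get i)

theorem forall_get {α : Type*} (l : List α) (p : α → Prop) :
    (∀ i : Fin l.length, p (l.get i)) ↔ ∀ a ∈ l, p a := by
  constructor
  · intro h a ha
    obtain ⟨i, rfl⟩ := List.get_of_mem ha
    exact h i
  · intro h i
    exact h _ (List.get_mem l i)

@[simp] theorem linVal_nil (s : V → ℝ) : linVal s [] = 0 := rfl

@[simp] theorem linVal_cons (s : V → ℝ) (p : ℝ × TransExpr V) (l : List (ℝ × TransExpr V)) :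
    linVal s (p :: l) = p.1 * p.2.eval s + linVal s l := rfl

@[simp] theorem linCost_nil : linCost ([] : List (ℝ × TransExpr V)) = 0 := rfl

@[simp] theorem linCost_cons (p : ℝ × TransExpr V) (l : List (ℝ × TransExpr V)) :
    linCost (p :: l) = p.2.cost + linCost l := rfl

@[simp] theorem eval_node (s : V → ℝ) (v : V) : (node v).eval s = s v := rfl

@[simp] theorem eval_reluL (s : V → ℝ) (l : List (ℝ × TransExpr V)) :
    (reluL l).eval s = max 0 (linVal s l) := by
  simp only [reluL, eval, linVal]
  rw [sum_get l fun p => p.1 * p.2.eval s]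

@[simp] theorem eval_prodL (s : V → ℝ) (l : List (TransExpr V)) :
    (prodL l).eval s = (l.map fun e => e.eval s).prod := by
  simp only [prodL, eval]
  rw [prod_get l fun e => e.eval s]

@[simp] theorem eval_recipL (s : V → ℝ) (l : List (ℝ × TransExpr V)) :
    (recipL l).eval s = (linVal s l)⁻¹ := by
  simp only [recipL, eval, linVal, one_div]
  rw [sum_get l fun p => p.1 * p.2.eval s]

@[simp] theorem cost_node (v : V) : (node v).cost = 0 := rfl

@[simp] theorem cost_reluL (l : List (ℝ × TransExpr V)) :
    (reluL l).cost = 1 + linCost l := by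
  simp only [reluL, cost, linCost]
  rw [sum_get l fun p => p.2.cost]

@[simp] theorem cost_prodL (l : List (TransExpr V)) :
    (prodL l).cost = 1 + (l.map cost).sum := by
  simp only [prodL, cost]
  rw [sum_get l cost]

@[simp] theorem cost_recipL (l : List (ℝ × TransExpr V)) :
    (recipL l).cost = 1 + linCost l := by
  simp only [recipL, cost, linCost]
  rw [sum_get l fun p => p.2.cost]

@[simp] theorem defined_node (s : V → ℝ) (v : V) : (node v).Defined s := trivial

@[simp] theorem defined_reluL (s : V → ℝ) (l : List (ℝ × TransExpr V)) :
    (reluL l).Defined s ↔ ∀ p ∈ l, p.2.Defined s := by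
  simp only [reluL, Defined]
  exact forall_get l fun p => p.2.Defined s

@[simp] theorem defined_prodL (s : V → ℝ) (l : List (TransExpr V)) :
    (prodL l).Defined s ↔ ∀ e ∈ l, e.Defined s := by
  simp only [prodL, Defined]
  exact forall_get l fun e => e.Defined s

@[simp] theorem defined_recipL (s : V → ℝ) (l : List (ℝ × TransExpr V)) :
    (recipL l).Defined s ↔ (∀ p ∈ l, p.2.Defined s) ∧ linVal s l ≠ 0 := by
  simp only [recipL, Defined, linVal]
  rw [sum_get l fun p => p.1 * p.2.eval s]
  exact and_congr_left' (forall_get l fun p => p.2.Defined s)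

@[simp] theorem nodes_node_subset (A : Set V) (v : V) : (node v).nodes ⊆ A ↔ v ∈ A := by
  simp [nodes]

@[simp] theorem nodes_reluL_subset (A : Set V) (l : List (ℝ × TransExpr V)) :
    (reluL l).nodes ⊆ A ↔ ∀ p ∈ l, p.2.nodes ⊆ A := by
  simp only [reluL, nodes, Set.iUnion_subset_iff]
  exact forall_get l fun p => p.2.nodes ⊆ A

@[simp] theorem nodes_prodL_subset (A : Set V) (l : List (TransExpr V)) :
    (prodL l).nodes ⊆ A ↔ ∀ e ∈ l, e.nodes ⊆ A := by
  simp only [prodL, nodes, Set.iUnion_subset_iff]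
  exact forall_get l fun e => e.nodes ⊆ A

@[simp] theorem nodes_recipL_subset (A : Set V) (l : List (ℝ × TransExpr V)) :
    (recipL l).nodes ⊆ A ↔ ∀ p ∈ l, p.2.nodes ⊆ A := by
  simp only [recipL, nodes, Set.iUnion_subset_iff]
  exact forall_get l fun p => p.2.nodes ⊆ A

theorem eval_congr {s s' : V → ℝ} (e : TransExpr V) (h : ∀ v ∈ e.nodes, s v = s' v) :
    e.eval s = e.eval s' := by
  induction e with
  | node v => exact h v rfl
  | relu w e ih | prod e ih | recip w e ih =>
    have := fun i => ih i fun v hv => h v (Set.mem_iUnion.2 ⟨i, hv⟩)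
    simp only [eval, this]

theorem defined_congr {s s' : V → ℝ} (e : TransExpr V) (h : ∀ v ∈ e.nodes, s v = s' v) :
    e.Defined s ↔ e.Defined s' := by
  induction e with
  | node v => exact Iff.rfl
  | relu w e ih | prod e ih =>
    exact forall_congr' fun i => ih i fun v hv => h v (Set.mem_iUnion.2 ⟨i, hv⟩)
  | recip w e ih =>
    have h1 := fun i => ih i fun v hv => h v (Set.mem_iUnion.2 ⟨i, hv⟩)
    have h2 := fun i => eval_congr (e i) fun v hv => h v (Set.mem_iUnion.2 ⟨i, hv⟩)
    simp only [Defined, h1, h2]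

/-! ### Constants, comparisons, case distinctions -/

/-- The constant `1`. -/
noncomputable def one : TransExpr V := prodL []

@[simp] theorem eval_one (s : V → ℝ) : (one : TransExpr V).eval s = 1 := by simp [one]
@[simp] theorem cost_one : (one : TransExpr V).cost = 1 := by simp [one]
@[simp] theorem defined_one (s : V → ℝ) : (one : TransExpr V).Defined s := by simp [one]
@[simp] theorem nodes_one (A : Set V) : (one : TransExpr V).nodes ⊆ A := by simp [one]

/-- A constant natural number. -/
noncomputable def nat (a : ℕ) : TransExpr V := reluL [((a : ℝ), one)]

@[simp] theorem eval_nat (s : V → ℝ) (a : ℕ) : (nat a : TransExpr V).eval s = a := by simp [nat]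
@[simp] theorem cost_nat (a : ℕ) : (nat a : TransExpr V).cost = 2 := by simp [nat]
@[simp] theorem defined_nat (s : V → ℝ) (a : ℕ) : (nat a : TransExpr V).Defined s := by simp [nat]
@[simp] theorem nodes_nat (A : Set V) (a : ℕ) : (nat a : TransExpr V).nodes ⊆ A := by simp [nat]

/-- The sum of two nonnegative values. -/
noncomputable def add (e f : TransExpr V) : TransExpr V := reluL [(1, e), (1, f)]

theorem eval_add {s : V → ℝ} {e f : TransExpr V} {a b : ℕ} (he : e.eval s = a)
    (hf : f.eval s = b) : (add e f).eval s = ((a + b : ℕ) : ℝ) := by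
  simp only [add, eval_reluL, linVal_cons, linVal_nil, he, hf, one_mul, add_zero, Nat.cast_add]
  exact max_eq_right (by positivity)

/-- The multiple of a natural value. -/
noncomputable def smul (c : ℕ) (e : TransExpr V) : TransExpr V := reluL [((c : ℝ), e)]

theorem eval_smul {s : V → ℝ} {e : TransExpr V} {a : ℕ} (c : ℕ) (he : e.eval s = a) :
    (smul c e).eval s = ((c * a : ℕ) : ℝ) := by
  simp only [smul, eval_reluL, linVal_cons, linVal_nil, he, add_zero, Nat.cast_mul]
  exact max_eq_right (by positivity)

/-- The truncated difference of two values. -/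
noncomputable def sub (e f : TransExpr V) : TransExpr V := reluL [(1, e), (-1, f)]

theorem max_zero_sub_natCast (a b : ℕ) : max 0 ((a : ℝ) - b) = ((a - b : ℕ) : ℝ) := by
  rcases le_total a b with h | h
  · rw [Nat.sub_eq_zero_of_le h, Nat.cast_zero, max_eq_left]
    exact sub_nonpos.2 (Nat.cast_le.2 h)
  · rw [Nat.cast_sub h, max_eq_right]
    exact sub_nonneg.2 (Nat.cast_le.2 h)

theorem eval_sub {s : V → ℝ} {e f : TransExpr V} {a b : ℕ} (he : e.eval s = a)
    (hf : f.eval s = b) : (sub e f).eval s = ((a - b : ℕ) : ℝ) := by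
  rw [← max_zero_sub_natCast]
  simp [sub, he, hf, sub_eq_add_neg]

/-- The indicator of `¬ p`, given that of `p`. -/
noncomputable def not (e : TransExpr V) : TransExpr V := reluL [(1, one), (-1, e)]

theorem eval_not {s : V → ℝ} {e : TransExpr V} {p : Prop} [Decidable p]
    (he : e.eval s = if p then 1 else 0) : (not e).eval s = if ¬p then 1 else 0 := by
  by_cases h : p <;> simp [not, he, h]

/-- The indicator of `p ∧ q`, given those of `p` and `q`. -/
noncomputable def and (e f : TransExpr V) : TransExpr V := prodL [e, f]

theorem eval_and {s : V → ℝ} {e f : TransExpr V} {p q : Prop} [Decidable p] [Decidable q]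
    (he : e.eval s = if p then 1 else 0) (hf : f.eval s = if q then 1 else 0) :
    (and e f).eval s = if p ∧ q then 1 else 0 := by
  by_cases h : p <;> by_cases h' : q <;> simp [and, he, hf, h, h']

/-- The indicator of `∀ i, p i`, given those of all `p i`. -/
noncomputable def all {r : ℕ} (e : Fin r → TransExpr V) : TransExpr V := prod e

theorem eval_all {s : V → ℝ} {r : ℕ} {e : Fin r → TransExpr V} {p : Fin r → Prop}
    [∀ i, Decidable (p i)] (he : ∀ i, (e i).eval s = if p i then 1 else 0) :
    (all e).eval s = if ∀ i, p i then 1 else 0 := by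
  simp only [all, eval, he]
  split_ifs with h
  · exact Finset.prod_eq_one fun i _ => if_pos (h i)
  · obtain ⟨i, hi⟩ := not_forall.1 h
    exact Finset.prod_eq_zero (Finset.mem_univ i) (if_neg hi)

/-- The indicator of `a < b` for natural values. -/
noncomputable def lt (e f : TransExpr V) : TransExpr V := not (not (sub f e))

/-- A truncated difference of naturals is `0` or at least `1`, so two negations clamp it to an
indicator. -/
theorem eval_lt {s : V → ℝ} {e f : TransExpr V} {a b : ℕ} (he : e.eval s = a)
    (hf : f.eval s = b) : (lt e f).eval s = if a < b then 1 else 0 := by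
  have h := eval_sub hf he
  simp only [lt, not, eval_reluL, linVal_cons, linVal_nil, h, eval_one]
  split_ifs with hab
  · have : (1 : ℝ) ≤ ((b - a : ℕ) : ℝ) := by exact_mod_cast Nat.sub_pos_of_lt hab
    rw [max_eq_left (a := (0 : ℝ)) (b := 1 * 1 + (-1 * ((b - a : ℕ) : ℝ) + 0)) (by linarith)]
    norm_num
  · rw [Nat.sub_eq_zero_of_le (not_lt.1 hab)]
    norm_num

/-- The indicator of `a = b` for natural values. -/
noncomputable def eq (e f : TransExpr V) : TransExpr V := and (not (lt e f)) (not (lt f e))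

theorem eval_eq {s : V → ℝ} {e f : TransExpr V} {a b : ℕ} (he : e.eval s = a)
    (hf : f.eval s = b) : (eq e f).eval s = if a = b then 1 else 0 := by
  rw [eq, eval_and (eval_not (eval_lt he hf)) (eval_not (eval_lt hf he))]
  exact if_congr (by omega) rfl rfl

/-- The nonnegative value of `e` or of `f`, depending on the indicator `c`. -/
noncomputable def ite (c e f : TransExpr V) : TransExpr V :=
  reluL [(1, prodL [c, e]), (1, prodL [not c, f])]

/-- The `max 0` is the price of adding by a ReLU: `ite` is exact for nonnegative values only, and
values of either sign need `mux`. -/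
theorem eval_ite {s : V → ℝ} {c e f : TransExpr V} {p : Prop} [Decidable p]
    (hc : c.eval s = if p then 1 else 0) :
    (ite c e f).eval s = max 0 (if p then e.eval s else f.eval s) := by
  have h := eval_not hc
  by_cases hp : p <;> simp [ite, hc, h, hp]

theorem eval_ite_nat {s : V → ℝ} {c e f : TransExpr V} {p : Prop} [Decidable p] {a b : ℕ}
    (hc : c.eval s = if p then 1 else 0) (he : e.eval s = a) (hf : f.eval s = b) :
    (ite c e f).eval s = ((if p then a else b : ℕ) : ℝ) := by
  rw [eval_ite hc, he, hf]
  split_ifs <;> simp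

/-- The nonnegative value of `e i` for the `i` with value `a` of `x`. -/
noncomputable def pick {r : ℕ} (x : TransExpr V) (e : Fin r → TransExpr V) : TransExpr V :=
  relu (fun _ => 1) fun i : Fin r => and (eq x (nat i)) (e i)

theorem eval_pick {s : V → ℝ} {r : ℕ} {x : TransExpr V} {e : Fin r → TransExpr V} (a : Fin r)
    (hx : x.eval s = ((a : ℕ) : ℝ)) : (pick x e).eval s = max 0 ((e a).eval s) := by
  simp only [pick, eval, one_mul]
  rw [Finset.sum_eq_single a]
  · simp [and, eval_eq hx (eval_nat s a)]
  · intro i _ hi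
    have : (a : ℕ) ≠ i := fun h => hi (Fin.ext h.symm)
    simp [and, eval_eq hx (eval_nat s i), this]
  · simp

section
variable (s : V → ℝ) (A : Set V) (e f c : TransExpr V)

@[simp] theorem defined_add : (add e f).Defined s ↔ e.Defined s ∧ f.Defined s := by simp [add]
@[simp] theorem defined_smul (a : ℕ) : (smul a e).Defined s ↔ e.Defined s := by simp [smul]
@[simp] theorem defined_sub : (sub e f).Defined s ↔ e.Defined s ∧ f.Defined s := by simp [sub]
@[simp] theorem defined_not : (not e).Defined s ↔ e.Defined s := by simp [not]
@[simp] theorem defined_and : (and e f).Defined s ↔ e.Defined s ∧ f.Defined s := by simp [and]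
@[simp] theorem defined_lt : (lt e f).Defined s ↔ f.Defined s ∧ e.Defined s := by simp [lt]
@[simp] theorem defined_eq : (eq e f).Defined s ↔ e.Defined s ∧ f.Defined s := by
  simp [eq]; tauto
@[simp] theorem defined_ite :
    (ite c e f).Defined s ↔ c.Defined s ∧ e.Defined s ∧ f.Defined s := by
  simp [ite]; tauto
@[simp] theorem defined_all {r : ℕ} (e : Fin r → TransExpr V) :
    (all e).Defined s ↔ ∀ i, (e i).Defined s := Iff.rfl
theorem defined_pick {r : ℕ} {e : Fin r → TransExpr V} (hc : c.Defined s)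
    (h : ∀ i, (e i).Defined s) : (pick c e).Defined s := fun i => by simp [hc, h]

@[simp] theorem nodes_add : (add e f).nodes ⊆ A ↔ e.nodes ⊆ A ∧ f.nodes ⊆ A := by simp [add]
@[simp] theorem nodes_smul (a : ℕ) : (smul a e).nodes ⊆ A ↔ e.nodes ⊆ A := by simp [smul]
@[simp] theorem nodes_sub : (sub e f).nodes ⊆ A ↔ e.nodes ⊆ A ∧ f.nodes ⊆ A := by simp [sub]
@[simp] theorem nodes_not : (not e).nodes ⊆ A ↔ e.nodes ⊆ A := by simp [not]
@[simp] theorem nodes_and : (and e f).nodes ⊆ A ↔ e.nodes ⊆ A ∧ f.nodes ⊆ A := by simp [and]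
@[simp] theorem nodes_lt : (lt e f).nodes ⊆ A ↔ f.nodes ⊆ A ∧ e.nodes ⊆ A := by simp [lt]
@[simp] theorem nodes_eq : (eq e f).nodes ⊆ A ↔ e.nodes ⊆ A ∧ f.nodes ⊆ A := by
  simp [eq]; tauto
@[simp] theorem nodes_ite :
    (ite c e f).nodes ⊆ A ↔ c.nodes ⊆ A ∧ e.nodes ⊆ A ∧ f.nodes ⊆ A := by
  simp [ite]; tauto
@[simp] theorem nodes_all {r : ℕ} (e : Fin r → TransExpr V) :
    (all e).nodes ⊆ A ↔ ∀ i, (e i).nodes ⊆ A := by simp [all, nodes]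
theorem nodes_pick {r : ℕ} {e : Fin r → TransExpr V} (hc : c.nodes ⊆ A)
    (h : ∀ i, (e i).nodes ⊆ A) : (pick c e).nodes ⊆ A := by
  simp only [pick, nodes, Set.iUnion_subset_iff]
  exact fun i => by simp [hc, h]

@[simp] theorem cost_add : (add e f).cost = 1 + (e.cost + f.cost) := by simp [add]
@[simp] theorem cost_smul (a : ℕ) : (smul a e).cost = 1 + e.cost := by simp [smul]
@[simp] theorem cost_sub : (sub e f).cost = 1 + (e.cost + f.cost) := by simp [sub]
@[simp] theorem cost_not : (not e).cost = 2 + e.cost := by simp [not]; ring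
@[simp] theorem cost_and : (and e f).cost = 1 + (e.cost + f.cost) := by simp [and]
@[simp] theorem cost_lt : (lt e f).cost = 5 + (e.cost + f.cost) := by simp [lt]; ring
@[simp] theorem cost_eq : (eq e f).cost = 15 + 2 * (e.cost + f.cost) := by simp [eq]; ring
@[simp] theorem cost_ite : (ite c e f).cost = 5 + (2 * c.cost + e.cost + f.cost) := by
  simp [ite]; ring
theorem cost_all_le {r b : ℕ} {e : Fin r → TransExpr V} (h : ∀ i, (e i).cost ≤ b) :
    (all e).cost ≤ 1 + r * b := by
  simp only [all, cost]
  have := Finset.sum_le_card_nsmul Finset.univ (fun i => (e i).cost) b fun i _ => h i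
  simpa using this
theorem cost_pick_le {r b : ℕ} {e : Fin r → TransExpr V} (h : ∀ i, (e i).cost ≤ b) :
    (pick c e).cost ≤ 1 + r * (20 + 2 * c.cost + b) := by
  simp only [pick, cost]
  have := Finset.sum_le_card_nsmul Finset.univ (fun i : Fin r => (and (eq c (nat i)) (e i)).cost)
    (20 + 2 * c.cost + b) fun i _ => by simp; linarith [h i]
  simpa using this
end

/-! ### Guarded copies of transition functions -/

/-- The negative of a linear form. -/
noncomputable def neg {r : ℕ} (w : Fin r → ℝ) : Fin r → ℝ := fun i => -w i

/-- A copy of an expression over other nodes, with every reciprocal replaced by `1` when the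
indicator `σ` is `0`. -/
noncomputable def guard (σ : TransExpr W) (ρ : V → W) : TransExpr V → TransExpr W
  | node v => node (ρ v)
  | relu w e => relu w fun i => guard σ ρ (e i)
  | prod e => prod fun i => guard σ ρ (e i)
  -- With `L` the linear form, the denominator is `σ max(0, L) - σ max(0, -L) + (1 - σ)`, that is,
  -- `L` for `σ = 1` and `1` for `σ = 0`. The split into two parts is needed because a bare linear
  -- form is not an elementary function.
  | recip w e => recipL [(1, prodL [σ, relu w fun i => guard σ ρ (e i)]),
      (-1, prodL [σ, relu (neg w) fun i => guard σ ρ (e i)]), (1, not σ)]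

theorem max_zero_sub_max_zero_neg (x : ℝ) : max 0 x - max 0 (-x) = x := by
  rcases le_total 0 x with h | h
  · rw [max_eq_right h, max_eq_left (by linarith)]; ring
  · rw [max_eq_left h, max_eq_right (by linarith)]; ring

theorem eval_guard_denom {s : W → ℝ} {σ : TransExpr W} (hσ : σ.eval s = 1) {r : ℕ}
    (w : Fin r → ℝ) (e : Fin r → TransExpr W) :
    linVal s [(1, prodL [σ, relu w e]), (-1, prodL [σ, relu (neg w) e]), (1, not σ)] =
      ∑ i, w i * (e i).eval s := by
  have := max_zero_sub_max_zero_neg (∑ i, w i * (e i).eval s)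
  simp [not, hσ, eval, neg]
  linarith

theorem eval_guard {s : W → ℝ} {σ : TransExpr W} (hσ : σ.eval s = 1) (ρ : V → W)
    (e : TransExpr V) : (guard σ ρ e).eval s = e.eval fun v => s (ρ v) := by
  induction e with
  | node v => rfl
  | relu w e ih | prod e ih => simp only [guard, eval, ih]
  | recip w e ih =>
    simp only [guard, eval_recipL]
    rw [eval_guard_denom hσ]
    simp only [eval, ih, one_div]

theorem defined_guard_of_one {s : W → ℝ} {σ : TransExpr W} (hσ : σ.eval s = 1)
    (hσ' : σ.Defined s) (ρ : V → W) (e : TransExpr V) (he : e.Defined fun v => s (ρ v)) :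
    (guard σ ρ e).Defined s := by
  induction e with
  | node v => trivial
  | relu w e ih | prod e ih => exact fun i => ih i (he i)
  | recip w e ih =>
    have h : ∀ i, (guard σ ρ (e i)).Defined s := fun i => ih i (he.1 i)
    simp only [guard, defined_recipL]
    rw [eval_guard_denom hσ]
    refine ⟨by simp [hσ', Defined, h], ?_⟩
    simpa only [eval_guard hσ] using he.2

/-- Nothing is assumed about the node values: every denominator is `1`, so an idle copy may hold
arbitrary numbers. -/
theorem defined_guard_of_zero {s : W → ℝ} {σ : TransExpr W} (hσ : σ.eval s = 0)
    (hσ' : σ.Defined s) (ρ : V → W) (e : TransExpr V) : (guard σ ρ e).Defined s := by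
  induction e with
  | node v => trivial
  | relu w e ih | prod e ih => exact fun i => ih i
  | recip w e ih =>
    simp only [guard, defined_recipL]
    refine ⟨by simp [hσ', Defined, ih], ?_⟩
    simp [hσ, not]

theorem nodes_guard {A : Set W} {σ : TransExpr W} (hσ : σ.nodes ⊆ A) {ρ : V → W}
    (e : TransExpr V) (he : ∀ v ∈ e.nodes, ρ v ∈ A) : (guard σ ρ e).nodes ⊆ A := by
  induction e with
  | node v => simpa [guard] using he v rfl
  | relu w e ih | prod e ih =>
    simp only [guard, nodes, Set.iUnion_subset_iff]
    exact fun i => ih i fun v hv => he v (Set.mem_iUnion.2 ⟨i, hv⟩)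
  | recip w e ih =>
    have h : ∀ i, (guard σ ρ (e i)).nodes ⊆ A :=
      fun i => ih i fun v hv => he v (Set.mem_iUnion.2 ⟨i, hv⟩)
    simp [guard, nodes, hσ, h]

/-- Superadditivity, from `(1 + x)(1 + y) - 1 ≥ x + y`; it passes the bound of `cost_guard_le` from
the arguments to a composition. -/
theorem sum_two_pow_sub_one_le {r : ℕ} (a : Fin r → ℕ) :
    ∑ i, (2 ^ a i - 1) ≤ 2 ^ (∑ i, a i) - 1 := by
  induction r with
  | zero => simp
  | succ r ih =>
    rw [Fin.sum_univ_succ, Fin.sum_univ_succ, pow_add]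
    have h := ih fun i => a i.succ
    have h1 : 1 ≤ 2 ^ a 0 := Nat.one_le_two_pow
    have h2 : 1 ≤ 2 ^ ∑ i : Fin r, a i.succ := Nat.one_le_two_pow
    obtain ⟨x, hx⟩ := Nat.exists_eq_add_of_le h1
    obtain ⟨y, hy⟩ := Nat.exists_eq_add_of_le h2
    rw [hy] at h ⊢
    rw [hx]
    have h0 : (1 + x) * (1 + y) - 1 = x + y + x * y := by
      rw [show (1 + x) * (1 + y) = 1 + (x + y + x * y) by ring]; omega
    rw [h0]
    rw [Nat.add_sub_cancel_left] at h ⊢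
    have := Nat.zero_le (x * y)
    omega

/-- A guarded reciprocal contains its arguments twice, so the cost may double at each level of
nesting; hence the power of `2`. -/
theorem cost_guard_le (σ : TransExpr W) (ρ : V → W) (e : TransExpr V) :
    (guard σ ρ e).cost ≤ (7 + 3 * σ.cost) * (2 ^ e.cost - 1) := by
  induction e with
  | node v => simp [guard]
  | relu w e ih | prod e ih =>
    simp only [guard, cost]
    have h := (Finset.sum_le_sum fun i (_ : i ∈ Finset.univ) => ih i).trans
      ((Finset.mul_sum _ _ _).symm.le.trans
        (Nat.mul_le_mul_left _ (sum_two_pow_sub_one_le fun i => (e i).cost)))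
    have h2 : 1 ≤ 2 ^ ∑ i, (e i).cost := Nat.one_le_two_pow
    have h3 : 2 ^ (1 + ∑ i, (e i).cost) - 1 = 1 + 2 * (2 ^ (∑ i, (e i).cost) - 1) := by
      rw [pow_add]; omega
    rw [h3]
    nlinarith
  | recip w e ih =>
    have h := (Finset.sum_le_sum fun i (_ : i ∈ Finset.univ) => ih i).trans
      ((Finset.mul_sum _ _ _).symm.le.trans
        (Nat.mul_le_mul_left _ (sum_two_pow_sub_one_le fun i => (e i).cost)))
    have h2 : 1 ≤ 2 ^ ∑ i, (e i).cost := Nat.one_le_two_pow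
    have h3 : 2 ^ (1 + ∑ i, (e i).cost) - 1 = 1 + 2 * (2 ^ (∑ i, (e i).cost) - 1) := by
      rw [pow_add]; omega
    simp only [guard, cost_recipL, linCost_cons, cost_prodL, List.map_cons, List.map_nil,
      List.sum_cons, List.sum_nil, cost, cost_not, linCost_nil]
    rw [h3]
    nlinarith

/-! ### Linear forms of values of both signs -/

/-- The absolute value of a linear form. -/
noncomputable def absL (l : List (ℝ × TransExpr V)) : TransExpr V :=
  reluL [(1, reluL l), (1, reluL (l.map fun p => (-p.1, p.2)))]

theorem linVal_neg (s : V → ℝ) (l : List (ℝ × TransExpr V)) :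
    linVal s (l.map fun p => (-p.1, p.2)) = -linVal s l := by
  induction l with
  | nil => simp
  | cons a l ih => simp [ih]; ring

@[simp] theorem eval_absL (s : V → ℝ) (l : List (ℝ × TransExpr V)) :
    (absL l).eval s = |linVal s l| := by
  simp only [absL, eval_reluL, linVal_cons, linVal_nil, linVal_neg, one_mul, add_zero]
  rcases le_total 0 (linVal s l) with h | h
  · rw [max_eq_right h, max_eq_left (a := (0 : ℝ)) (b := -_) (by linarith), abs_of_nonneg h]
    simpa using h
  · rw [max_eq_left h, max_eq_right (a := (0 : ℝ)) (b := -_) (by linarith), abs_of_nonpos h]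
    simpa using h

theorem linCost_neg (l : List (ℝ × TransExpr V)) :
    linCost (l.map fun p => (-p.1, p.2)) = linCost l := by
  simp [linCost, Function.comp_def]

/-- The value of a linear form, provided that it is at most `0` or greater than `ε`. -/
noncomputable def lin (ε : ℝ) (l : List (ℝ × TransExpr V)) : TransExpr V :=
  -- If `v ≤ 0` or `v > ε`, then `|v - ε| / (v - ε)` is the sign that turns `|v|` into `v`; the
  -- shift by `ε` avoids a zero denominator at `v = 0`.
  prodL [absL l, absL ((-ε, one) :: l), recipL ((-ε, one) :: l)]

theorem eval_lin {s : V → ℝ} {ε : ℝ} (hε : 0 < ε) {l : List (ℝ × TransExpr V)}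
    (hl : 0 < linVal s l → ε < linVal s l) : (lin ε l).eval s = linVal s l := by
  simp only [lin, eval_prodL, eval_absL, eval_recipL, linVal_cons, eval_one, List.map_cons,
    List.map_nil, List.prod_cons, List.prod_nil, mul_one]
  rcases lt_or_ge 0 (linVal s l) with h | h
  · have := hl h
    rw [abs_of_pos h, abs_of_pos (by linarith), mul_inv_cancel₀ (by linarith), mul_one]
  · rw [abs_of_nonpos h, abs_of_neg (by linarith), neg_mul (-ε + _), mul_inv_cancel₀ (by linarith)]
    ring

theorem defined_lin {s : V → ℝ} {ε : ℝ} (hε : 0 < ε) {l : List (ℝ × TransExpr V)}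
    (hl : 0 < linVal s l → ε < linVal s l) (hd : ∀ p ∈ l, p.2.Defined s) :
    (lin ε l).Defined s := by
  have h : -ε + linVal s l ≠ 0 := by
    rcases lt_or_ge 0 (linVal s l) with h | h
    · have := hl h
      linarith
    · linarith
  have h1 : ∀ a b, (a, b) ∈ l → b.Defined s := fun a b => hd (a, b)
  simp [lin, absL, h]
  grind

theorem nodes_lin {A : Set V} (ε : ℝ) {l : List (ℝ × TransExpr V)}
    (h : ∀ p ∈ l, p.2.nodes ⊆ A) : (lin ε l).nodes ⊆ A := by
  have h1 : ∀ a b, (a, b) ∈ l → b.nodes ⊆ A := fun a b => h (a, b)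
  simp [lin, absL]
  grind

theorem cost_lin (ε : ℝ) (l : List (ℝ × TransExpr V)) :
    (lin ε l).cost = 11 + 5 * linCost l := by
  have := linCost_neg l
  have h2 := linCost_neg ((-ε, one) :: l)
  simp [lin, absL] at *
  rw [this]
  ring

end TransExpr

/-! ### Conditional expectations under a language model. -/

namespace LangModel

variable {m n : ℕ}

theorem textPrefix_congr {x y : Fin n → Fin m} {i : ℕ}
    (h : ∀ l : Fin n, (l : ℕ) < i → x l = y l) : textPrefix x i = textPrefix y i := by
  refine List.ext_getElem (by simp [textPrefix]) fun l hl hl' => ?_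
  simp only [textPrefix, List.length_take, List.length_ofFn, lt_min_iff] at hl
  simpa [textPrefix] using h ⟨l, hl.2⟩ hl.1

theorem next_congr (q : LangModel m n) {x y : Fin n → Fin m} {i : Fin n}
    (h : ∀ l, l ≤ i → x l = y l) : q.next x i = q.next y i := by
  rw [next, next, textPrefix_congr fun l hl => h l (Fin.lt_def.2 hl).le, h i le_rfl]

theorem length_textPrefix (x : Fin n → Fin m) (i : Fin n) :
    (textPrefix x i).length = i := by
  simp [textPrefix, i.2.le]

theorem next_nonneg (q : LangModel m n) (x : Fin n → Fin m) (i : Fin n) : 0 ≤ q.next x i :=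
  q.nonneg _ (by rw [length_textPrefix]; exact i.2) _

theorem next_update (q : LangModel m n) (x : Fin n → Fin m) (i : Fin n) (a : Fin m) :
    q.next (Function.update x i a) i = q.prob (textPrefix x i) a := by
  rw [next, Function.update_self]
  congr 1
  exact textPrefix_congr fun l hl =>
    Function.update_of_ne (fun h => absurd (congrArg Fin.val h) hl.ne) _ _

theorem sum_next_update (q : LangModel m n) (x : Fin n → Fin m) (i : Fin n) :
    ∑ a, q.next (Function.update x i a) i = 1 := by
  simp only [next_update]
  exact q.sum_eq_one _ (by rw [length_textPrefix]; exact i.2)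

theorem next_le_one (q : LangModel m n) (x : Fin n → Fin m) (i : Fin n) : q.next x i ≤ 1 := by
  rw [← q.sum_next_update x i]
  have := Finset.single_le_sum (f := fun a => q.next (Function.update x i a) i)
    (fun a _ => q.next_nonneg _ i) (Finset.mem_univ (x i))
  simpa using this

/-- The conditional expectation of `f`, given the tokens of `y` at the positions before `i`. -/
noncomputable def cexp (q : LangModel m n) (i : ℕ) (y : Fin n → Fin m)
    (f : (Fin n → Fin m) → ℝ) : ℝ :=
  ∑ x : Fin n → Fin m with ∀ l : Fin n, (l : ℕ) < i → x l = y l,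
    (∏ l ∈ Finset.univ.filter fun l : Fin n => i ≤ (l : ℕ), q.next x l) * f x

theorem condExp_eq_cexp (q : LangModel m n) (i : Fin n) (y : Fin n → Fin m)
    (f : (Fin n → Fin m) → ℝ) : q.condExp i y f = q.cexp i y f := by
  unfold condExp cexp
  simp only [Fin.lt_def, Fin.le_def]

theorem cexp_of_le (q : LangModel m n) {i : ℕ} (hi : n ≤ i) (y : Fin n → Fin m)
    (f : (Fin n → Fin m) → ℝ) : q.cexp i y f = f y := by
  unfold cexp
  rw [Finset.sum_eq_single_of_mem y (by simp)]
  · rw [Finset.prod_eq_one, one_mul]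
    intro l hl
    exact absurd (Finset.mem_filter.1 hl).2 (by omega)
  · intro x hx hxy
    exact absurd (funext fun l => (Finset.mem_filter.1 hx).2 l (by omega)) hxy

/-- The tower property: the texts are sorted by their token at position `i`, whose probability is
common to all of them. -/
theorem cexp_succ (q : LangModel m n) (i : Fin n) (y : Fin n → Fin m)
    (f : (Fin n → Fin m) → ℝ) :
    q.cexp i y f = ∑ a, q.next (Function.update y i a) i *
      q.cexp ((i : ℕ) + 1) (Function.update y i a) f := by
  unfold cexp
  rw [← Finset.sum_fiberwise _ (fun x : Fin n → Fin m => x i)]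
  refine Finset.sum_congr rfl fun a _ => ?_
  rw [Finset.mul_sum, Finset.filter_filter]
  refine Finset.sum_congr ?_ ?_
  · ext x
    simp only [Finset.mem_filter, Finset.mem_univ, true_and]
    constructor
    · rintro ⟨h, rfl⟩ l hl
      rcases eq_or_ne l i with rfl | hne
      · simp
      · rw [Function.update_of_ne hne]
        exact h l (by have := Fin.val_ne_of_ne hne; omega)
    · intro h
      refine ⟨fun l hl => ?_, ?_⟩
      · rw [h l (by omega), Function.update_of_ne]
        exact fun e => absurd (congrArg Fin.val e) hl.ne
      · simpa using h i (by omega)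
  · intro x hx
    have h := (Finset.mem_filter.1 hx).2
    rw [← mul_assoc]
    congr 1
    have hs : (Finset.univ.filter fun l : Fin n => (i : ℕ) ≤ l) =
        insert i (Finset.univ.filter fun l : Fin n => (i : ℕ) + 1 ≤ l) := by
      ext l
      simp only [Finset.mem_filter, Finset.mem_univ, true_and, Finset.mem_insert, Fin.ext_iff]
      omega
    rw [hs, Finset.prod_insert (by simp)]
    congr 1
    exact q.next_congr fun l hl => h l (by have := Fin.le_def.1 hl; omega)

theorem cexp_congr (q : LangModel m n) {i : ℕ} {y y' : Fin n → Fin m}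
    (h : ∀ l : Fin n, (l : ℕ) < i → y l = y' l) (f : (Fin n → Fin m) → ℝ) :
    q.cexp i y f = q.cexp i y' f := by
  unfold cexp
  refine Finset.sum_congr ?_ fun _ _ => rfl
  ext x
  simp only [Finset.mem_filter, Finset.mem_univ, true_and]
  exact forall₂_congr fun l hl => by rw [h l hl]

/-- Induction on the number of open positions; each step sums out one token. -/
theorem cexp_const (q : LangModel m n) (c : ℝ) (i : ℕ) (y : Fin n → Fin m) :
    q.cexp i y (fun _ => c) = c := by
  obtain ⟨d, hd⟩ : ∃ d, n ≤ i + d := ⟨n, by omega⟩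
  induction d generalizing i y with
  | zero => exact q.cexp_of_le hd y _
  | succ d ih =>
    rcases le_or_gt n i with h | h
    · exact q.cexp_of_le h y _
    · have := q.cexp_succ ⟨i, h⟩ y fun _ => c
      simp only at this
      rw [this]
      simp only [fun a => ih (i + 1) (Function.update y ⟨i, h⟩ a) (by omega)]
      rw [← Finset.sum_mul, q.sum_next_update, one_mul]

theorem cexp_mono (q : LangModel m n) {f g : (Fin n → Fin m) → ℝ} (h : ∀ x, f x ≤ g x)
    (i : ℕ) (y : Fin n → Fin m) : q.cexp i y f ≤ q.cexp i y g :=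
  Finset.sum_le_sum fun x _ => mul_le_mul_of_nonneg_left (h x)
    (Finset.prod_nonneg fun l _ => q.next_nonneg x l)

theorem cexp_of_dependsOn (q : LangModel m n) {e i : ℕ} (hei : e ≤ i)
    {f : (Fin n → Fin m) → ℝ}
    (hf : ∀ x y : Fin n → Fin m, (∀ l : Fin n, (l : ℕ) < e → x l = y l) → f x = f y)
    (y : Fin n → Fin m) : q.cexp i y f = f y := by
  rw [← q.cexp_const (f y) i y]
  unfold cexp
  refine Finset.sum_congr rfl fun x hx => ?_
  rw [hf x y fun l hl => (Finset.mem_filter.1 hx).2 l (by omega)]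

theorem cexp_one_add_mul (q : LangModel m n) (c : ℝ) (f : (Fin n → Fin m) → ℝ) (i : ℕ)
    (y : Fin n → Fin m) : q.cexp i y (fun x => 1 + c * f x) = 1 + c * q.cexp i y f := by
  conv_rhs => rw [← q.cexp_const 1 i y]
  unfold cexp
  rw [Finset.mul_sum, ← Finset.sum_add_distrib]
  exact Finset.sum_congr rfl fun x _ => by ring

/-- Single texts may have probability `0`, so positivity comes from comparison with the least value
of `f`, which is positive as there are finitely many texts. -/
theorem cexp_pos [Nonempty (Fin m)] (q : LangModel m n) {f : (Fin n → Fin m) → ℝ}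
    (hf : ∀ x, 0 < f x) (i : ℕ) (y : Fin n → Fin m) : 0 < q.cexp i y f := by
  obtain ⟨x, -, hx⟩ := Finset.exists_min_image Finset.univ f Finset.univ_nonempty
  calc 0 < f x := hf x
    _ = q.cexp i y fun _ => f x := (q.cexp_const _ i y).symm
    _ ≤ _ := q.cexp_mono (fun z => hx z (Finset.mem_univ z)) i y

/-! ### Reweighted models -/

/-- Some text that starts with `s` and `a`. -/
def extend (n : ℕ) (s : List (Fin m)) (a : Fin m) : Fin n → Fin m :=
  fun i => (s ++ [a]).getD i a

theorem extend_textPrefix (x : Fin n → Fin m) (i : Fin n) {l : Fin n} (hl : l ≤ i) :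
    extend n (textPrefix x i) (x i) l = x l := by
  have hlen := length_textPrefix x i
  have hl' := Fin.le_def.1 hl
  unfold extend
  rw [List.getD_eq_getElem _ _ (by simp [hlen]; omega)]
  rcases eq_or_lt_of_le hl with rfl | h
  · rw [List.getElem_append_right (by omega)]
    simp
  · rw [List.getElem_append_left (by rw [hlen]; exact h)]
    simp [textPrefix]

theorem extend_of_lt {s : List (Fin m)} (a a' : Fin m) {l : Fin n} (hl : (l : ℕ) < s.length) :
    extend n s a l = extend n s a' l := by
  unfold extend
  rw [List.getD_eq_getElem _ _ (by simp; omega), List.getD_eq_getElem _ _ (by simp; omega),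
    List.getElem_append_left hl, List.getElem_append_left hl]

theorem extend_length {s : List (Fin m)} (a : Fin m) (hs : s.length < n) :
    extend n s a ⟨s.length, hs⟩ = a := by
  simp [extend]

/-- The language model in which the continuations of the text at position `i` are drawn from the
distribution of `q` with density proportional to `g i`. -/
noncomputable def reweight (q : LangModel m n) (g : ℕ → (Fin n → Fin m) → ℝ)
    (hg : ∀ i x, 0 < g i x) : LangModel m n where
  -- Only the tokens of the extended text up to position `s.length` matter, so its arbitrary
  -- continuation does no harm.
  prob s a := if h : s.length < n then
      q.next (extend n s a) ⟨s.length, h⟩ *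
        (q.cexp (s.length + 1) (extend n s a) (g s.length) /
          q.cexp s.length (extend n s a) (g s.length))
    else 0
  nonneg s hs a := by
    have : Nonempty (Fin m) := ⟨a⟩
    rw [dif_pos hs]
    exact mul_nonneg (q.next_nonneg _ _)
      (div_nonneg (q.cexp_pos (hg _) _ _).le (q.cexp_pos (hg _) _ _).le)
  sum_eq_one s hs := by
    simp only [dif_pos hs]
    have hne : Nonempty (Fin m) := by
      by_contra h
      rw [not_nonempty_iff] at h
      simpa using q.sum_eq_one s hs
    obtain ⟨a₀⟩ := id hne
    set x := extend n s a₀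
    have hx : ∀ a, ∀ l : Fin n, (l : ℕ) < s.length + 1 →
        extend n s a l = Function.update x ⟨s.length, hs⟩ a l := by
      intro a l hl
      rcases Nat.lt_succ_iff_lt_or_eq.1 hl with h | h
      · rw [Function.update_of_ne (fun e => absurd (congrArg Fin.val e) h.ne)]
        exact extend_of_lt _ _ h
      · obtain rfl : l = ⟨s.length, hs⟩ := Fin.ext h
        rw [Function.update_self, extend_length]
    have h1 : ∀ a, q.next (extend n s a) ⟨s.length, hs⟩ =
        q.next (Function.update x ⟨s.length, hs⟩ a) ⟨s.length, hs⟩ := fun a =>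
      q.next_congr fun l hl => hx a l (Nat.lt_succ_of_le (Fin.le_def.1 hl))
    have h2 : ∀ a, q.cexp (s.length + 1) (extend n s a) (g s.length) =
        q.cexp (s.length + 1) (Function.update x ⟨s.length, hs⟩ a) (g s.length) := fun a =>
      q.cexp_congr (hx a) _
    have h3 : ∀ a, q.cexp s.length (extend n s a) (g s.length) =
        q.cexp s.length x (g s.length) := fun a =>
      q.cexp_congr (fun l hl => extend_of_lt _ _ hl) _
    simp only [h1, h2, h3, ← mul_div_assoc]
    rw [← Finset.sum_div, ← q.cexp_succ ⟨s.length, hs⟩ x (g s.length)]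
    exact div_self (q.cexp_pos (hg _) _ _).ne'

theorem next_reweight (q : LangModel m n) (g : ℕ → (Fin n → Fin m) → ℝ)
    (hg : ∀ i x, 0 < g i x) (x : Fin n → Fin m) (i : Fin n) :
    (q.reweight g hg).next x i =
      q.next x i * (q.cexp ((i : ℕ) + 1) x (g i) / q.cexp i x (g i)) := by
  have hlen := length_textPrefix x i
  have h : ∀ l : Fin n, (l : ℕ) < (i : ℕ) + 1 → extend n (textPrefix x i) (x i) l = x l :=
    fun l hl => extend_textPrefix x i (Fin.le_def.2 (Nat.lt_succ_iff.1 hl))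
  simp only [next, reweight]
  rw [dif_pos (by rw [hlen]; exact i.2)]
  simp only [hlen]
  rw [q.cexp_congr h, q.cexp_congr fun l hl => h l (by omega)]
  congr 1
  exact q.next_congr fun l hl => h l (Nat.lt_succ_of_le (Fin.le_def.1 hl))

/-! ### Conditional expectations by enumeration of the windows -/

/-- As `φ a` ignores the coordinate `r`, the token `a` can be chosen independently of the window;
the coordinate that becomes idle accounts for the factor `m`. -/
theorem mul_sum_pi {m k : ℕ} (r : Fin k) (φ : Fin m → (Fin k → Fin m) → ℝ)
    (hφ : ∀ a w z, φ a (Function.update w r z) = φ a w) :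
    (m : ℝ) * ∑ w, φ (w r) w = ∑ a, ∑ w, φ a w := by
  have h2 : ∑ a, ∑ w, φ a w = ∑ w : Fin k → Fin m, ∑ a, φ a w := Finset.sum_comm
  have key : ∀ ψ : (Fin k → Fin m) → ℝ,
      ∑ w : Fin k → Fin m, ∑ a, ψ (Function.update w r a) = m * ∑ w, ψ w := by
    intro ψ
    rw [← Finset.sum_product']
    rw [← Finset.sum_fiberwise (Finset.univ ×ˢ Finset.univ)
      (fun p : (Fin k → Fin m) × Fin m => Function.update p.1 r p.2), Finset.mul_sum]
    refine Finset.sum_congr rfl fun w _ => ?_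
    rw [Finset.sum_congr rfl (g := fun _ => ψ w)
      (fun p hp => by rw [(Finset.mem_filter.1 hp).2]), Finset.sum_const, nsmul_eq_mul]
    congr 1
    norm_cast
    refine Eq.trans (b := (Finset.univ : Finset (Fin m)).card) ?_ (by simp)
    -- A pair `(v, a)` with `Function.update v r a = w` is determined by the overwritten value `v
    -- r`, which is free.
    refine Finset.card_nbij' (fun p => p.1 r) (fun a => (Function.update w r a, w r)) ?_ ?_ ?_ ?_
    · simp
    · intro a _
      simp
    · rintro ⟨v, a⟩ hv
      have hv : Function.update v r a = w := by simpa using hv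
      subst hv
      simp
    · intro a _
      simp
  rw [h2, ← key]
  refine Finset.sum_congr rfl fun w _ => Finset.sum_congr rfl fun a _ => ?_
  rw [hφ, Function.update_self]

/-- The text `x`, with the tokens of `w` at the positions from `i` on and before `e`; the window
`w` starts at position `b`. -/
def splice {k : ℕ} (b e i : ℕ) (x : Fin n → Fin m) (w : Fin k → Fin m) : Fin n → Fin m :=
  fun l => if h : i ≤ l ∧ (l : ℕ) < e ∧ (l : ℕ) - b < k then w ⟨l - b, h.2.2⟩ else x l

/-- The probability that `q` gives to the window `w` from position `i` on, times `f`. -/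
noncomputable def windowTerm {k : ℕ} (q : LangModel m n) (b e : ℕ) (f : (Fin n → Fin m) → ℝ)
    (i : ℕ) (x : Fin n → Fin m) (w : Fin k → Fin m) : ℝ :=
  (∏ l ∈ Finset.univ.filter fun l : Fin n => i ≤ (l : ℕ) ∧ (l : ℕ) < e,
    q.next (splice b e i x w) l) *
    f (splice b e i x w)

section
variable {k : ℕ} (q : LangModel m n) {b e : ℕ} (f : (Fin n → Fin m) → ℝ)

theorem splice_succ {i : Fin n} (hb : b ≤ i) (hi : (i : ℕ) < e) (hk : (i : ℕ) - b < k)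
    (x : Fin n → Fin m) (w : Fin k → Fin m) :
    splice b e i x w =
      splice b e ((i : ℕ) + 1) (Function.update x i (w ⟨i - b, hk⟩)) w := by
  funext l
  unfold splice
  by_cases hl : l = i
  · subst hl
    simp [hi, hk]
  · have := Fin.val_ne_of_ne hl
    rw [Function.update_of_ne hl]
    by_cases h : (i : ℕ) ≤ l ∧ (l : ℕ) < e ∧ (l : ℕ) - b < k
    · rw [dif_pos h, dif_pos ⟨by omega, h.2⟩]
    · rw [dif_neg h, dif_neg fun h' => h ⟨by omega, h'.2⟩]

theorem splice_of_lt {i : ℕ} (x : Fin n → Fin m) (w : Fin k → Fin m) {l : Fin n}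
    (hl : (l : ℕ) < i) : splice b e i x w l = x l :=
  dif_neg fun h => absurd h.1 (by omega)

/-- The independence that `mul_sum_pi` requires: once position `i` is fixed, its coordinate of the
window is not read any more. -/
theorem splice_update {i : ℕ} (hb : b ≤ i) (hk : i - b < k) (x : Fin n → Fin m)
    (w : Fin k → Fin m) (z : Fin m) :
    splice b e (i + 1) x (Function.update w ⟨i - b, hk⟩ z) = splice b e (i + 1) x w := by
  funext l
  unfold splice
  split_ifs with h
  · rw [Function.update_of_ne]
    intro h'
    have := congrArg Fin.val h'
    simp only at this
    omega
  · rfl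

theorem windowTerm_succ {i : Fin n} (hb : b ≤ i) (hi : (i : ℕ) < e) (hk : (i : ℕ) - b < k)
    (x : Fin n → Fin m) (w : Fin k → Fin m) :
    q.windowTerm b e f i x w = q.next (Function.update x i (w ⟨i - b, hk⟩)) i *
      q.windowTerm b e f ((i : ℕ) + 1) (Function.update x i (w ⟨i - b, hk⟩)) w := by
  unfold windowTerm
  rw [splice_succ hb hi hk, ← mul_assoc]
  congr 1
  have hs : (Finset.univ.filter fun l : Fin n => (i : ℕ) ≤ l ∧ (l : ℕ) < e) =
      insert i (Finset.univ.filter fun l : Fin n => (i : ℕ) + 1 ≤ l ∧ (l : ℕ) < e) := by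
    ext l
    simp only [Finset.mem_filter, Finset.mem_univ, true_and, Finset.mem_insert, Fin.ext_iff]
    omega
  rw [hs, Finset.prod_insert (by simp)]
  congr 1
  exact q.next_congr fun l hl => splice_of_lt _ _ (Nat.lt_succ_of_le (Fin.le_def.1 hl))

/-- One step of the tower property for the enumeration. With `c = 1` it serves the denominator of a
next-token probability, with the indicator of a token the numerator. -/
theorem mul_sum_windowTerm {i : Fin n} (hb : b ≤ i) (hi : (i : ℕ) < e) (hk : (i : ℕ) - b < k)
    (x : Fin n → Fin m) (c : Fin m → ℝ) :
    (m : ℝ) * ∑ w : Fin k → Fin m, c (w ⟨i - b, hk⟩) * q.windowTerm b e f i x w =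
      ∑ a, c a * (q.next (Function.update x i a) i *
        ∑ w : Fin k → Fin m, q.windowTerm b e f ((i : ℕ) + 1) (Function.update x i a) w) := by
  simp only [windowTerm_succ q f hb hi hk, Finset.mul_sum]
  rw [← Finset.mul_sum]
  refine mul_sum_pi ⟨i - b, hk⟩ (fun a w => c a * (q.next (Function.update x i a) i *
    q.windowTerm b e f ((i : ℕ) + 1) (Function.update x i a) w)) fun a w z => ?_
  simp only [windowTerm, splice_update hb hk]

/-- Only `d` coordinates of a window influence the text, so each continuation is counted `m ^ (k -
d)` times. The induction goes backwards from the end `e` of the block, where `f` is determined. -/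
theorem pow_mul_sum_windowTerm (hen : e ≤ n) (hek : e ≤ b + k)
    (hf : ∀ x y : Fin n → Fin m, (∀ l : Fin n, (l : ℕ) < e → x l = y l) → f x = f y)
    (d i : ℕ) (hb : b ≤ i) (hd : i + d = e) (x : Fin n → Fin m) :
    (m : ℝ) ^ d * ∑ w : Fin k → Fin m, q.windowTerm b e f i x w = m ^ k * q.cexp i x f := by
  induction d generalizing i x with
  | zero =>
    obtain rfl : i = e := hd
    rw [q.cexp_of_dependsOn le_rfl hf]
    have : ∀ w : Fin k → Fin m, q.windowTerm b i f i x w = f x := by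
      intro w
      have hs : splice b i i x w = x := by
        funext l
        exact dif_neg fun h => by omega
      rw [windowTerm, hs, Finset.prod_eq_one, one_mul]
      intro l hl
      have := (Finset.mem_filter.1 hl).2
      omega
    simp [this]
  | succ d ih =>
    have hin : i < n := by omega
    have h := mul_sum_windowTerm (k := k) (b := b) (e := e) q f (i := ⟨i, hin⟩) hb
      (show i < e by omega) (show i - b < k by omega) x fun _ => 1
    simp only [one_mul] at h
    rw [pow_succ, mul_assoc, h, q.cexp_succ ⟨i, hin⟩ x f, Finset.mul_sum, Finset.mul_sum]
    refine Finset.sum_congr rfl fun a _ => ?_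
    rw [mul_left_comm, ih (i + 1) (by omega) (by omega), mul_left_comm]

theorem sum_windowTerm_pos [Nonempty (Fin m)] (hen : e ≤ n) (hek : e ≤ b + k)
    (hf : ∀ x y : Fin n → Fin m, (∀ l : Fin n, (l : ℕ) < e → x l = y l) → f x = f y)
    (hf0 : ∀ x, 0 < f x) {i : ℕ} (hb : b ≤ i) (hi : i ≤ e) (x : Fin n → Fin m) :
    0 < ∑ w : Fin k → Fin m, q.windowTerm b e f i x w := by
  have hm : (0 : ℝ) < m := by exact_mod_cast Fin.pos_iff_nonempty.2 ‹_›
  have h := pow_mul_sum_windowTerm q f hen hek hf (e - i) i hb (by omega) x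
  have h1 := q.cexp_pos hf0 i x
  have h2 : 0 < (m : ℝ) ^ (e - i) * ∑ w : Fin k → Fin m, q.windowTerm b e f i x w := by
    rw [h]; positivity
  exact pos_of_mul_pos_right h2 (by positivity)

/-- Both sums count every continuation with the same multiplicity, which cancels. This quotient is
what the network computes. -/
theorem sum_windowTerm_div [Nonempty (Fin m)] (hen : e ≤ n) (hek : e ≤ b + k)
    (hf : ∀ x y : Fin n → Fin m, (∀ l : Fin n, (l : ℕ) < e → x l = y l) → f x = f y)
    (hf0 : ∀ x, 0 < f x) {i : Fin n} (hb : b ≤ i) (hi : (i : ℕ) < e) (hk : (i : ℕ) - b < k)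
    (x : Fin n → Fin m) :
    (∑ w : Fin k → Fin m, (if w ⟨i - b, hk⟩ = x i then q.windowTerm b e f i x w else 0)) /
        ∑ w : Fin k → Fin m, q.windowTerm b e f i x w =
      q.next x i * (q.cexp ((i : ℕ) + 1) x f / q.cexp i x f) := by
  have hm : (0 : ℝ) < m := by exact_mod_cast Fin.pos_iff_nonempty.2 ‹_›
  have h0 := mul_sum_windowTerm q f hb hi hk x fun a => if a = x i then 1 else 0
  simp only [ite_mul, one_mul, zero_mul, Finset.sum_ite_eq', Finset.mem_univ, if_true,
    Function.update_eq_self] at h0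
  have h1 := pow_mul_sum_windowTerm q f hen hek hf (e - (i + 1)) (i + 1) (by omega) (by omega) x
  have h2 := pow_mul_sum_windowTerm q f hen hek hf (e - i) i hb (by omega) x
  have hpos := sum_windowTerm_pos q f hen hek hf hf0 hb hi.le x
  have hc := q.cexp_pos hf0 i x
  rw [show e - (i : ℕ) = e - (i + 1) + 1 by omega, pow_succ] at h2
  rw [← mul_div_assoc, div_eq_div_iff hpos.ne' hc.ne']
  set A := ∑ w : Fin k → Fin m, (if w ⟨i - b, hk⟩ = x i then q.windowTerm b e f i x w else 0)
  set B := ∑ w : Fin k → Fin m, q.windowTerm b e f i x w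
  set B' := ∑ w : Fin k → Fin m, q.windowTerm b e f ((i : ℕ) + 1) x w
  have hM : (m : ℝ) ^ (e - ((i : ℕ) + 1)) * m * m ^ k ≠ 0 := by positivity
  refine mul_left_cancel₀ hM ?_
  calc _ = (m : ℝ) ^ (e - ((i : ℕ) + 1)) * (m * A) * (m ^ k * q.cexp i x f) := by ring
    _ = q.next x i * ((m : ℝ) ^ (e - ((i : ℕ) + 1)) * B') *
        ((m : ℝ) ^ (e - ((i : ℕ) + 1)) * m * B) := by rw [h0, ← h2]; ring
    _ = _ := by rw [h1]; ring

end

end LangModel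

/-! ### Weights of texts, and telescoping over blocks. -/

/-- The weight `γ` of the texts that `d` marks in the window at `i`. -/
noncomputable def Distinguisher.weight {m n k : ℕ} (d : Distinguisher m n k) (γ : ℝ) (i : ℕ)
    (x : Fin n → Fin m) : ℝ :=
  if h : i < n then 1 + (γ - 1) * d.val ⟨i, h⟩ x else 1

/-- The first position of the block of length `k` that contains position `j`, for blocks that
start at the positions `o`, `o + k`, …; before position `o` it is `0`. -/
def blockStart (k o j : ℕ) : ℕ := if j < o then 0 else j - (j - o) % k

/-- The weight that decides about the token at position `j`. -/
noncomputable def Distinguisher.blockWeight {m n k : ℕ} (d : Distinguisher m n k) (γ : ℝ)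
    (o j : ℕ) : (Fin n → Fin m) → ℝ :=
  if j < o then fun _ => 1 else d.weight γ (blockStart k o j)

namespace Distinguisher

variable {m n k : ℕ} (d : Distinguisher m n k) {γ : ℝ}

theorem val_nonneg (i : Fin n) (x : Fin n → Fin m) : 0 ≤ d.val i x := by
  rcases d.zero_or_one i x with h | h <;> simp [h]

theorem val_le_one (i : Fin n) (x : Fin n → Fin m) : d.val i x ≤ 1 := by
  rcases d.zero_or_one i x with h | h <;> simp [h]

theorem weight_pos (hγ : 0 < γ) (i : ℕ) (x : Fin n → Fin m) : 0 < d.weight γ i x := by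
  unfold weight
  split_ifs with h
  · rcases d.zero_or_one ⟨i, h⟩ x with h | h <;> simp [h, hγ]
  · exact one_pos

theorem blockWeight_pos (hγ : 0 < γ) (o j : ℕ) (x : Fin n → Fin m) :
    0 < d.blockWeight γ o j x := by
  unfold blockWeight
  split_ifs
  · exact one_pos
  · exact d.weight_pos hγ _ x

theorem weight_congr (γ : ℝ) {i : ℕ} {x y : Fin n → Fin m}
    (h : ∀ l : Fin n, (l : ℕ) < i + k → x l = y l) : d.weight γ i x = d.weight γ i y := by
  unfold weight
  split_ifs with hi
  · rw [d.window ⟨i, hi⟩ x y h]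
  · rfl

theorem cexp_weight (q : LangModel m n) (γ : ℝ) {i : ℕ} (hi : i < n) (j : ℕ)
    (x : Fin n → Fin m) :
    q.cexp j x (d.weight γ i) = 1 + (γ - 1) * q.cexp j x (d.val ⟨i, hi⟩) := by
  rw [← q.cexp_one_add_mul]
  congr 1
  funext y
  exact dif_pos hi

/-- The logarithms of the factors by which the probabilities of the tokens change add up to one
term for every block. -/
theorem sum_log_blockWeight [Nonempty (Fin m)] (q : LangModel m n) (hk : 0 < k) (γ : ℝ)
    {o : ℕ} (ho : o < k) (x : Fin n → Fin m) (J : ℕ) :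
    ∑ j ∈ Finset.range J, (Real.log (q.cexp (j + 1) x (d.blockWeight γ o j)) -
        Real.log (q.cexp j x (d.blockWeight γ o j))) =
      ∑ i ∈ Finset.range J with i % k = o, (Real.log (q.cexp J x (d.weight γ i)) -
        Real.log (q.cexp i x (d.weight γ i))) := by
  induction J with
  | zero => simp
  | succ J ih =>
    rw [Finset.sum_range_succ, ih]
    -- Every block but the current one is complete: its weight depends on tokens before `i + k ≤ J`
    -- only, so the next token leaves its expectation unchanged.
    have hT : ∀ i ∈ (Finset.range J).filter fun i => i % k = o, blockStart k o J ≠ i →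
        q.cexp (J + 1) x (d.weight γ i) = q.cexp J x (d.weight γ i) := by
      intro i hi hne
      obtain ⟨hiJ, hio⟩ := Finset.mem_filter.1 hi
      have hiJ := Finset.mem_range.1 hiJ
      have hik : i + k ≤ J := by
        have h1 := Nat.div_add_mod i k
        have h2 := Nat.div_add_mod (J - o) k
        have hoJ : o ≤ J := by have := Nat.mod_le i k; omega
        unfold blockStart at hne
        rw [if_neg (by omega)] at hne
        set r := (J - o) % k
        have hr : r < k := Nat.mod_lt _ hk
        rcases lt_trichotomy (i / k) ((J - o) / k) with h | h | h
        · have := Nat.mul_le_mul_left k (Nat.succ_le_of_lt h)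
          rw [Nat.succ_eq_add_one, mul_add] at this
          omega
        · rw [h] at h1
          omega
        · have := Nat.mul_le_mul_left k (Nat.succ_le_of_lt h)
          rw [Nat.succ_eq_add_one, mul_add] at this
          omega
      rw [q.cexp_of_dependsOn (e := i + k) (by omega) (fun y z h => d.weight_congr γ h),
        q.cexp_of_dependsOn (e := i + k) (by omega) (fun y z h => d.weight_congr γ h)]
    -- Before the offset the weight is `1` and no block has started, so both sides vanish.
    rcases lt_or_ge J o with hJ | hJ
    · have h0 : ∀ J' ≤ J + 1, ((Finset.range J').filter fun i => i % k = o) = ∅ := by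
        intro J' hJ'
        refine Finset.filter_eq_empty_iff.2 fun i hi => ?_
        have := Finset.mem_range.1 hi
        rcases lt_or_ge i k with h | h
        · rw [Nat.mod_eq_of_lt h]; omega
        · omega
      by_cases hoJ : J % k = o
      · rw [Nat.mod_eq_of_lt (by omega)] at hoJ
        omega
      · rw [h0 J (by omega), h0 (J + 1) le_rfl]
        simp only [blockWeight, if_pos hJ, q.cexp_const]
        simp
    · have hw : d.blockWeight γ o J = d.weight γ (blockStart k o J) := if_neg (by omega)
      rw [hw]
      have hb : (blockStart k o J) % k = o ∧ blockStart k o J ≤ J := by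
        unfold blockStart
        rw [if_neg (by omega)]
        refine ⟨?_, by omega⟩
        have h2 := Nat.div_add_mod (J - o) k
        have : J - (J - o) % k = o + k * ((J - o) / k) := by omega
        rw [this, Nat.add_mul_mod_self_left, Nat.mod_eq_of_lt ho]
      set B := blockStart k o J
      rw [Finset.range_add_one, Finset.filter_insert]
      -- Either a block starts at `J` and adds a summand, or the summand of the current block is
      -- prolonged by one difference.
      rcases eq_or_lt_of_le hb.2 with hBJ | hBJ
      · rw [hBJ] at hb hT ⊢
        rw [if_pos hb.1, Finset.sum_insert (by simp), add_comm]
        congr 1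
        refine Finset.sum_congr rfl fun i hi => ?_
        rw [hT i hi]
        exact (Finset.mem_range.1 (Finset.mem_filter.1 hi).1).ne'
      · have hJo : ¬ J % k = o := by
          intro h
          have hB' : B = J - (J - o) % k := if_neg (by omega)
          have : (J - o) % k = 0 := by
            have h1 := Nat.div_add_mod J k
            have : J - o = k * (J / k) := by omega
            rw [this, Nat.mul_mod_right]
          omega
        rw [if_neg hJo, eq_comm, ← sub_eq_iff_eq_add', ← Finset.sum_sub_distrib,
          Finset.sum_eq_single_of_mem B
            (Finset.mem_filter.2 ⟨Finset.mem_range.2 hBJ, hb.1⟩)]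
        · ring
        · intro i hi hne
          rw [hT i hi hne.symm]
          ring

end Distinguisher

/-! ### The loss and its decrease. -/

namespace LangModel

variable {m n : ℕ}

theorem text_nonneg (q : LangModel m n) (x : Fin n → Fin m) : 0 ≤ q.text x :=
  Finset.prod_nonneg fun i _ => q.next_nonneg x i

theorem sum_text [Nonempty (Fin m)] (q : LangModel m n) : ∑ x, q.text x = 1 := by
  have := q.cexp_const 1 0 fun _ => Classical.arbitrary _
  simpa [cexp, text] using this

/-- Texts that `p` excludes have factor `0`; on the others `negLog` is an ordinary logarithm. -/
theorem loss_eq (p q : LangModel m n) (hn : 0 < n)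
    (h : ∀ x, p.text x ≠ 0 → ∀ i, q.next x i ≠ 0) :
    loss p q = ENNReal.ofReal (∑ x, p.text x * ((1 / (n : ℝ)) *
      ∑ i, -Real.log (q.next x i))) := by
  have hlog : ∀ x i, 0 ≤ -Real.log (q.next x i) := fun x i =>
    neg_nonneg.2 (Real.log_nonpos (q.next_nonneg x i) (q.next_le_one x i))
  have hn' : (0 : ℝ) < n := Nat.cast_pos.2 hn
  rw [ENNReal.ofReal_sum_of_nonneg fun x _ => mul_nonneg (p.text_nonneg x)
    (mul_nonneg (by positivity) (Finset.sum_nonneg fun i _ => hlog x i))]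
  refine Finset.sum_congr rfl fun x _ => ?_
  rw [ENNReal.ofReal_mul (p.text_nonneg x)]
  by_cases hx : p.text x = 0
  · simp [hx]
  congr 1
  rw [ENNReal.ofReal_mul (by positivity), ENNReal.ofReal_sum_of_nonneg fun i _ => hlog x i,
    ENNReal.div_eq_inv_mul, one_div, ENNReal.ofReal_inv_of_pos hn', ENNReal.ofReal_natCast]
  congr 1
  exact Finset.sum_congr rfl fun i _ => if_neg (h x hx i)

theorem next_ne_zero_of_loss_ne_top (p q : LangModel m n) (h : loss p q ≠ ⊤) (x : Fin n → Fin m)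
    (hx : p.text x ≠ 0) (i : Fin n) : q.next x i ≠ 0 := by
  intro h0
  refine h (ENNReal.sum_eq_top.2 ⟨x, Finset.mem_univ x, ?_⟩)
  have h1 : ∑ i, negLog (q.next x i) = ⊤ :=
    ENNReal.sum_eq_top.2 ⟨i, Finset.mem_univ i, if_pos h0⟩
  rw [h1, ENNReal.top_div_of_ne_top (ENNReal.natCast_ne_top n), ENNReal.mul_top]
  simpa using lt_of_le_of_ne (p.text_nonneg x) (Ne.symm hx)

end LangModel

namespace Distinguisher

variable {m n k : ℕ} (d : Distinguisher m n k)

theorem abs_advantage_le_one [Nonempty (Fin m)] (p q : LangModel m n) (hn : 0 < n) :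
    |d.advantage p q| ≤ 1 := by
  have hn' : (0 : ℝ) < n := Nat.cast_pos.2 hn
  unfold advantage
  refine (Finset.abs_sum_le_sum_abs _ _).trans (le_trans ?_ p.sum_text.le)
  refine Finset.sum_le_sum fun y _ => ?_
  rw [abs_mul, abs_of_nonneg (p.text_nonneg y)]
  refine mul_le_of_le_one_right (p.text_nonneg y) ?_
  rw [abs_mul, abs_of_pos (by positivity), one_div, inv_mul_le_iff₀ hn', mul_one]
  refine (Finset.abs_sum_le_sum_abs _ _).trans ?_
  have : ∀ i, |q.condExp i y (d.val i) - d.val i y| ≤ 1 := by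
    intro i
    have h1 := q.cexp_mono (fun x => d.val_nonneg i x) i y
    have h2 := q.cexp_mono (fun x => d.val_le_one i x) i y
    rw [q.cexp_const] at h1 h2
    rw [q.condExp_eq_cexp, abs_le]
    have := d.val_nonneg i y
    have := d.val_le_one i y
    constructor <;> linarith
  simpa using Finset.sum_le_sum fun i (_ : i ∈ Finset.univ) => this i

/-- Reweighting by `exp (-β d)` for a suitable `β`, in blocks of length `k` at a suitable offset,
decreases the loss. -/
theorem exists_loss_reweight_le (p q : LangModel m n) (hk : 0 < k) (hn : 0 < n) :
    ∃ o < k, ∃ (γ : ℝ) (hγ : 0 < γ),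
      LangModel.loss p (q.reweight (d.blockWeight γ o) (d.blockWeight_pos hγ o)) +
        ENNReal.ofReal (d.advantage p q ^ 2 / (4 * (k : ℝ))) ≤ LangModel.loss p q := by
  by_cases htop : LangModel.loss p q = ⊤
  -- For an infinite loss any choice will do.
  · exact ⟨0, hk, 1, one_pos, htop ▸ le_top⟩
  have hne : Nonempty (Fin m) := by
    by_contra h
    rw [not_nonempty_iff] at h
    simpa using q.sum_eq_one [] hn
  have hpos := fun x hx i => (q.next_nonneg x i).lt_of_ne'
    (LangModel.next_ne_zero_of_loss_ne_top p q htop x hx i)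
  have hn' : (0 : ℝ) < n := Nat.cast_pos.2 hn
  have hk' : (0 : ℝ) < k := Nat.cast_pos.2 hk
  set α := d.advantage p q with hα
  have hα1 : |α| ≤ 1 := d.abs_advantage_le_one p q hn
  -- This choice maximises `βα - β²`. The sign of `α` is arbitrary, so `γ` may exceed `1`.
  set β := α / 2 with hβ
  set γ := Real.exp (-β) with hγ
  have hγ0 : 0 < γ := Real.exp_pos _
  -- The quadratic bound for the exponential needs `|β| ≤ 1`, hence the bound on the advantage.
  have hγ1 : γ - 1 ≤ -β + β ^ 2 := by
    have h := Real.abs_exp_sub_one_sub_id_le (x := -β) (by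
      rw [abs_neg, hβ, abs_div, abs_two]; linarith)
    have := (abs_le.1 h).2
    rw [neg_sq] at this
    linarith
  -- the gain of the block at `i`
  let F : ℕ → (Fin n → Fin m) → ℝ := fun i x =>
    Real.log (q.cexp n x (d.weight γ i)) - Real.log (q.cexp i x (d.weight γ i))
  -- With `a` the conditional expectation of `d_i`: `log (1 + (γ - 1) a) ≤ (γ - 1) a ≤ -βa + β² a`,
  -- and `a ≤ 1`.
  have hF : ∀ (i : Fin n) x, β * (q.condExp i x (d.val i) - d.val i x) - β ^ 2 ≤ F i x := by
    intro i x
    have h1 : Real.log (q.cexp n x (d.weight γ i)) = -β * d.val i x := by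
      rw [q.cexp_of_le le_rfl, weight, dif_pos i.2]
      rcases d.zero_or_one i x with h | h <;> simp [h, hγ]
    have hp := q.cexp_pos (d.weight_pos hγ0 i) i x
    have h2 := Real.log_le_sub_one_of_pos hp
    have h3 := d.cexp_weight q γ i.2 i x
    have h4 := q.cexp_mono (fun x => d.val_nonneg i x) i x
    have h5 := q.cexp_mono (fun x => d.val_le_one i x) i x
    rw [q.cexp_const] at h4 h5
    simp only [Fin.eta] at h3
    rw [q.condExp_eq_cexp]
    simp only [F]
    rw [h1]
    set a := q.cexp i x (d.val i)
    have h6 : (γ - 1) * a ≤ (-β + β ^ 2) * a := mul_le_mul_of_nonneg_right hγ1 h4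
    have h7 : β ^ 2 * a ≤ β ^ 2 * 1 := mul_le_mul_of_nonneg_left h5 (sq_nonneg β)
    nlinarith
  let G : ℕ → ℝ := fun o => ∑ x, p.text x * ((1 / (n : ℝ)) *
    ∑ i ∈ Finset.range n with i % k = o, F i x)
  -- The residue classes modulo `k` partition the positions, so the gains of all offsets add up to
  -- the average over all windows.
  have hG : α ^ 2 / 4 ≤ ∑ o ∈ Finset.range k, G o := by
    have h1 : ∑ o ∈ Finset.range k, G o =
        ∑ x, p.text x * ((1 / (n : ℝ)) * ∑ i : Fin n, F i x) := by
      rw [Finset.sum_comm]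
      refine Finset.sum_congr rfl fun x _ => ?_
      rw [← Finset.mul_sum, ← Finset.mul_sum]
      congr 2
      rw [Finset.sum_fiberwise_of_maps_to (g := fun i => i % k)
        (fun i _ => Finset.mem_range.2 (Nat.mod_lt i hk)), Finset.sum_range]
    have h2 : ∀ x, (1 / (n : ℝ)) * ∑ i : Fin n,
        (β * (q.condExp i x (d.val i) - d.val i x) - β ^ 2) =
        β * ((1 / (n : ℝ)) * ∑ i : Fin n, (q.condExp i x (d.val i) - d.val i x)) - β ^ 2 := by
      intro x
      rw [Finset.sum_sub_distrib, ← Finset.mul_sum]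
      simp
      field_simp
    have h3 : ∑ x, p.text x * ((1 / (n : ℝ)) * ∑ i : Fin n,
        (β * (q.condExp i x (d.val i) - d.val i x) - β ^ 2)) = β * α - β ^ 2 := by
      have h4 : β ^ 2 = ∑ x, p.text x * β ^ 2 := by rw [← Finset.sum_mul, p.sum_text, one_mul]
      simp only [h2]
      conv_rhs => rw [h4, hα, advantage, Finset.mul_sum, ← Finset.sum_sub_distrib]
      exact Finset.sum_congr rfl fun x _ => by ring
    calc α ^ 2 / 4 = β * α - β ^ 2 := by rw [hβ]; ring
      _ = _ := h3.symm
      _ ≤ _ := by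
        rw [h1]
        refine Finset.sum_le_sum fun x _ => mul_le_mul_of_nonneg_left
          (mul_le_mul_of_nonneg_left (Finset.sum_le_sum fun i _ => hF i x) (by positivity))
          (p.text_nonneg x)
  obtain ⟨o, ho, hGo⟩ : ∃ o ∈ Finset.range k, α ^ 2 / (4 * k) ≤ G o := by
    refine Finset.exists_le_of_sum_le (by simpa using hk.ne') ?_
    simp only [Finset.sum_const, Finset.card_range, nsmul_eq_mul]
    calc (k : ℝ) * (α ^ 2 / (4 * k)) = α ^ 2 / 4 := by field_simp
      _ ≤ _ := hG
  have ho := Finset.mem_range.1 ho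
  refine ⟨o, ho, γ, hγ0, ?_⟩
  set q' := q.reweight (d.blockWeight γ o) (d.blockWeight_pos hγ0 o)
  have hc : ∀ i j x, 0 < q.cexp j x (d.blockWeight γ o i) := fun i j x =>
    q.cexp_pos (d.blockWeight_pos hγ0 o i) j x
  have hpos' : ∀ x, p.text x ≠ 0 → ∀ i, q'.next x i ≠ 0 := by
    intro x hx i
    simp only [q']
    rw [LangModel.next_reweight]
    exact (mul_pos (hpos x hx i) (div_pos (hc _ _ _) (hc _ _ _))).ne'
  rw [LangModel.loss_eq p q hn (fun x hx i => (hpos x hx i).ne'),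
    LangModel.loss_eq p q' hn hpos', ← ENNReal.ofReal_add _ (by positivity)]
  · refine ENNReal.ofReal_le_ofReal ?_
    have : ∑ x, p.text x * ((1 / (n : ℝ)) * ∑ i, -Real.log (q.next x i)) =
        ∑ x, p.text x * ((1 / (n : ℝ)) * ∑ i, -Real.log (q'.next x i)) + G o := by
      rw [← Finset.sum_add_distrib]
      refine Finset.sum_congr rfl fun x _ => ?_
      by_cases hx : p.text x = 0
      · simp [hx]
      rw [← mul_add, ← mul_add]
      congr 2
      rw [← d.sum_log_blockWeight q hk γ ho x n, Finset.sum_range, ← Finset.sum_add_distrib]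
      refine Finset.sum_congr rfl fun i _ => ?_
      simp only [q']
      rw [LangModel.next_reweight, Real.log_mul (hpos x hx i).ne'
        (div_pos (hc _ _ _) (hc _ _ _)).ne', Real.log_div (hc _ _ _).ne' (hc _ _ _).ne']
      ring
    rw [this]
    linarith
  · exact Finset.sum_nonneg fun x _ => mul_nonneg (p.text_nonneg x) (mul_nonneg (by positivity)
      (Finset.sum_nonneg fun i _ =>
        neg_nonneg.2 (Real.log_nonpos (q'.next_nonneg x i) (q'.next_le_one x i))))

end Distinguisher

/-! ### Selection between values of either sign, and cyclic counters. -/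

namespace TransExpr

variable {V : Type}

/-- The value of `e` or of `f`, depending on the indicator `c`; it has to be at most `0` or
greater than `ε`. -/
noncomputable def mux (ε : ℝ) (c e f : TransExpr V) : TransExpr V :=
  lin ε [(1, prodL [c, e]), (1, prodL [not c, f])]

theorem linVal_mux {s : V → ℝ} {c e f : TransExpr V} {p : Prop} [Decidable p]
    (hc : c.eval s = if p then 1 else 0) :
    linVal s [(1, prodL [c, e]), (1, prodL [not c, f])] = if p then e.eval s else f.eval s := by
  have h := eval_not hc
  by_cases hp : p <;> simp [hc, h, hp]

theorem eval_mux {s : V → ℝ} {ε : ℝ} (hε : 0 < ε) {c e f : TransExpr V} {p : Prop} [Decidable p]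
    (hc : c.eval s = if p then 1 else 0)
    (hv : 0 < (if p then e.eval s else f.eval s) → ε < if p then e.eval s else f.eval s) :
    (mux ε c e f).eval s = if p then e.eval s else f.eval s := by
  rw [mux, eval_lin hε, linVal_mux hc]
  rwa [linVal_mux hc]

theorem defined_mux {s : V → ℝ} {ε : ℝ} (hε : 0 < ε) {c e f : TransExpr V} {p : Prop}
    [Decidable p] (hc : c.eval s = if p then 1 else 0)
    (hv : 0 < (if p then e.eval s else f.eval s) → ε < if p then e.eval s else f.eval s)
    (hc' : c.Defined s) (he : e.Defined s) (hf : f.Defined s) : (mux ε c e f).Defined s := by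
  refine defined_lin hε ?_ (by simp [hc', he, hf])
  rwa [linVal_mux hc]

theorem nodes_mux {A : Set V} (ε : ℝ) {c e f : TransExpr V} (hc : c.nodes ⊆ A)
    (he : e.nodes ⊆ A) (hf : f.nodes ⊆ A) : (mux ε c e f).nodes ⊆ A :=
  nodes_lin ε (by simp [hc, he, hf])

theorem cost_mux (ε : ℝ) (c e f : TransExpr V) :
    (mux ε c e f).cost = 31 + 10 * c.cost + 5 * e.cost + 5 * f.cost := by
  simp [mux, cost_lin]; ring

/-- The next value of a cyclic counter with the values `0, …, a`. -/
noncomputable def bump (a : ℕ) (e : TransExpr V) : TransExpr V :=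
  ite (eq e (nat a)) (nat 0) (add e (nat 1))

theorem eval_bump {s : V → ℝ} {e : TransExpr V} {b : ℕ} (a : ℕ) (he : e.eval s = b) :
    (bump a e).eval s = ((if b = a then 0 else b + 1 : ℕ) : ℝ) :=
  eval_ite_nat (eval_eq he (eval_nat s a)) (eval_nat s 0) (by simpa using eval_add he (eval_nat s 1))

@[simp] theorem cost_bump (a : ℕ) (e : TransExpr V) : (bump a e).cost = 48 + 5 * e.cost := by
  simp [bump]; ring
@[simp] theorem defined_bump (s : V → ℝ) (a : ℕ) (e : TransExpr V) :
    (bump a e).Defined s ↔ e.Defined s := by simp [bump]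
@[simp] theorem nodes_bump (A : Set V) (a : ℕ) (e : TransExpr V) :
    (bump a e).nodes ⊆ A ↔ e.nodes ⊆ A := by simp [bump]

theorem eval_ite_ind {s : V → ℝ} {c e f : TransExpr V} {p q r : Prop} [Decidable p]
    [Decidable q] [Decidable r] (hc : c.eval s = if p then 1 else 0)
    (he : e.eval s = if q then 1 else 0) (hf : f.eval s = if r then 1 else 0) :
    (ite c e f).eval s = if (if p then q else r) then 1 else 0 := by
  rw [eval_ite hc, he, hf]
  by_cases hp : p <;> by_cases hq : q <;> by_cases hr : r <;> simp [hp, hq, hr]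

end TransExpr

/-! ## The boosted network -/

namespace Boost

open TransExpr

/-- The control nodes: the position in the slot, the slot in the round, the indicators of the last
round and of the arrival of a token; position, start (plus 1), length and indicator of
distinguishing of the current block; the token of the current slot; the constant `0`. -/
inductive Ctl : Type
  | tick | slot | fin | first | pos | start | len | flg | cur | zero
  deriving DecidableEq

instance : Fintype Ctl :=
  ⟨{.tick, .slot, .fin, .first, .pos, .start, .len, .flg, .cur, .zero}, fun c => by
    cases c <;> decide⟩

/-- The input node, the accumulators of a product and of two sums, and the output node. -/
inductive Acc : Type
  | inp | prd | den | num | out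
  deriving DecidableEq

instance : Fintype Acc := ⟨{.inp, .prd, .den, .num, .out}, fun c => by cases c <;> decide⟩

variable {VQ VD : Type} (Q : RNN Unit VQ) (D : RNN DistInput VD) (m n k : ℕ) (ε γ : ℝ)

/-- The hidden nodes of the boosted network. -/
inductive HNode : Type
  | savQ (v : Q.hidden)
  | savD (v : D.hidden)
  | digit (i : Fin k)
  | mem (i : Fin k)
  | ctl (c : Ctl)
  -- Padding that makes the number of nodes exact: `2k + 10 + (4k + 7) = 6k + 17`.
  | pad (i : Fin (4 * k + 7))

/-- The other nodes of the boosted network. -/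
inductive VNode (VQ VD : Type) (k : ℕ) : Type
  | runQ (v : VQ)
  | runD (v : VD)
  | acc (a : Acc)
  | pad (i : Fin (k + 3))

/-- The nodes of the boosted network. -/
abbrev Node : Type := HNode Q D k ⊕ VNode VQ VD k

/-- The hidden nodes, sorted by kind. -/
def hNodeEquiv : HNode Q D k ≃
    Q.hidden ⊕ D.hidden ⊕ Fin k ⊕ Fin k ⊕ Ctl ⊕ Fin (4 * k + 7) where
  toFun
    | .savQ v => .inl v
    | .savD v => .inr (.inl v)
    | .digit i => .inr (.inr (.inl i))
    | .mem i => .inr (.inr (.inr (.inl i)))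
    | .ctl c => .inr (.inr (.inr (.inr (.inl c))))
    | .pad i => .inr (.inr (.inr (.inr (.inr i))))
  invFun
    | .inl v => .savQ v
    | .inr (.inl v) => .savD v
    | .inr (.inr (.inl i)) => .digit i
    | .inr (.inr (.inr (.inl i))) => .mem i
    | .inr (.inr (.inr (.inr (.inl c)))) => .ctl c
    | .inr (.inr (.inr (.inr (.inr i)))) => .pad i
  left_inv v := by cases v <;> rfl
  right_inv v := by rcases v with v | v | v | v | v | v <;> rfl

/-- The other nodes, sorted by kind. -/
def vNodeEquiv : VNode VQ VD k ≃ VQ ⊕ VD ⊕ Acc ⊕ Fin (k + 3) where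
  toFun
    | .runQ v => .inl v
    | .runD v => .inr (.inl v)
    | .acc a => .inr (.inr (.inl a))
    | .pad i => .inr (.inr (.inr i))
  invFun
    | .inl v => .runQ v
    | .inr (.inl v) => .runD v
    | .inr (.inr (.inl a)) => .acc a
    | .inr (.inr (.inr i)) => .pad i
  left_inv v := by cases v <;> rfl
  right_inv v := by rcases v with v | v | v | v <;> rfl

noncomputable instance : Fintype (HNode Q D k) := Fintype.ofEquiv _ (hNodeEquiv Q D k).symm

noncomputable instance [Fintype VQ] [Fintype VD] : Fintype (VNode VQ VD k) :=
  Fintype.ofEquiv _ (vNodeEquiv k).symm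

theorem card_hNode : Fintype.card (HNode Q D k) =
    Q.hidden.card + D.hidden.card + 6 * k + 17 := by
  rw [Fintype.card_congr (hNodeEquiv Q D k)]
  have : Fintype.card Ctl = 10 := rfl
  simp [this]
  ring

theorem card_vNode [Fintype VQ] [Fintype VD] : Fintype.card (VNode VQ VD k) =
    Fintype.card VQ + Fintype.card VD + k + 8 := by
  rw [Fintype.card_congr (vNodeEquiv k)]
  have : Fintype.card Acc = 5 := rfl
  simp [this]
  ring

/-- The number of time steps in a slot. -/
def slotLen : ℕ := max Q.time D.time + 4

/-- A control node. -/
def ctl (c : Ctl) : TransExpr (Node Q D k) := node (.inl (.ctl c))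

/-- The input, an accumulator or the output. -/
def acc (a : Acc) : TransExpr (Node Q D k) := node (.inr (.acc a))

/-- A digit of the number of the round. -/
def digit (i : Fin k) : TransExpr (Node Q D k) := node (.inl (.digit i))

/-- A stored token. -/
def mem (i : Fin k) : TransExpr (Node Q D k) := node (.inl (.mem i))

/-- The indicator of the last step of a slot. -/
noncomputable def slotEnd : TransExpr (Node Q D k) :=
  eq (ctl Q D k .tick) (nat (slotLen Q D - 1))

/-- The indicator of the last step of a round. -/
noncomputable def roundEnd : TransExpr (Node Q D k) :=
  and (slotEnd Q D k) (eq (ctl Q D k .slot) (nat (k - 1)))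

/-- The indicator of the last step for a token. -/
noncomputable def tokenEnd : TransExpr (Node Q D k) := and (roundEnd Q D k) (ctl Q D k .fin)

/-- The indicator of the last token of a block. -/
noncomputable def blockEnd : TransExpr (Node Q D k) :=
  eq (add (ctl Q D k .pos) (nat 1)) (ctl Q D k .len)

/-- The indicator that the digits before the `i`-th one are maximal. -/
noncomputable def allMax (i : ℕ) : TransExpr (Node Q D k) :=
  all fun l : Fin k => if (l : ℕ) < i then eq (digit Q D k l) (nat (m - 1)) else one

/-- The indicator that a simulated network with the RNN-time `T` makes a step, if it is to make
less than `c` steps in all. -/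
noncomputable def stepFlag (T : ℕ) (c : TransExpr (Node Q D k)) : TransExpr (Node Q D k) :=
  -- Step `0` of a slot fetches the token into `cur`, the steps `1, …, T` simulate, and the rest of
  -- the slot is idle.
  and (and (lt (nat 0) (ctl Q D k .tick)) (lt (ctl Q D k .tick) (nat (T + 1))))
    (lt (add (smul T (ctl Q D k .slot)) (ctl Q D k .tick)) c)

/-- The indicator of a step of the running copy of a network. -/
noncomputable def runFlag (T : ℕ) : TransExpr (Node Q D k) :=
  -- This allows `T * len - 1` steps in all. The output is due before the last update, which is not
  -- known to be defined.
  stepFlag Q D k T (smul T (ctl Q D k .len))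

/-- The indicator that the saved values are advanced to the next block. -/
noncomputable def advance : TransExpr (Node Q D k) :=
  and (and (ctl Q D k .fin) (blockEnd Q D k))
    -- As `start` counts from `1`, this says that the block ends before the text does. Otherwise no
    -- later block needs the saved copies, and their last update might be undefined.
    (lt (add (ctl Q D k .start) (ctl Q D k .len)) (nat (n + 1)))

/-- The indicator of a step of the saved copy of a network. -/
noncomputable def savFlag (T : ℕ) : TransExpr (Node Q D k) :=
  -- Unlike a running copy, a saved copy makes all `T * len` steps, so as to reach the start of the
  -- next block.
  and (advance Q D n k) (stepFlag Q D k T (add (smul T (ctl Q D k .len)) (nat 1)))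

/-- The indicator of the first step of a round. -/
noncomputable def reset : TransExpr (Node Q D k) :=
  and (eq (ctl Q D k .tick) (nat 0)) (eq (ctl Q D k .slot) (nat 0))

/-- Where a network with the non-input nodes `nd` finds its node values, when its channels are
given at the nodes `inp`. -/
def route {ι V W : Type} (R : RNN ι V) (inp : ι → W) (nd : V → W) (v : V) : W :=
  match R.input v with
  | some c => inp c
  | none => nd v

/-- The saved copy of a hidden node. -/
noncomputable def savNode {ι V W : Type} (R : RNN ι V) (z : W) (sv : R.hidden → W) (v : V) : W :=
  open Classical in if h : v ∈ R.hidden then sv ⟨v, h⟩ else z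

/-- The nodes at which the channels of `D` are given, if `i` is that of the index. -/
def distInp (i : Ctl) : DistInput → Node Q D k
  | .token => .inl (.ctl .cur)
  | .index => .inl (.ctl i)

/-- The nodes of the saved copy of `Q`. -/
noncomputable def savQ (v : VQ) : Node Q D k :=
  savNode Q (.inl (.ctl .zero)) (fun v => .inl (.savQ v)) v

/-- The nodes of the saved copy of `D`. -/
noncomputable def savD (v : VD) : Node Q D k :=
  savNode D (.inl (.ctl .zero)) (fun v => .inl (.savD v)) v

/-- The nodes that replace those of `Q` in the saved copy. -/
noncomputable def routeSavQ : VQ → Node Q D k :=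
  route Q (fun _ => .inl (.ctl .cur)) (savQ Q D k)

/-- The nodes that replace those of `D` in the saved copy. -/
noncomputable def routeSavD : VD → Node Q D k :=
  route D (distInp Q D k .zero) (savD Q D k)

/-- The nodes that replace those of `Q` in the running copy. -/
noncomputable def routeRunQ : VQ → Node Q D k :=
  route Q (fun _ => .inl (.ctl .cur)) fun v => .inr (.runQ v)

/-- The nodes that replace those of `D` in the running copy. -/
noncomputable def routeRunD : VD → Node Q D k :=
  route D (distInp Q D k .start) fun v => .inr (.runD v)

/-- The transition functions of the control nodes. -/
noncomputable def ctlTrans : Ctl → TransExpr (Node Q D k)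
  | .tick => ite (slotEnd Q D k) (nat 0) (add (ctl Q D k .tick) (nat 1))
  | .slot => ite (slotEnd Q D k) (bump (k - 1) (ctl Q D k .slot)) (ctl Q D k .slot)
  | .fin => ite (roundEnd Q D k) (and (not (ctl Q D k .fin)) (allMax Q D m k k)) (ctl Q D k .fin)
  | .first => tokenEnd Q D k
  | .pos => ite (tokenEnd Q D k) (ite (blockEnd Q D k) (nat 0) (add (ctl Q D k .pos) (nat 1)))
      (ctl Q D k .pos)
  | .start => ite (and (tokenEnd Q D k) (blockEnd Q D k))
      (add (ctl Q D k .start) (ctl Q D k .len)) (ctl Q D k .start)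
  | .len => ite (and (tokenEnd Q D k) (blockEnd Q D k))
      -- Two truncated differences give the minimum of `k` and the number of tokens left after the
      -- current block.
      (sub (nat k) (sub (add (add (nat k) (ctl Q D k .start)) (ctl Q D k .len)) (nat (n + 1))))
      (ctl Q D k .len)
  | .flg => ite (and (tokenEnd Q D k) (blockEnd Q D k)) one (ctl Q D k .flg)
  | .cur => pick (ctl Q D k .slot) fun i =>
      -- In the last round `fin` is `1`, and the token just received counts as known; tokens that
      -- are not known come from the digits.
      ite (lt (nat i) (add (ctl Q D k .pos) (ctl Q D k .fin))) (mem Q D k i) (digit Q D k i)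
  | .zero => nat 0

/-- The transition functions of the hidden nodes. -/
noncomputable def hTrans : HNode Q D k → TransExpr (Node Q D k)
  | .savQ v => mux ε (savFlag Q D n k Q.time)
      (guard (savFlag Q D n k Q.time) (routeSavQ Q D k) (Q.trans v)) (node (.inl (.savQ v)))
  | .savD v => mux ε (savFlag Q D n k D.time)
      (guard (savFlag Q D n k D.time) (routeSavD Q D k) (D.trans v)) (node (.inl (.savD v)))
  | .digit i => ite (and (and (roundEnd Q D k) (not (ctl Q D k .fin))) (allMax Q D m k i))
      (bump (m - 1) (digit Q D k i)) (digit Q D k i)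
  | .mem i => ite (eq (ctl Q D k .pos) (nat i)) (acc Q D k .inp) (mem Q D k i)
  | .ctl c => ctlTrans Q D m n k c
  | .pad _ => one

/-- The indicator that the output of `Q` is a factor. -/
noncomputable def readQ : TransExpr (Node Q D k) :=
  -- At tick `Q.time` all updates but the last one for this token have been made, which is when the
  -- output is due. Slots before `pos` carry known tokens and give no factor.
  and (and (eq (ctl Q D k .tick) (nat Q.time)) (lt (ctl Q D k .slot) (ctl Q D k .len)))
    (not (lt (ctl Q D k .slot) (ctl Q D k .pos)))

/-- The indicator that the output of `D` decides about a factor. -/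
noncomputable def readD : TransExpr (Node Q D k) :=
  and (and (eq (ctl Q D k .tick) (nat D.time))
    (eq (add (ctl Q D k .slot) (nat 1)) (ctl Q D k .len))) (ctl Q D k .flg)

/-- The indicator that the window of the round continues the text with the input token. -/
noncomputable def hit : TransExpr (Node Q D k) :=
  pick (ctl Q D k .pos) fun i => eq (digit Q D k i) (acc Q D k .inp)

/-- The transition functions of the accumulators and of the output node. -/
noncomputable def accTrans : Acc → TransExpr (Node Q D k)
  | .inp => one
  | .prd => ite (reset Q D k) one (prodL [acc Q D k .prd,
      ite (readQ Q D k) (node (routeRunQ Q D k Q.out)) one,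
      ite (readD Q D k) (reluL [(1, one), (γ - 1, node (routeRunD Q D k D.out))]) one])
  | .den => ite (ctl Q D k .first) (nat 0) (reluL [(1, acc Q D k .den),
      (1, prodL [roundEnd Q D k, not (ctl Q D k .fin), acc Q D k .prd])])
  | .num => ite (ctl Q D k .first) (nat 0) (reluL [(1, acc Q D k .num),
      (1, prodL [roundEnd Q D k, not (ctl Q D k .fin), hit Q D k, acc Q D k .prd])])
  | .out => prodL [acc Q D k .num,
      -- Before the last round the denominator is `1`, whatever `den` may be.
      recipL [(1, prodL [ctl Q D k .fin, acc Q D k .den]), (1, not (ctl Q D k .fin))]]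

/-- The transition functions of the nodes that are not hidden. -/
noncomputable def vTrans : VNode VQ VD k → TransExpr (Node Q D k)
  | .runQ v => if Q.input v = none then
      mux ε (runFlag Q D k Q.time)
        (guard (runFlag Q D k Q.time) (routeRunQ Q D k) (Q.trans v))
        (mux ε (reset Q D k) (node (savQ Q D k v)) (node (.inr (.runQ v))))
      else one
  | .runD v => if D.input v = none then
      mux ε (runFlag Q D k D.time)
        (guard (runFlag Q D k D.time) (routeRunD Q D k) (D.trans v))
        (mux ε (reset Q D k) (node (savD Q D k v)) (node (.inr (.runD v))))
      else one
  | .acc a => accTrans Q D k γ a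
  | .pad _ => one

/-- The initial values, for the block length `l` and the indicator `f` of distinguishing in the
first block. -/
noncomputable def initial (l : ℕ) (f : ℝ) : Node Q D k → ℝ
  | .inl (.savQ v) => Q.init v
  | .inl (.savD v) => D.init v
  | .inl (.ctl .first) => 1
  | .inl (.ctl .start) => 1
  | .inl (.ctl .len) => l
  | .inl (.ctl .flg) => f
  | _ => 0

/-- The nodes that hidden nodes may depend on. -/
def hiddenOrInput : Set (Node Q D k) := {u | u ∈ Set.range Sum.inl ∨ u = .inr (.acc .inp)}

section nodes

variable {Q D m n k}

@[simp] theorem inl_mem_hiddenOrInput (v : HNode Q D k) :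
    Sum.inl v ∈ hiddenOrInput Q D k := Or.inl ⟨v, rfl⟩

@[simp] theorem inp_mem_hiddenOrInput :
    Sum.inr (.acc .inp) ∈ hiddenOrInput Q D k := Or.inr rfl

theorem nodes_savFlag (T : ℕ) : (savFlag Q D n k T).nodes ⊆ hiddenOrInput Q D k := by
  simp [savFlag, advance, stepFlag, blockEnd, ctl]

theorem route_mem {ι V W : Type} {R : RNN ι V} {A : Set W} {inp : ι → W} {z : W}
    {sv : R.hidden → W} (hi : ∀ c, inp c ∈ A) (hz : z ∈ A) (hs : ∀ v, sv v ∈ A) (v : V) :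
    route R inp (savNode R z sv) v ∈ A := by
  unfold route savNode
  split
  · exact hi _
  · split_ifs
    · exact hs _
    · exact hz

theorem nodes_hTrans (v : HNode Q D k) :
    (hTrans Q D m n k ε v).nodes ⊆ hiddenOrInput Q D k := by
  cases v with
  | savQ v =>
    refine nodes_mux _ (nodes_savFlag _) (nodes_guard (nodes_savFlag _) _ fun v _ => ?_) (by simp)
    exact route_mem (fun _ => by simp) (by simp) (fun _ => by simp) v
  | savD v =>
    refine nodes_mux _ (nodes_savFlag _) (nodes_guard (nodes_savFlag _) _ fun v _ => ?_) (by simp)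
    refine route_mem (fun c => ?_) (by simp) (fun _ => by simp) v
    cases c <;> simp [distInp]
  | digit i =>
    simp only [hTrans, roundEnd, slotEnd, allMax, digit, ctl, nodes_ite, nodes_and, nodes_eq,
      nodes_nat, nodes_not, nodes_all, nodes_bump, nodes_node_subset, inl_mem_hiddenOrInput,
      and_true, true_and]
    intro l
    split_ifs <;> simp
  | mem i => simp [hTrans, ctl, acc, mem]
  | ctl c =>
    cases c with
    | fin =>
      simp only [hTrans, ctlTrans, roundEnd, slotEnd, allMax, digit, ctl, nodes_ite, nodes_and,
        nodes_eq, nodes_nat, nodes_not, nodes_all, nodes_node_subset, inl_mem_hiddenOrInput,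
        and_true, true_and]
      intro l
      split_ifs <;> simp
    | cur => exact nodes_pick _ _ (by simp [ctl]) fun i => by simp [ctl, mem, digit]
    | tick | slot | first | pos | start | len | flg | zero =>
      simp [hTrans, ctlTrans, tokenEnd, roundEnd, slotEnd, blockEnd, ctl]
  | pad i => simp [hTrans]

end nodes

/-- The boosted network. -/
noncomputable def net (hk : 0 < k) (l : ℕ) (f : ℝ) : RNN Unit (Node Q D k) where
  input v := match v with
    | .inr (.acc .inp) => some ()
    | _ => none
  out := .inr (.acc .out)
  trans := Sum.elim (hTrans Q D m n k ε) (vTrans Q D k ε γ)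
  init := initial Q D k l f
  time := (m ^ k + 1) * k * slotLen Q D
  time_pos := by unfold slotLen; positivity
  hidden := Finset.univ.map ⟨Sum.inl, Sum.inl_injective⟩
  hidden_not_input v hv := by
    obtain ⟨v, -, rfl⟩ := Finset.mem_map.1 hv
    rfl
  hidden_closed v hv u hu := by
    obtain ⟨v, -, rfl⟩ := Finset.mem_map.1 hv
    rcases nodes_hTrans ε v hu with ⟨u, rfl⟩ | rfl
    · exact Or.inl (Finset.mem_map.2 ⟨u, Finset.mem_univ u, rfl⟩)
    · exact Or.inr (by simp)

theorem card_hidden_net (hk : 0 < k) (l : ℕ) (f : ℝ) :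
    (net Q D m n k ε γ hk l f).hidden.card = Q.hidden.card + D.hidden.card + 6 * k + 17 := by
  rw [← card_hNode]
  exact Finset.card_map _

theorem card_node [Fintype VQ] [Fintype VD] : Fintype.card (Node Q D k) =
    Fintype.card VQ + Q.hidden.card + Fintype.card VD + D.hidden.card + 7 * k + 25 := by
  rw [Fintype.card_sum, card_hNode, card_vNode]
  ring

section cost

variable {Q D m n k}

theorem cost_mux_guard_le {V W : Type} {ε : ℝ} {σ f : TransExpr W} {ρ : V → W} {e : TransExpr V}
    {c : ℕ} (hσ : σ.cost ≤ 100) (hf : f.cost ≤ 1000) (he : e.cost ≤ c) :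
    (mux ε σ (guard σ ρ e) f).cost ≤ 10000 * 2 ^ c := by
  have h1 := cost_guard_le σ ρ e
  have h2 : (7 + 3 * σ.cost) * (2 ^ e.cost - 1) ≤ 307 * 2 ^ c :=
    Nat.mul_le_mul (by omega) ((Nat.sub_le _ _).trans (Nat.pow_le_pow_right two_pos he))
  have h3 : 1 ≤ 2 ^ c := Nat.one_le_two_pow
  rw [cost_mux]
  omega

theorem cost_allMax_le (i : ℕ) : (allMax Q D m k i).cost ≤ 1 + k * 19 := by
  refine cost_all_le fun l => ?_
  split_ifs <;> simp [digit]

/-- The numbers `m`, `n`, `ε` and `γ` enter as coefficients of linear forms, which cost nothing.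
Only `hit`, `allMax` and the choice of `cur` grow with `k`, and only the guarded copies depend on
`c`. -/
theorem costLE_net {c : ℕ} (hQ : Q.CostLE c) (hD : D.CostLE c) (hk : 0 < k) (l : ℕ) (f : ℝ) :
    (net Q D m n k ε γ hk l f).CostLE (10000 * 2 ^ c + 1000 * k) := by
  have h3 : 1 ≤ 2 ^ c := Nat.one_le_two_pow
  rintro (v | v) hv
  · change (hTrans Q D m n k ε v).cost ≤ _
    cases v with
    | savQ v =>
      refine (cost_mux_guard_le ?_ (by simp) (hQ v (Q.hidden_not_input v v.2))).trans
        (Nat.le_add_right _ _)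
      simp [savFlag, advance, stepFlag, blockEnd, ctl]
    | savD v =>
      refine (cost_mux_guard_le ?_ (by simp) (hD v (D.hidden_not_input v v.2))).trans
        (Nat.le_add_right _ _)
      simp [savFlag, advance, stepFlag, blockEnd, ctl]
    | digit i =>
      have := cost_allMax_le (Q := Q) (D := D) (m := m) (k := k) i
      simp [hTrans, roundEnd, slotEnd, ctl, digit]
      omega
    | mem i =>
      simp [hTrans, ctl, acc, mem]
      omega
    | ctl a =>
      cases a with
      | fin =>
        have := cost_allMax_le (Q := Q) (D := D) (m := m) (k := k) k
        simp [hTrans, ctlTrans, roundEnd, slotEnd, ctl]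
        omega
      | cur =>
        refine (cost_pick_le _ (b := 100) fun i => by simp [ctl, mem, digit]).trans ?_
        simp [ctl]
        omega
      | tick | slot | first | pos | start | len | flg | zero =>
        simp [hTrans, ctlTrans, tokenEnd, roundEnd, slotEnd, blockEnd, ctl]
        omega
    | pad i => simp [hTrans]; omega
  · change (vTrans Q D k ε γ v).cost ≤ _
    cases v with
    | runQ v =>
      simp only [vTrans]
      split_ifs with h
      · refine (cost_mux_guard_le ?_ ?_ (hQ v h)).trans (Nat.le_add_right _ _)
        · simp [runFlag, stepFlag, ctl]
        · simp [cost_mux, reset, ctl]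
      · simp; omega
    | runD v =>
      simp only [vTrans]
      split_ifs with h
      · refine (cost_mux_guard_le ?_ ?_ (hD v h)).trans (Nat.le_add_right _ _)
        · simp [runFlag, stepFlag, ctl]
        · simp [cost_mux, reset, ctl]
      · simp; omega
    | acc a =>
      cases a with
      | num =>
        have : (hit Q D k).cost ≤ 1 + k * (20 + 2 * 0 + 15) := by
          refine cost_pick_le (ctl Q D k .pos) fun i => ?_
          simp [digit, acc]
        simp [vTrans, accTrans, roundEnd, slotEnd, ctl, acc]
        omega
      | inp | prd | den | out =>
        simp [vTrans, accTrans, reset, readQ, readD, roundEnd, slotEnd, ctl, acc]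
        omega
    | pad i => simp [vTrans]; omega

end cost

end Boost

/-! ### Simulation of a network by copies inside another one. -/

namespace RNN

variable {ι V : Type} (R : RNN ι V)

theorem runFrom_congr {ξ ξ' : ℕ → ι → ℝ} (s : V → ℝ) {t : ℕ}
    (h : ∀ t' < t, ξ (t' / R.time) = ξ' (t' / R.time)) : R.runFrom ξ s t = R.runFrom ξ' s t := by
  induction t with
  | zero => rfl
  | succ t ih =>
    rw [runFrom, runFrom, ih fun t' ht' => h t' (by omega), h t (Nat.lt_succ_self t)]

theorem runFrom_congr_of_lt {ξ ξ' : ℕ → ι → ℝ} (s : V → ℝ) {t l : ℕ} (hl : t ≤ l * R.time)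
    (h : ∀ a < l, ξ a = ξ' a) : R.runFrom ξ s t = R.runFrom ξ' s t :=
  R.runFrom_congr s fun t' ht' => h _ <| by
    rw [Nat.div_lt_iff_lt_mul R.time_pos]
    omega

/-- The state that agrees with `s` on the hidden nodes and is `0` elsewhere. -/
noncomputable def restrict (s : V → ℝ) (v : V) : ℝ :=
  open Classical in if v ∈ R.hidden then s v else 0

end RNN

namespace Boost

open TransExpr

/-- A value is at most `0` or greater than `ε`. -/
def Gap (ε v : ℝ) : Prop := 0 < v → ε < v

/-- Half of the least positive value works. All smaller `ε'` are admitted so that several bounds can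
be merged into a minimum. -/
theorem exists_gap {α : Type*} [Finite α] (f : α → ℝ) : ∃ ε > 0, ∀ ε' ≤ ε, ∀ a, Gap ε' (f a) := by
  cases isEmpty_or_nonempty α with
  | inl h => exact ⟨1, one_pos, fun _ _ a => isEmptyElim a⟩
  | inr h =>
    obtain ⟨a, ha⟩ := Finite.exists_min fun a => if 0 < f a then f a else 1
    refine ⟨(if 0 < f a then f a else 1) / 2, by split_ifs <;> linarith, fun ε' hε' b hb => ?_⟩
    have := ha b
    rw [if_pos hb] at this
    have : 0 < if 0 < f a then f a else 1 := by split_ifs <;> linarith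
    linarith

section simulation

variable {ι V W : Type} {R : RNN ι V} {σ : W → ℝ} {ε : ℝ} {flag : TransExpr W} {p : Prop}
  [Decidable p] {inp : ι → W} {ξ : ι → ℝ} {s : V → ℝ}

theorem apply_savNode {z : W} {sv : R.hidden → W} (hs : ∀ v, σ (sv v) = s v) (hz : σ z = 0)
    (v : V) : σ (savNode R z sv v) = R.restrict s v := by
  unfold savNode RNN.restrict
  split_ifs with h
  · exact hs ⟨v, h⟩
  · exact hz

theorem apply_route_savNode {z : W} {sv : R.hidden → W} (hs : ∀ v, σ (sv v) = s v)
    (hi : ∀ c, σ (inp c) = ξ c) {v : V} (hv : v ∈ R.hidden ∨ R.input v ≠ none) :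
    σ (route R inp (savNode R z sv) v) = R.view ξ s v := by
  unfold route RNN.view
  cases h : R.input v with
  | some c => exact hi c
  | none =>
    have hv := hv.resolve_right (by simp [h])
    simp only [savNode, dif_pos hv, hs]

theorem comp_route {nd : V → W} (hn : ∀ v, R.input v = none → σ (nd v) = s v)
    (hi : ∀ c, σ (inp c) = ξ c) : (fun v => σ (route R inp nd v)) = R.view ξ s := by
  funext v
  unfold route RNN.view
  cases h : R.input v with
  | some c => exact hi c
  | none => exact hn v h

/-- Here `s` is a full state of `R`, of which only the hidden part is stored; by `hidden_closed`
this part and the inputs determine its own update. -/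
theorem eval_saved (hε : 0 < ε) {z : W} {sv : R.hidden → W} (hs : ∀ v, σ (sv v) = s v)
    (hi : p → ∀ c, σ (inp c) = ξ c) (hf : flag.eval σ = if p then 1 else 0) (v : R.hidden)
    (hg : Gap ε (if p then R.step ξ s v else s v)) :
    (mux ε flag (guard flag (route R inp (savNode R z sv)) (R.trans v)) (node (sv v))).eval σ =
      if p then R.step ξ s v else s v := by
  have h : (if p then (guard flag (route R inp (savNode R z sv)) (R.trans v)).eval σ
      else (node (sv v)).eval σ) = if p then R.step ξ s v else s v := by
    split_ifs with hp
    · rw [if_pos hp] at hf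
      rw [eval_guard hf]
      exact eval_congr _ fun u hu => apply_route_savNode hs (hi hp) (R.hidden_closed v v.2 u hu)
    · exact hs v
  rw [eval_mux hε hf (by rwa [h]), h]

theorem defined_saved (hε : 0 < ε) {z : W} {sv : R.hidden → W} (hs : ∀ v, σ (sv v) = s v)
    (hi : p → ∀ c, σ (inp c) = ξ c) (hf : flag.eval σ = if p then 1 else 0)
    (hf' : flag.Defined σ) (v : R.hidden) (hg : Gap ε (if p then R.step ξ s v else s v))
    (hd : p → R.StepDefined ξ s) :
    (mux ε flag (guard flag (route R inp (savNode R z sv)) (R.trans v))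
      (node (sv v))).Defined σ := by
  have h : (if p then (guard flag (route R inp (savNode R z sv)) (R.trans v)).eval σ
      else (node (sv v)).eval σ) = if p then R.step ξ s v else s v := by
    split_ifs with hp
    · rw [if_pos hp] at hf
      rw [eval_guard hf]
      exact eval_congr _ fun u hu => apply_route_savNode hs (hi hp) (R.hidden_closed v v.2 u hu)
    · exact hs v
  refine defined_mux hε hf (by rwa [h]) hf' ?_ trivial
  by_cases hp : p
  · rw [if_pos hp] at hf
    refine defined_guard_of_one hf hf' _ _ ?_
    exact (defined_congr _ fun u hu => apply_route_savNode hs (hi hp)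
      (R.hidden_closed v v.2 u hu)).2 (hd hp v (R.hidden_not_input v v.2))
  · rw [if_neg hp] at hf
    exact defined_guard_of_zero hf hf' _ _

/-- A simulated step has priority over loading, and loading over holding. The stored values have to
be those of `s` only when a step is made; before loading they may be anything. -/
theorem eval_running (hε : 0 < ε) {nd : V → W} {rst : TransExpr W} {r : Prop} [Decidable r]
    (hn : p → ∀ v, R.input v = none → σ (nd v) = s v) (hi : p → ∀ c, σ (inp c) = ξ c)
    (hf : flag.eval σ = if p then 1 else 0) (hr : rst.eval σ = if r then 1 else 0)
    {v : V} {a : W} (hg : p → Gap ε (R.step ξ s v))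
    (hg' : Gap ε (if r then σ a else σ (nd v))) :
    (mux ε flag (guard flag (route R inp nd) (R.trans v))
      (mux ε rst (node a) (node (nd v)))).eval σ =
        if p then R.step ξ s v else if r then σ a else σ (nd v) := by
  have h0 := eval_mux (e := node a) (f := node (nd v)) hε hr hg'
  have h : (if p then (guard flag (route R inp nd) (R.trans v)).eval σ
      else (mux ε rst (node a) (node (nd v))).eval σ) =
      if p then R.step ξ s v else if r then σ a else σ (nd v) := by
    split_ifs with hp hr'
    · rw [if_pos hp] at hf
      rw [eval_guard hf, comp_route (hn hp) (hi hp)]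
      rfl
    · rw [h0, if_pos hr']; rfl
    · rw [h0, if_neg hr']; rfl
  rw [eval_mux hε hf, h]
  rw [h]
  by_cases hp : p
  · rw [if_pos hp]; exact hg hp
  · rw [if_neg hp]; exact hg'

theorem defined_running (hε : 0 < ε) {nd : V → W} {rst : TransExpr W} {r : Prop} [Decidable r]
    (hn : p → ∀ v, R.input v = none → σ (nd v) = s v) (hi : p → ∀ c, σ (inp c) = ξ c)
    (hf : flag.eval σ = if p then 1 else 0) (hr : rst.eval σ = if r then 1 else 0)
    (hf' : flag.Defined σ) (hr' : rst.Defined σ)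
    {v : V} {a : W} (hv : R.input v = none) (hg : p → Gap ε (R.step ξ s v))
    (hg' : Gap ε (if r then σ a else σ (nd v))) (hd : p → R.StepDefined ξ s) :
    (mux ε flag (guard flag (route R inp nd) (R.trans v))
      (mux ε rst (node a) (node (nd v)))).Defined σ := by
  have h0 := eval_mux (e := node a) (f := node (nd v)) hε hr hg'
  refine defined_mux hε hf ?_ hf' ?_ (defined_mux hε hr hg' hr' trivial trivial)
  · by_cases hp : p
    · rw [if_pos hp] at hf
      rw [if_pos hp, eval_guard hf, comp_route (hn hp) (hi hp)]
      exact hg hp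
    · rw [if_neg hp, h0]
      exact hg'
  · by_cases hp : p
    · rw [if_pos hp] at hf
      refine defined_guard_of_one hf hf' _ _ ?_
      rw [comp_route (hn hp) (hi hp)]
      exact hd hp v hv
    · rw [if_neg hp] at hf
      exact defined_guard_of_zero hf hf' _ _

end simulation

/-! ### Digits -/

theorem digit_zero_succ {m : ℕ} (hm : 0 < m) (ρ : ℕ) :
    ((ρ + 1) / m = ρ / m + if ρ % m = m - 1 then 1 else 0) ∧
      (ρ + 1) % m = if ρ % m = m - 1 then 0 else ρ % m + 1 := by
  have h1 := Nat.div_add_mod ρ m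
  have h2 := Nat.mod_lt ρ hm
  split_ifs with h
  · have : ρ + 1 = m * (ρ / m + 1) := by rw [mul_add]; omega
    rw [this]
    exact ⟨Nat.mul_div_cancel_left _ hm, Nat.mul_mod_right _ _⟩
  · have : ρ + 1 = (ρ % m + 1) + m * (ρ / m) := by omega
    constructor
    · conv_lhs => rw [this]
      rw [Nat.add_mul_div_left _ _ hm, Nat.div_eq_of_lt (by omega)]
      ring
    · conv_lhs => rw [this]
      rw [Nat.add_mul_mod_self_left, Nat.mod_eq_of_lt (by omega)]

/-- Induction that strips the lowest digit: the quotient by `m` moves on exactly when that digit is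
`m - 1`. -/
theorem digit_succ {m : ℕ} (hm : 0 < m) (i ρ : ℕ) :
    (ρ + 1) / m ^ i % m =
      if ∀ l < i, ρ / m ^ l % m = m - 1 then
        (if ρ / m ^ i % m = m - 1 then 0 else ρ / m ^ i % m + 1) else ρ / m ^ i % m := by
  induction i generalizing ρ with
  | zero => simpa using (digit_zero_succ hm ρ).2
  | succ i ih =>
    have hd : ∀ a l, a / m ^ (l + 1) = a / m / m ^ l := fun a l => by
      rw [Nat.div_div_eq_div_mul, pow_succ']
    have hall : (∀ l < i + 1, ρ / m ^ l % m = m - 1) ↔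
        ρ % m = m - 1 ∧ ∀ l < i, ρ / m / m ^ l % m = m - 1 := by
      constructor
      · intro h
        exact ⟨by simpa using h 0 (by omega), fun l hl => by rw [← hd]; exact h _ (by omega)⟩
      · rintro ⟨h0, h⟩ l hl
        cases l with
        | zero => simpa using h0
        | succ l => rw [hd]; exact h l (by omega)
    rw [hd, hd, (digit_zero_succ hm ρ).1]
    by_cases h : ρ % m = m - 1
    · rw [if_pos h, ih]
      exact if_congr (by rw [hall]; simp [h]) rfl rfl
    · rw [if_neg h, if_neg (fun h' => h (hall.1 h').1)]
      rfl

/-- This is how the network recognises the last window and sets `fin`. -/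
theorem digits_max_iff {m : ℕ} (hm : 0 < m) (k : ℕ) {ρ : ℕ} (hρ : ρ < m ^ k) :
    (∀ l < k, ρ / m ^ l % m = m - 1) ↔ ρ + 1 = m ^ k := by
  induction k generalizing ρ with
  | zero => simpa using hρ
  | succ k ih =>
    have hd : ∀ a l, a / m ^ (l + 1) = a / m / m ^ l := fun a l => by
      rw [Nat.div_div_eq_div_mul, pow_succ']
    have hρ' : ρ / m < m ^ k := Nat.div_lt_of_lt_mul (by rwa [← pow_succ'])
    have h1 := Nat.div_add_mod ρ m
    have h2 := Nat.mod_lt ρ hm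
    have hall : (∀ l < k + 1, ρ / m ^ l % m = m - 1) ↔
        ρ % m = m - 1 ∧ ∀ l < k, ρ / m / m ^ l % m = m - 1 := by
      constructor
      · intro h
        exact ⟨by simpa using h 0 (by omega), fun l hl => by rw [← hd]; exact h _ (by omega)⟩
      · rintro ⟨h0, h⟩ l hl
        cases l with
        | zero => simpa using h0
        | succ l => rw [hd]; exact h l (by omega)
    rw [hall, ih hρ', pow_succ']
    constructor
    · rintro ⟨h3, h4⟩
      rw [← h4, mul_add]
      omega
    · intro h
      have h5 : m * (ρ / m + 1) = m * m ^ k := by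
        have h6 : m ∣ ρ + 1 := ⟨_, h⟩
        have h7 := (digit_zero_succ hm ρ).2
        rw [Nat.mod_eq_zero_of_dvd h6] at h7
        split_ifs at h7 with h8
        rw [mul_add]
        omega
      have h6 := Nat.eq_of_mul_eq_mul_left hm h5
      refine ⟨?_, h6⟩
      rw [← h, mul_add] at h5
      omega

/-- In the extra round `ρ = m ^ k` the counter has overflowed and shows zeros, as the next token
needs it. -/
theorem digit_pow {m : ℕ} (hm : 0 < m) {i k : ℕ} (hi : i < k) : m ^ k / m ^ i % m = 0 := by
  rw [Nat.pow_div hi.le hm, show k - i = (k - i - 1) + 1 by omega, pow_succ, Nat.mul_mod_left]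

/-! ### Blocks -/

/-- The length of the block that contains position `j`. -/
def blockLen (k o n j : ℕ) : ℕ := min (if j < o then o else k) (n - blockStart k o j)

section blocks

variable {k o n j : ℕ}

theorem blockStart_le (j : ℕ) : blockStart k o j ≤ j := by
  unfold blockStart
  split_ifs <;> omega

theorem lt_blockStart_add (hk : 0 < k) (hj : j < n) :
    j < blockStart k o j + blockLen k o n j := by
  unfold blockLen blockStart
  have := Nat.mod_lt (j - o) hk
  have := Nat.mod_le (j - o) k
  split_ifs <;> omega

theorem blockStart_add_le (hj : j < n) : blockStart k o j + blockLen k o n j ≤ n := by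
  unfold blockLen
  have := blockStart_le (k := k) (o := o) j
  omega

theorem blockLen_le (ho : o < k) : blockLen k o n j ≤ k := by
  unfold blockLen
  split_ifs <;> omega

theorem blockLen_of_le (hj : o ≤ j) : blockLen k o n j = min k (n - blockStart k o j) := by
  unfold blockLen
  rw [if_neg (by omega)]

/-- By `j + 1 < n` the block is not cut short by the end of the text; it has its full length, so the
next position is `o` or lies a multiple of `k` after it. -/
theorem block_succ_of_eq (hk : 0 < k) (hj : j + 1 < n)
    (h : j + 1 = blockStart k o j + blockLen k o n j) :
    o ≤ j + 1 ∧ blockStart k o (j + 1) = j + 1 ∧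
      blockLen k o n (j + 1) = min k (n - (j + 1)) := by
  have h1 : o ≤ j + 1 ∧ blockStart k o (j + 1) = j + 1 := by
    unfold blockLen blockStart at h
    unfold blockStart
    have h2 := Nat.mod_lt (j - o) hk
    have h3 := Nat.mod_le (j - o) k
    by_cases hjo : j < o
    · rw [if_pos hjo, if_pos hjo] at h
      have : j + 1 = o := by omega
      simp [this]
    · rw [if_neg hjo, if_neg hjo] at h
      have h4 := (digit_zero_succ hk (j - o)).2
      rw [if_pos (by omega)] at h4
      rw [if_neg (by omega), show j + 1 - o = j - o + 1 by omega, h4]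
      omega
  exact ⟨h1.1, h1.2, by rw [blockLen_of_le h1.1, h1.2]⟩

theorem block_succ_of_ne (hk : 0 < k) (hj : j + 1 < n)
    (h : j + 1 ≠ blockStart k o j + blockLen k o n j) :
    (j + 1 < o ↔ j < o) ∧ blockStart k o (j + 1) = blockStart k o j ∧
      blockLen k o n (j + 1) = blockLen k o n j := by
  have h1 : (j + 1 < o ↔ j < o) ∧ blockStart k o (j + 1) = blockStart k o j := by
    unfold blockLen blockStart at h
    unfold blockStart
    have h2 := Nat.mod_lt (j - o) hk
    have h3 := Nat.mod_le (j - o) k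
    by_cases hjo : j < o
    · rw [if_pos hjo, if_pos hjo] at h
      have : j + 1 < o := by omega
      simp [this, hjo]
    · rw [if_neg hjo, if_neg hjo] at h
      have h4 := (digit_zero_succ hk (j - o)).2
      rw [if_neg (by omega)] at h4
      rw [if_neg (by omega), if_neg hjo, show j + 1 - o = j - o + 1 by omega, h4]
      omega
  refine ⟨h1.1, h1.2, ?_⟩
  unfold blockLen
  rw [h1.2]
  simp only [h1.1]

end blocks

/-! ### Progress in a round -/

/-- The number of steps that a simulated network with RNN-time `T` has made before step `s` of
slot `u`, if it makes at most `c` steps in all. -/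
def progress (T c u s : ℕ) : ℕ := min (u * T + min (s - 1) T) c

section progress

variable {T c u s : ℕ}

theorem progress_zero : progress T c 0 0 = 0 := by simp [progress]

theorem progress_eq (h : (0 < s ∧ s < T + 1) ∧ T * u + s < c + 1) :
    progress T c u s = u * T + (s - 1) := by
  rw [mul_comm] at h
  unfold progress
  omega

theorem progress_succ :
    progress T c u (s + 1) =
      if (0 < s ∧ s < T + 1) ∧ T * u + s < c + 1 then progress T c u s + 1
      else progress T c u s := by
  unfold progress
  rw [mul_comm T u]
  split_ifs <;> omega

/-- All `T` steps of the slot are over; the spare steps of a slot ensure this at its last tick. -/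
theorem progress_slot_succ (hs : T + 1 < s) : progress T c (u + 1) 0 = progress T c u s := by
  unfold progress
  rw [add_mul]
  omega

end progress

end Boost

/-! ### Correctness of the hidden nodes. -/

namespace Boost

open TransExpr

/-- The tokens of a text as inputs for the network of a language model. -/
def tokStream {m n : ℕ} (x : Fin n → Fin m) (a : ℕ) (_ : Unit) : ℝ := tokenValue x a

/-- The tokens of a text as inputs for the network of a distinguisher, before any window. -/
def idleStream {m n : ℕ} (x : Fin n → Fin m) (a : ℕ) : DistInput → ℝ
  | .token => tokenValue x a
  | .index => 0

theorem tokStream_congr {m n : ℕ} {x y : Fin n → Fin m} {b : ℕ}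
    (h : ∀ l : Fin n, (l : ℕ) < b → x l = y l) {a : ℕ} (ha : a < b) :
    tokenValue x a = tokenValue y a := by
  unfold tokenValue
  split_ifs with hn
  · rw [h ⟨a, hn⟩ ha]
  · rfl

variable {m n k o : ℕ} {VQ VD : Type} {q : LangModel m n} {d : Distinguisher m n k}
  {Q : RNN Unit VQ} {D : RNN DistInput VD} {ε γ : ℝ}

/-- The data of the boosted network, with a bound `ε` for the positive values that occur. -/
structure Setup (q : LangModel m n) (d : Distinguisher m n k) (Q : RNN Unit VQ)
    (D : RNN DistInput VD) (o : ℕ) (ε : ℝ) : Prop where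
  m_pos : 0 < m
  k_pos : 0 < k
  o_lt : o < k
  ε_pos : 0 < ε
  repQ : Q.RepresentsLM q
  repD : D.RepresentsDist d
  gap_savQ : ∀ x : Fin n → Fin m, ∀ t ≤ n * Q.time, ∀ v,
    Gap ε (Q.runFrom (tokStream x) Q.init t v)
  gap_savD : ∀ x : Fin n → Fin m, ∀ t ≤ n * D.time, ∀ v,
    Gap ε (D.runFrom (idleStream x) D.init t v)
  gap_runQ : ∀ (x : Fin n → Fin m) (b : Fin n), ∀ t ≤ n * Q.time, ∀ v,
    Gap ε (Q.runFrom (fun a => tokStream x (b + a))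
      (Q.restrict (Q.runFrom (tokStream x) Q.init (b * Q.time))) t v)
  gap_runD : ∀ (x : Fin n → Fin m) (b : Fin n), ∀ t ≤ n * D.time, ∀ v,
    Gap ε (D.runFrom (fun a => distStream b x (b + a))
      (D.restrict (D.runFrom (idleStream x) D.init (b * D.time))) t v)

/-- The window of round `ρ`. -/
def window {m : ℕ} (hm : 0 < m) (k ρ : ℕ) : Fin k → Fin m :=
  fun i => ⟨ρ / m ^ (i : ℕ) % m, Nat.mod_lt _ hm⟩

/-- The text that is tried in round `ρ` when the tokens of `x` before position `j` are known; in
the last round the token at `j` is known, too. -/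
def guess (hm : 0 < m) (k o : ℕ) (x : Fin n → Fin m) (j ρ : ℕ) : Fin n → Fin m :=
  LangModel.splice (blockStart k o j) (blockStart k o j + blockLen k o n j)
    (j + if ρ = m ^ k then 1 else 0) x (window hm k ρ)

/-- The number of steps that the saved copy of a network with RNN-time `T` has made. -/
def savTime (m n k o T j ρ u s : ℕ) : ℕ :=
  blockStart k o j * T +
    if (ρ = m ^ k ∧ j - blockStart k o j + 1 = blockLen k o n j) ∧
      blockStart k o j + 1 + blockLen k o n j < n + 1
    then progress T (blockLen k o n j * T) u s else 0

/-- The node values in step `s` of slot `u` of round `ρ` for the token at `j` are correct at the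
input node and at the hidden nodes. -/
structure HiddenOK (hm : 0 < m) (Q : RNN Unit VQ) (D : RNN DistInput VD) (o : ℕ)
    (x : Fin n → Fin m) (j ρ u s : ℕ) (σ : Node Q D k → ℝ) : Prop where
  inp : (acc Q D k .inp).eval σ = tokenValue x j
  tick : (ctl Q D k .tick).eval σ = s
  slot : (ctl Q D k .slot).eval σ = u
  fin : (ctl Q D k .fin).eval σ = if ρ = m ^ k then 1 else 0
  first : (ctl Q D k .first).eval σ = if ρ = 0 ∧ u = 0 ∧ s = 0 then 1 else 0
  pos : (ctl Q D k .pos).eval σ = ((j - blockStart k o j : ℕ) : ℝ)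
  start : (ctl Q D k .start).eval σ = ((blockStart k o j + 1 : ℕ) : ℝ)
  len : (ctl Q D k .len).eval σ = (blockLen k o n j : ℕ)
  flg : (ctl Q D k .flg).eval σ = if o ≤ j then 1 else 0
  zero : (ctl Q D k .zero).eval σ = 0
  digit : ∀ i : Fin k, (digit Q D k i).eval σ = ((ρ / m ^ (i : ℕ) % m : ℕ) : ℝ)
  -- The current token is stored by the first update after its arrival, hence the excluded time.
  mem : ∀ i : Fin k, blockStart k o j + i < j ∨
      (blockStart k o j + i = j ∧ ¬(ρ = 0 ∧ u = 0 ∧ s = 0)) →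
    (mem Q D k i).eval σ = tokenValue x (blockStart k o j + i)
  -- The token of the slot arrives at `cur` one step after the slot begins.
  cur : 0 < s → u < blockLen k o n j →
    (ctl Q D k .cur).eval σ = tokenValue (guess hm k o x j ρ) (blockStart k o j + u)
  savQ : ∀ v, σ (.inl (.savQ v)) =
    Q.runFrom (tokStream x) Q.init (savTime m n k o Q.time j ρ u s) v
  savD : ∀ v, σ (.inl (.savD v)) =
    D.runFrom (idleStream x) D.init (savTime m n k o D.time j ρ u s) v

section eval

variable {hm : 0 < m} {x : Fin n → Fin m} {j ρ u s : ℕ} {σ : Node Q D k → ℝ}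

theorem HiddenOK.eval_slotEnd (h : HiddenOK hm Q D o x j ρ u s σ) :
    (slotEnd Q D k).eval σ = if s = slotLen Q D - 1 then 1 else 0 :=
  eval_eq h.tick (eval_nat _ _)

theorem HiddenOK.eval_roundEnd (h : HiddenOK hm Q D o x j ρ u s σ) :
    (roundEnd Q D k).eval σ = if s = slotLen Q D - 1 ∧ u = k - 1 then 1 else 0 :=
  eval_and h.eval_slotEnd (eval_eq h.slot (eval_nat _ _))

theorem HiddenOK.eval_tokenEnd (h : HiddenOK hm Q D o x j ρ u s σ) :
    (tokenEnd Q D k).eval σ =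
      if (s = slotLen Q D - 1 ∧ u = k - 1) ∧ ρ = m ^ k then 1 else 0 :=
  eval_and h.eval_roundEnd h.fin

theorem eval_nat_one (σ : Node Q D k → ℝ) :
    (nat 1 : TransExpr (Node Q D k)).eval σ = ((1 : ℕ) : ℝ) := eval_nat σ 1

theorem HiddenOK.eval_blockEnd (h : HiddenOK hm Q D o x j ρ u s σ) :
    (blockEnd Q D k).eval σ =
      if j - blockStart k o j + 1 = blockLen k o n j then 1 else 0 :=
  eval_eq (eval_add h.pos (eval_nat_one σ)) h.len

theorem HiddenOK.eval_allMax (h : HiddenOK hm Q D o x j ρ u s σ) {i : ℕ} (hi : i ≤ k) :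
    (allMax Q D m k i).eval σ = if ∀ l < i, ρ / m ^ l % m = m - 1 then 1 else 0 := by
  have h1 := eval_all (s := σ) (p := fun l : Fin k => (l : ℕ) < i → ρ / m ^ (l : ℕ) % m = m - 1)
    (e := fun l : Fin k => if (l : ℕ) < i then eq (Boost.digit Q D k l) (nat (m - 1)) else one)
    fun l => by
      by_cases hl : (l : ℕ) < i
      · simp only [if_pos hl]
        rw [eval_eq (h.digit l) (eval_nat _ _)]
        simp [hl]
      · simp [hl]
  rw [allMax, h1]
  refine if_congr ⟨fun h l hl => h ⟨l, by omega⟩ hl, fun h l hl => h l hl⟩ rfl rfl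

theorem HiddenOK.eval_stepFlag (h : HiddenOK hm Q D o x j ρ u s σ) (T : ℕ)
    {e : TransExpr (Node Q D k)} {c : ℕ} (he : e.eval σ = c) :
    (stepFlag Q D k T e).eval σ =
      if (0 < s ∧ s < T + 1) ∧ T * u + s < c then 1 else 0 :=
  eval_and (eval_and (eval_lt (eval_nat σ 0) h.tick) (eval_lt h.tick (eval_nat σ (T + 1))))
    (eval_lt (eval_add (eval_smul T h.slot) h.tick) he)

theorem HiddenOK.eval_runFlag (h : HiddenOK hm Q D o x j ρ u s σ) (T : ℕ) :
    (runFlag Q D k T).eval σ =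
      if (0 < s ∧ s < T + 1) ∧ T * u + s < T * blockLen k o n j then 1 else 0 :=
  h.eval_stepFlag T (eval_smul T h.len)

theorem HiddenOK.eval_savFlag (h : HiddenOK hm Q D o x j ρ u s σ) (T : ℕ) :
    (savFlag Q D n k T).eval σ =
      if ((ρ = m ^ k ∧ j - blockStart k o j + 1 = blockLen k o n j) ∧
          blockStart k o j + 1 + blockLen k o n j < n + 1) ∧
        (0 < s ∧ s < T + 1) ∧ T * u + s < T * blockLen k o n j + 1 then 1 else 0 :=
  eval_and (eval_and (eval_and h.fin h.eval_blockEnd)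
    (eval_lt (eval_add h.start h.len) (eval_nat σ (n + 1))))
    (h.eval_stepFlag T (eval_add (eval_smul T h.len) (eval_nat_one σ)))

theorem HiddenOK.eval_reset (h : HiddenOK hm Q D o x j ρ u s σ) :
    (reset Q D k).eval σ = if s = 0 ∧ u = 0 then 1 else 0 :=
  eval_and (eval_eq h.tick (eval_nat σ 0)) (eval_eq h.slot (eval_nat σ 0))

theorem defined_savFlag (σ : Node Q D k → ℝ) (T : ℕ) : (savFlag Q D n k T).Defined σ := by
  simp [savFlag, advance, stepFlag, blockEnd, ctl]

theorem tokenValue_nonneg (x : Fin n → Fin m) (a : ℕ) : 0 ≤ tokenValue x a := by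
  unfold tokenValue
  split_ifs
  · positivity
  · exact le_rfl

theorem guess_of_lt {l : Fin n} (hl : (l : ℕ) < j + if ρ = m ^ k then 1 else 0) :
    guess hm k o x j ρ l = x l :=
  LangModel.splice_of_lt _ _ hl

theorem tokenValue_guess_of_lt {l : ℕ} (hl : l < j + if ρ = m ^ k then 1 else 0) :
    tokenValue (guess hm k o x j ρ) l = tokenValue x l :=
  tokStream_congr (b := l + 1) (fun l' hl' => guess_of_lt (by omega)) (Nat.lt_succ_self l)

theorem tokenValue_guess_of_le (hj : j < n) {u : Fin k}
    (hu : j + (if ρ = m ^ k then 1 else 0) ≤ blockStart k o j + u)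
    (hu' : (u : ℕ) < blockLen k o n j) :
    tokenValue (guess hm k o x j ρ) (blockStart k o j + u) = ((ρ / m ^ (u : ℕ) % m : ℕ) : ℝ) := by
  have h1 := blockStart_add_le (k := k) (o := o) hj
  unfold tokenValue
  rw [dif_pos (by omega)]
  unfold guess LangModel.splice
  rw [dif_pos]
  · simp [window]
  · simp only [add_tsub_cancel_left]
    exact ⟨hu, by omega, u.2⟩

/-- The simulated steps of a saved copy. -/
theorem savTime_facts {T : ℕ} (hT : 0 < T)
    (hp : ((ρ = m ^ k ∧ j - blockStart k o j + 1 = blockLen k o n j) ∧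
          blockStart k o j + 1 + blockLen k o n j < n + 1) ∧
        (0 < s ∧ s < T + 1) ∧ T * u + s < T * blockLen k o n j + 1) :
    savTime m n k o T j ρ u s / T = blockStart k o j + u ∧ u < blockLen k o n j ∧
      savTime m n k o T j ρ u s < (blockStart k o j + blockLen k o n j) * T := by
  have h1 : savTime m n k o T j ρ u s = (s - 1) + T * (blockStart k o j + u) := by
    rw [savTime, if_pos hp.1, progress_eq (by rw [mul_comm (blockLen k o n j)]; exact hp.2)]
    ring
  have h2 : u < blockLen k o n j := by
    by_contra hu
    have := Nat.mul_le_mul_left T (not_lt.1 hu)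
    omega
  refine ⟨?_, h2, ?_⟩
  · rw [h1, Nat.add_mul_div_left _ _ hT, Nat.div_eq_of_lt (by omega), zero_add]
  · rw [h1, mul_comm _ T, mul_add, mul_add]
    omega

theorem savTime_le {T : ℕ} (hj : j < n) : savTime m n k o T j ρ u s ≤ n * T := by
  have h1 := Nat.mul_le_mul_right T (blockStart_add_le (k := k) (o := o) hj)
  have h2 : progress T (blockLen k o n j * T) u s ≤ blockLen k o n j * T := min_le_right _ _
  rw [add_mul] at h1
  unfold savTime
  split_ifs <;> omega

/-- The time of a saved copy after a step within a token. -/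
theorem savTime_succ {T ρ' u' s' S : ℕ} (hS : T + 4 ≤ S) (hu : u < k) (hs : s < S) (hρ : ρ ≤ m ^ k)
    (hlast : ¬((s = S - 1 ∧ u = k - 1) ∧ ρ = m ^ k))
    (hs' : s' = if s = S - 1 then 0 else s + 1)
    (hu' : u' = if s = S - 1 then if u = k - 1 then 0 else u + 1 else u)
    (hρ' : ρ' = if s = S - 1 ∧ u = k - 1 then ρ + 1 else ρ) :
    savTime m n k o T j ρ' u' s' =
      if ((ρ = m ^ k ∧ j - blockStart k o j + 1 = blockLen k o n j) ∧
          blockStart k o j + 1 + blockLen k o n j < n + 1) ∧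
        (0 < s ∧ s < T + 1) ∧ T * u + s < T * blockLen k o n j + 1
      then savTime m n k o T j ρ u s + 1 else savTime m n k o T j ρ u s := by
  by_cases h : ((ρ = m ^ k ∧ j - blockStart k o j + 1 = blockLen k o n j) ∧
          blockStart k o j + 1 + blockLen k o n j < n + 1)
  · by_cases h2 : s = S - 1
    · have hu2 : ¬u = k - 1 := fun h' => hlast ⟨⟨h2, h'⟩, h.1.1⟩
      have : ¬(s < T + 1) := by omega
      simp only [h2, hu2, if_true, if_false, and_false] at hs' hu' hρ'
      subst hs' hu' hρ'
      rw [if_neg (by tauto), savTime, savTime, if_pos h, if_pos h,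
        progress_slot_succ (s := s) (by omega)]
    · simp only [h2, if_false, false_and] at hs' hu' hρ'
      subst hs' hu' hρ'
      rw [savTime, savTime, if_pos h, if_pos h, progress_succ]
      have h3 : T * blockLen k o n j = blockLen k o n j * T := mul_comm _ _
      rw [h3]
      simp only [h, true_and]
      split_ifs <;> rfl
  · rw [if_neg fun h' => h h'.1, savTime, savTime, if_neg h]
    -- If the advancing round begins with this step, its progress is still `0`; otherwise the copy
    -- rests.
    split_ifs with h4
    · have h5 : s = S - 1 ∧ u = k - 1 := by
        by_contra h5
        rw [if_neg h5] at hρ'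
        exact h (hρ' ▸ h4)
      rw [if_pos h5.1] at hs'
      rw [if_pos h5.1, if_pos h5.2] at hu'
      subst hs' hu'
      simp [progress_zero]
    · rfl

/-- The time of a saved copy after the last step for a token. -/
theorem savTime_next {T S : ℕ} (hS : T + 4 ≤ S) (hm : 0 < m) (hk : 0 < k) (ho : o < k)
    (hj : j + 1 < n) :
    savTime m n k o T (j + 1) 0 0 0 = savTime m n k o T j (m ^ k) (k - 1) (S - 1) := by
  have hm' : ¬(0 = m ^ k) := (pow_pos hm k).ne
  have h1 := blockStart_le (k := k) (o := o) j
  have h2 := lt_blockStart_add (o := o) hk (show j < n by omega)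
  unfold savTime
  rw [if_neg (fun h => hm' h.1.1)]
  by_cases h : j + 1 = blockStart k o j + blockLen k o n j
  · rw [if_pos ⟨⟨rfl, by omega⟩, by omega⟩, (block_succ_of_eq hk hj h).2.1, h, add_mul, add_zero]
    congr 1
    -- A block has at most `k` tokens, so all of its steps fit into one round.
    have h3 : blockLen k o n j * T ≤ k * T := Nat.mul_le_mul_right T (blockLen_le ho)
    have h4 : (k - 1) * T + T = k * T := by
      obtain ⟨l, rfl⟩ : ∃ l, k = l + 1 := ⟨k - 1, by omega⟩
      simp [add_mul]
    unfold progress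
    omega
  · rw [if_neg (fun h' => h (by omega)), (block_succ_of_ne hk hj h).2.1]

end eval

section step

variable {x : Fin n → Fin m} {j ρ u s : ℕ} {σ : Node Q D k → ℝ}

theorem slotLen_ge (Q : RNN Unit VQ) (D : RNN DistInput VD) :
    Q.time + 4 ≤ slotLen Q D ∧ D.time + 4 ≤ slotLen Q D := by
  unfold slotLen
  omega

/-- As `b < n`, the network also has to read the token at `b`; the first `b * Q.time` updates
therefore lie before the last one, about which nothing is known. -/
theorem Setup.stepDefined_savQ (H : Setup q d Q D o ε) {b t : ℕ} (hb : b < n)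
    (ht : t < b * Q.time) :
    Q.StepDefined (tokStream x (t / Q.time)) (Q.runFrom (tokStream x) Q.init t) := by
  refine (H.repQ x ⟨b, hb⟩).1.1 t ?_
  have := Q.time_pos
  simp only [add_mul]
  omega

theorem distStream_eq_idleStream {i : Fin n} {a : ℕ} (ha : a < i) :
    distStream i x a = idleStream x a := by
  funext c
  cases c with
  | token => rfl
  | index => exact if_pos ha

/-- Before its window the index input is `0`, so one idle run is the beginning of the runs for all
windows still to come. -/
theorem Setup.stepDefined_savD (H : Setup q d Q D o ε) {b t : ℕ} (hb : b < n)
    (ht : t < b * D.time) :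
    D.StepDefined (idleStream x (t / D.time)) (D.runFrom (idleStream x) D.init t) := by
  have h := (H.repD ⟨b, hb⟩ x).1.1 t
  have h1 := D.time_pos
  have h2 : (b + 1) * D.time ≤ min (b + k) n * D.time :=
    Nat.mul_le_mul_right _ (by have := H.k_pos; omega)
  rw [add_mul] at h2
  have h3 := h (by simp only; omega)
  have h4 : t / D.time < b := by rwa [Nat.div_lt_iff_lt_mul h1]
  rw [distStream_eq_idleStream h4, D.runFrom_congr_of_lt (l := b) D.init ht.le
    fun a ha => distStream_eq_idleStream (i := ⟨b, hb⟩) ha] at h3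
  exact h3

/-- The saved copy moves only in the last round for the last token of a block. All tokens of the
block are known then, so `cur` shows the true text and not a guess. -/
theorem Setup.savQ_step (H : Setup q d Q D o ε) (hj : j < n)
    (h : HiddenOK H.m_pos Q D o x j ρ u s σ) (v : Q.hidden) :
    (hTrans Q D m n k ε (.savQ v)).Defined σ ∧ (hTrans Q D m n k ε (.savQ v)).eval σ =
      Q.runFrom (tokStream x) Q.init
        (if ((ρ = m ^ k ∧ j - blockStart k o j + 1 = blockLen k o n j) ∧
          blockStart k o j + 1 + blockLen k o n j < n + 1) ∧
        (0 < s ∧ s < Q.time + 1) ∧ Q.time * u + s < Q.time * blockLen k o n j + 1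
        then savTime m n k o Q.time j ρ u s + 1 else savTime m n k o Q.time j ρ u s) v := by
  have hf := h.eval_savFlag Q.time
  set p := ((ρ = m ^ k ∧ j - blockStart k o j + 1 = blockLen k o n j) ∧
          blockStart k o j + 1 + blockLen k o n j < n + 1) ∧
        (0 < s ∧ s < Q.time + 1) ∧ Q.time * u + s < Q.time * blockLen k o n j + 1 with hp
  set t := savTime m n k o Q.time j ρ u s with ht
  have hF : p → t / Q.time = blockStart k o j + u ∧ u < blockLen k o n j ∧
      t < (blockStart k o j + blockLen k o n j) * Q.time :=
    fun hp => savTime_facts Q.time_pos hp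
  have hr : Q.runFrom (tokStream x) Q.init (if p then t + 1 else t) v = if p then
      Q.step (tokStream x (t / Q.time)) (Q.runFrom (tokStream x) Q.init t) v
      else Q.runFrom (tokStream x) Q.init t v := by
    split_ifs <;> rfl
  have hg : Gap ε (if p then
      Q.step (tokStream x (t / Q.time)) (Q.runFrom (tokStream x) Q.init t) v
      else Q.runFrom (tokStream x) Q.init t v) := by
    rw [← hr]
    refine H.gap_savQ x _ ?_ v
    split_ifs with hp'
    · have := (hF hp').2.2
      exact this.trans_le (Nat.mul_le_mul_right _ (blockStart_add_le hj))
    · exact savTime_le hj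
  have hi : p → ∀ c : Unit, σ (.inl (.ctl .cur)) = tokStream x (t / Q.time) c := by
    intro hp' c
    rw [(hF hp').1]
    refine (h.cur hp'.2.1.1 (hF hp').2.1).trans (tokenValue_guess_of_lt ?_)
    rw [if_pos hp'.1.1.1]
    have := (hF hp').2.1
    have := hp'.1.1.2
    have := blockStart_le (k := k) (o := o) j
    omega
  rw [hr]
  refine ⟨defined_saved H.ε_pos h.savQ hi hf (defined_savFlag _ _) v hg fun hp' => ?_,
    eval_saved H.ε_pos h.savQ hi hf v hg⟩
  exact H.stepDefined_savQ (by have := hp'.1.2; omega) (hF hp').2.2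

theorem Setup.savD_step (H : Setup q d Q D o ε) (hj : j < n)
    (h : HiddenOK H.m_pos Q D o x j ρ u s σ) (v : D.hidden) :
    (hTrans Q D m n k ε (.savD v)).Defined σ ∧ (hTrans Q D m n k ε (.savD v)).eval σ =
      D.runFrom (idleStream x) D.init
        (if ((ρ = m ^ k ∧ j - blockStart k o j + 1 = blockLen k o n j) ∧
          blockStart k o j + 1 + blockLen k o n j < n + 1) ∧
        (0 < s ∧ s < D.time + 1) ∧ D.time * u + s < D.time * blockLen k o n j + 1
        then savTime m n k o D.time j ρ u s + 1 else savTime m n k o D.time j ρ u s) v := by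
  have hf := h.eval_savFlag D.time
  set p := ((ρ = m ^ k ∧ j - blockStart k o j + 1 = blockLen k o n j) ∧
          blockStart k o j + 1 + blockLen k o n j < n + 1) ∧
        (0 < s ∧ s < D.time + 1) ∧ D.time * u + s < D.time * blockLen k o n j + 1 with hp
  set t := savTime m n k o D.time j ρ u s with ht
  have hF : p → t / D.time = blockStart k o j + u ∧ u < blockLen k o n j ∧
      t < (blockStart k o j + blockLen k o n j) * D.time :=
    fun hp => savTime_facts D.time_pos hp
  have hr : D.runFrom (idleStream x) D.init (if p then t + 1 else t) v = if p then
      D.step (idleStream x (t / D.time)) (D.runFrom (idleStream x) D.init t) v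
      else D.runFrom (idleStream x) D.init t v := by
    split_ifs <;> rfl
  have hg : Gap ε (if p then
      D.step (idleStream x (t / D.time)) (D.runFrom (idleStream x) D.init t) v
      else D.runFrom (idleStream x) D.init t v) := by
    rw [← hr]
    refine H.gap_savD x _ ?_ v
    split_ifs with hp'
    · have := (hF hp').2.2
      exact this.trans_le (Nat.mul_le_mul_right _ (blockStart_add_le hj))
    · exact savTime_le hj
  have hi : p → ∀ c, σ (distInp Q D k .zero c) = idleStream x (t / D.time) c := by
    intro hp' c
    cases c with
    | index => exact h.zero
    | token =>
      rw [(hF hp').1]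
      refine (h.cur hp'.2.1.1 (hF hp').2.1).trans (tokenValue_guess_of_lt ?_)
      rw [if_pos hp'.1.1.1]
      have := (hF hp').2.1
      have := hp'.1.1.2
      have := blockStart_le (k := k) (o := o) j
      omega
  rw [hr]
  refine ⟨defined_saved H.ε_pos h.savD hi hf (defined_savFlag _ _) v hg fun hp' => ?_,
    eval_saved H.ε_pos h.savD hi hf v hg⟩
  exact H.stepDefined_savD (by have := hp'.1.2; omega) (hF hp').2.2

theorem Setup.defined_hTrans (H : Setup q d Q D o ε) (hj : j < n)
    (h : HiddenOK H.m_pos Q D o x j ρ u s σ) (v : HNode Q D k) :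
    (hTrans Q D m n k ε v).Defined σ := by
  have hall : ∀ i, (allMax Q D m k i).Defined σ := by
    intro i
    simp only [allMax, digit, defined_all]
    intro l
    split_ifs <;> simp
  cases v with
  | savQ v => exact (H.savQ_step hj h v).1
  | savD v => exact (H.savD_step hj h v).1
  | digit i => simp [hTrans, roundEnd, slotEnd, hall, digit, ctl]
  | mem i => simp [hTrans, ctl, acc, mem]
  | ctl c =>
    cases c with
    | fin => simp [hTrans, ctlTrans, roundEnd, slotEnd, hall, ctl]
    | cur => exact defined_pick _ _ (by simp [ctl]) fun i => by simp [ctl, mem, digit]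
    | tick | slot | first | pos | start | len | flg | zero =>
      simp [hTrans, ctlTrans, tokenEnd, roundEnd, slotEnd, blockEnd, ctl]
  | pad i => simp [hTrans]

theorem eval_mem_step (h : HiddenOK hm Q D o x j ρ u s σ) (i : Fin k)
    (hi : blockStart k o j + i ≤ j) :
    (hTrans Q D m n k ε (.mem i)).eval σ = tokenValue x (blockStart k o j + i) := by
  have h1 : (hTrans Q D m n k ε (.mem i)).eval σ = _ :=
    eval_ite (e := acc Q D k .inp) (f := mem Q D k i) (eval_eq h.pos (eval_nat σ i))
  rw [h1]
  split_ifs with h2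
  · rw [h.inp, show blockStart k o j + i = j by omega]
    exact max_eq_right (tokenValue_nonneg _ _)
  · rw [h.mem i (Or.inl (by omega))]
    exact max_eq_right (tokenValue_nonneg _ _)

theorem eval_cur_step {hm : 0 < m} (h : HiddenOK hm Q D o x j ρ u s σ) (ho : o < k)
    (hj : j < n) (hu : u < blockLen k o n j) :
    (hTrans Q D m n k ε (.ctl .cur)).eval σ =
      tokenValue (guess hm k o x j ρ) (blockStart k o j + u) := by
  have hk := blockLen_le (n := n) (j := j) ho
  have h1 := eval_pick (e := fun i => ite (lt (nat i) (add (ctl Q D k .pos) (ctl Q D k .fin)))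
    (mem Q D k i) (digit Q D k i)) ⟨u, by omega⟩ h.slot
  have hfin : (ctl Q D k .fin).eval σ = ((if ρ = m ^ k then 1 else 0 : ℕ) : ℝ) := by
    rw [h.fin]
    split_ifs <;> simp
  have h2 := eval_ite (e := mem Q D k ⟨u, by omega⟩) (f := digit Q D k ⟨u, by omega⟩)
    (eval_lt (eval_nat σ u) (eval_add h.pos hfin))
  have hb := blockStart_le (k := k) (o := o) j
  have h3 : (hTrans Q D m n k ε (.ctl .cur)).eval σ = _ := h1
  rw [h3, h2, ← max_assoc, max_self]
  by_cases h4 : u < j - blockStart k o j + if ρ = m ^ k then 1 else 0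
  · rw [if_pos h4, h.mem, tokenValue_guess_of_lt]
    · exact max_eq_right (tokenValue_nonneg _ _)
    · omega
    · have hpow := pow_pos hm k
      simp only
      split_ifs at h4 with h5 <;> omega
  · have h5 := tokenValue_guess_of_le (hm := hm) (x := x) (ρ := ρ) (u := ⟨u, by omega⟩) hj
      (by simp only; omega) hu
    simp only at h5
    rw [if_neg h4, h.digit, h5]
    exact max_eq_right (by positivity)

/-- A step within the time for a token. -/
theorem Setup.hiddenOK_step (H : Setup q d Q D o ε) (hj : j < n) {ρ' u' s' : ℕ}
    {σ' : Node Q D k → ℝ} (h : HiddenOK H.m_pos Q D o x j ρ u s σ)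
    (hσ : ∀ v, σ' (.inl v) = (hTrans Q D m n k ε v).eval σ)
    (hinp : (acc Q D k .inp).eval σ' = tokenValue x j)
    (hu : u < k) (hs : s < slotLen Q D) (hρ : ρ ≤ m ^ k)
    (hlast : ¬((s = slotLen Q D - 1 ∧ u = k - 1) ∧ ρ = m ^ k))
    (hs' : s' = if s = slotLen Q D - 1 then 0 else s + 1)
    (hu' : u' = if s = slotLen Q D - 1 then if u = k - 1 then 0 else u + 1 else u)
    (hρ' : ρ' = if s = slotLen Q D - 1 ∧ u = k - 1 then ρ + 1 else ρ) :
    HiddenOK H.m_pos Q D o x j ρ' u' s' σ' where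
  inp := hinp
  tick := by
    rw [hs']
    exact (hσ _).trans (eval_ite_nat h.eval_slotEnd (eval_nat σ 0)
      (eval_add h.tick (eval_nat_one σ)))
  slot := by
    rw [hu']
    exact (hσ _).trans (eval_ite_nat h.eval_slotEnd (eval_bump _ h.slot) h.slot)
  fin := by
    refine ((hσ (.ctl .fin)).trans (eval_ite_ind h.eval_roundEnd
      (eval_and (eval_not h.fin) (h.eval_allMax le_rfl)) h.fin)).trans (if_congr ?_ rfl rfl)
    rw [hρ']
    split_ifs with h1
    · have hρ : ρ < m ^ k := lt_of_le_of_ne hρ fun h' => hlast ⟨h1, h'⟩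
      rw [digits_max_iff H.m_pos k hρ]
      simp [hρ.ne]
    · rfl
  first := by
    refine ((hσ (.ctl .first)).trans h.eval_tokenEnd).trans (if_congr ?_ rfl rfl)
    refine iff_of_false hlast fun h1 => ?_
    obtain ⟨h1, h2, h3⟩ := h1
    have h4 : s = slotLen Q D - 1 := by
      by_contra h4
      rw [if_neg h4] at hs'
      omega
    rw [if_pos h4] at hu'
    have h5 : u = k - 1 := by
      by_contra h5
      rw [if_neg h5] at hu'
      omega
    rw [if_pos ⟨h4, h5⟩] at hρ'
    omega
  pos := (hσ _).trans ((eval_ite_nat h.eval_tokenEnd (eval_ite_nat h.eval_blockEnd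
    (eval_nat σ 0) (eval_add h.pos (eval_nat_one σ))) h.pos).trans (by rw [if_neg hlast]))
  start := (hσ _).trans ((eval_ite_nat (eval_and h.eval_tokenEnd h.eval_blockEnd)
    (eval_add h.start h.len) h.start).trans (by rw [if_neg (fun h' => hlast h'.1)]))
  len := (hσ _).trans ((eval_ite_nat (eval_and h.eval_tokenEnd h.eval_blockEnd)
    (eval_sub (eval_nat σ k) (eval_sub (eval_add (eval_add (eval_nat σ k) h.start) h.len)
      (eval_nat σ (n + 1)))) h.len).trans (by rw [if_neg (fun h' => hlast h'.1)]))
  flg := (hσ _).trans ((eval_ite_ind (q := True) (eval_and h.eval_tokenEnd h.eval_blockEnd)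
    (by simp) h.flg).trans (if_congr (by rw [if_neg (fun h' => hlast h'.1)]) rfl rfl))
  zero := (hσ _).trans (by simp [hTrans, ctlTrans])
  digit i := by
    refine (hσ _).trans ((eval_ite_nat (eval_and (eval_and h.eval_roundEnd (eval_not h.fin))
      (h.eval_allMax i.2.le)) (eval_bump (m - 1) (h.digit i)) (h.digit i)).trans ?_)
    congr 1
    rw [hρ']
    by_cases h1 : s = slotLen Q D - 1 ∧ u = k - 1
    · rw [if_pos h1, digit_succ H.m_pos]
      exact if_congr (and_iff_right ⟨h1, fun h' => hlast ⟨h1, h'⟩⟩) rfl rfl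
    · rw [if_neg h1, if_neg fun h' => h1 h'.1.1]
  mem i hi := (hσ _).trans (eval_mem_step h i (by omega))
  cur h1 h2 := by
    have h3 : ¬s = slotLen Q D - 1 := fun h' => by
      rw [if_pos h'] at hs'
      omega
    rw [if_neg h3] at hu'
    rw [if_neg fun h' => h3 h'.1] at hρ'
    subst hu' hρ'
    exact (hσ _).trans (eval_cur_step h H.o_lt hj h2)
  savQ v := by
    rw [hσ, (H.savQ_step hj h v).2,
      savTime_succ (slotLen_ge Q D).1 hu hs hρ hlast hs' hu' hρ']
  savD v := by
    rw [hσ, (H.savD_step hj h v).2,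
      savTime_succ (slotLen_ge Q D).2 hu hs hρ hlast hs' hu' hρ']

/-- The last step for a token. -/
theorem Setup.hiddenOK_next (H : Setup q d Q D o ε) (hj : j + 1 < n) {σ' : Node Q D k → ℝ}
    (h : HiddenOK H.m_pos Q D o x j (m ^ k) (k - 1) (slotLen Q D - 1) σ)
    (hσ : ∀ v, σ' (.inl v) = (hTrans Q D m n k ε v).eval σ)
    (hinp : (acc Q D k .inp).eval σ' = tokenValue x (j + 1)) :
    HiddenOK H.m_pos Q D o x (j + 1) 0 0 0 σ' := by
  have hb := blockStart_le (k := k) (o := o) j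
  have hlt := lt_blockStart_add (o := o) H.k_pos (show j < n by omega)
  have hpow := pow_pos H.m_pos k
  have hS := slotLen_ge Q D
  -- At the last tick of a slot the saved copies are idle.
  have hflag : ∀ T, T + 4 ≤ slotLen Q D →
      ¬(((m ^ k = m ^ k ∧ j - blockStart k o j + 1 = blockLen k o n j) ∧
          blockStart k o j + 1 + blockLen k o n j < n + 1) ∧
        (0 < slotLen Q D - 1 ∧ slotLen Q D - 1 < T + 1) ∧
          T * (k - 1) + (slotLen Q D - 1) < T * blockLen k o n j + 1) := by
    intro T hT h'
    have := h'.2.1.2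
    omega
  constructor
  case inp => exact hinp
  case tick =>
    exact (hσ _).trans ((eval_ite_nat h.eval_slotEnd (eval_nat σ 0)
      (eval_add h.tick (eval_nat_one σ))).trans (by simp))
  case slot =>
    exact (hσ _).trans ((eval_ite_nat h.eval_slotEnd (eval_bump _ h.slot) h.slot).trans (by simp))
  case fin =>
    refine ((hσ (.ctl .fin)).trans (eval_ite_ind h.eval_roundEnd
      (eval_and (eval_not h.fin) (h.eval_allMax le_rfl)) h.fin)).trans (if_congr ?_ rfl rfl)
    simp [hpow.ne]
  case first =>
    exact ((hσ (.ctl .first)).trans h.eval_tokenEnd).trans (if_congr (by simp) rfl rfl)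
  case pos =>
    refine (hσ _).trans ((eval_ite_nat h.eval_tokenEnd (eval_ite_nat h.eval_blockEnd
      (eval_nat σ 0) (eval_add h.pos (eval_nat_one σ))) h.pos).trans ?_)
    congr 1
    rw [if_pos (by simp)]
    split_ifs with h1
    · rw [(block_succ_of_eq H.k_pos hj (by omega)).2.1]
      omega
    · rw [(block_succ_of_ne H.k_pos hj (by omega)).2.1]
      omega
  case start =>
    refine (hσ _).trans ((eval_ite_nat (eval_and h.eval_tokenEnd h.eval_blockEnd)
      (eval_add h.start h.len) h.start).trans ?_)
    congr 1
    split_ifs with h1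
    · rw [(block_succ_of_eq H.k_pos hj (by omega)).2.1]
      omega
    · rw [(block_succ_of_ne H.k_pos hj (fun h' => h1 ⟨by simp, by omega⟩)).2.1]
  case len =>
    refine (hσ _).trans ((eval_ite_nat (eval_and h.eval_tokenEnd h.eval_blockEnd)
      (eval_sub (eval_nat σ k) (eval_sub (eval_add (eval_add (eval_nat σ k) h.start) h.len)
      (eval_nat σ (n + 1)))) h.len).trans ?_)
    congr 1
    split_ifs with h1
    · rw [(block_succ_of_eq H.k_pos hj (by omega)).2.2]
      omega
    · rw [(block_succ_of_ne H.k_pos hj (fun h' => h1 ⟨by simp, by omega⟩)).2.2]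
  case flg =>
    refine (hσ _).trans ((eval_ite_ind (q := True) (eval_and h.eval_tokenEnd h.eval_blockEnd)
      (by simp) h.flg).trans (if_congr ?_ rfl rfl))
    split_ifs with h1
    · have := (block_succ_of_eq (o := o) H.k_pos hj (by omega)).1
      simp [this]
    · have := (block_succ_of_ne (o := o) H.k_pos hj (fun h' => h1 ⟨by simp, by omega⟩)).1
      omega
  case zero => exact (hσ _).trans (by simp [hTrans, ctlTrans])
  case digit =>
    intro i
    refine (hσ _).trans ((eval_ite_nat (eval_and (eval_and h.eval_roundEnd (eval_not h.fin))
      (h.eval_allMax i.2.le)) (eval_bump (m - 1) (h.digit i)) (h.digit i)).trans ?_)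
    rw [if_neg (by simp), digit_pow H.m_pos i.2]
    simp
  case mem =>
    intro i hi
    have hi : blockStart k o (j + 1) + i < j + 1 := hi.resolve_right (by simp)
    by_cases h1 : j + 1 = blockStart k o j + blockLen k o n j
    · rw [(block_succ_of_eq H.k_pos hj h1).2.1] at hi
      omega
    · rw [(block_succ_of_ne H.k_pos hj h1).2.1] at hi ⊢
      exact (hσ _).trans (eval_mem_step h i (by omega))
  case cur => exact fun h1 => absurd h1 (lt_irrefl 0)
  case savQ =>
    intro v
    rw [hσ, (H.savQ_step (by omega) h v).2, if_neg (hflag _ hS.1),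
      savTime_next hS.1 H.m_pos H.k_pos H.o_lt hj]
  case savD =>
    intro v
    rw [hσ, (H.savD_step (by omega) h v).2, if_neg (hflag _ hS.2),
      savTime_next hS.2 H.m_pos H.k_pos H.o_lt hj]

end step

end Boost

/-! ### Correctness of the running copies, the accumulators and the output. -/

namespace Boost

open TransExpr

/-- A step of the running copy of a network. -/
theorem running_step {ι V W : Type} {R : RNN ι V} {σ : W → ℝ} {ε : ℝ} (hε : 0 < ε)
    {flag rst : TransExpr W} {inp : ι → W} {nd : V → W} {ξ : ℕ → ι → ℝ} {s₀ : V → ℝ}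
    {c u s : ℕ}
    (hn : ¬(s = 0 ∧ u = 0) → ∀ v, R.input v = none →
      σ (nd v) = R.runFrom ξ s₀ (progress R.time c u s) v)
    (hi : (0 < s ∧ s < R.time + 1) ∧ R.time * u + s < c + 1 → ∀ a, σ (inp a) = ξ u a)
    (hf : flag.eval σ = if (0 < s ∧ s < R.time + 1) ∧ R.time * u + s < c + 1 then 1 else 0)
    (hr : rst.eval σ = if s = 0 ∧ u = 0 then 1 else 0)
    (hf' : flag.Defined σ) (hr' : rst.Defined σ)
    {v : V} {a : W} (hv : R.input v = none) (ha : s = 0 ∧ u = 0 → σ a = s₀ v)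
    (hg : ∀ t ≤ c, Gap ε (R.runFrom ξ s₀ t v))
    (hd : ∀ t < c, R.StepDefined (ξ (t / R.time)) (R.runFrom ξ s₀ t)) :
    (mux ε flag (guard flag (route R inp nd) (R.trans v))
        (mux ε rst (node a) (node (nd v)))).Defined σ ∧
      (mux ε flag (guard flag (route R inp nd) (R.trans v))
        (mux ε rst (node a) (node (nd v)))).eval σ =
        R.runFrom ξ s₀ (if (0 < s ∧ s < R.time + 1) ∧ R.time * u + s < c + 1
          then progress R.time c u s + 1 else progress R.time c u s) v := by
  set p := (0 < s ∧ s < R.time + 1) ∧ R.time * u + s < c + 1 with hp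
  set t := progress R.time c u s with ht
  have hT := R.time_pos
  have h1 : p → t / R.time = u ∧ t < c := by
    intro h
    rw [ht, progress_eq h, mul_comm u]
    refine ⟨?_, by omega⟩
    rw [add_comm, Nat.add_mul_div_left _ _ hT, Nat.div_eq_of_lt (by omega), zero_add]
  have htc : t ≤ c := min_le_right _ _
  have h2 : (if s = 0 ∧ u = 0 then σ a else σ (nd v)) = R.runFrom ξ s₀ t v := by
    split_ifs with h
    · rw [ha h, ht, h.1, h.2, progress_zero]
      rfl
    · exact hn h v hv
  have hn' : p → ∀ v, R.input v = none → σ (nd v) = R.runFrom ξ s₀ t v :=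
    fun h => hn fun h' => by have := h.1; omega
  have hstep : p → R.step (ξ u) (R.runFrom ξ s₀ t) = R.runFrom ξ s₀ (t + 1) := by
    intro h
    rw [RNN.runFrom, (h1 h).1]
  have hg1 : p → Gap ε (R.step (ξ u) (R.runFrom ξ s₀ t) v) := by
    intro h
    rw [hstep h]
    exact hg _ (h1 h).2
  have hg2 : Gap ε (if s = 0 ∧ u = 0 then σ a else σ (nd v)) := by
    rw [h2]
    exact hg t htc
  refine ⟨defined_running hε hn' hi hf hr hf' hr' hv hg1 hg2 fun h => ?_, ?_⟩
  · have := hd t (h1 h).2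
    rwa [(h1 h).1] at this
  · rw [eval_running hε hn' hi hf hr hg1 hg2, h2]
    split_ifs with h
    · rw [hstep h]
    · rfl

variable {m n k o : ℕ} {VQ VD : Type} {q : LangModel m n} {d : Distinguisher m n k}
  {Q : RNN Unit VQ} {D : RNN DistInput VD} {ε γ : ℝ}

/-- The product of the probabilities that are read in the first `τ` steps of round `ρ`, and of the
weight of the text. -/
noncomputable def prdVal (hm : 0 < m) (q : LangModel m n) (d : Distinguisher m n k) (γ : ℝ)
    (o : ℕ) (x : Fin n → Fin m) (S TQ TD j ρ τ : ℕ) : ℝ :=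
  (∏ l ∈ Finset.univ.filter fun l : Fin n =>
      (j ≤ l ∧ (l : ℕ) < blockStart k o j + blockLen k o n j) ∧
        (l - blockStart k o j) * S + TQ < τ, q.next (guess hm k o x j ρ) l) *
    if (blockLen k o n j - 1) * S + TD < τ then d.blockWeight γ o j (guess hm k o x j ρ) else 1

/-- The contribution of round `ρ` to the denominator. -/
noncomputable def term (hm : 0 < m) (q : LangModel m n) (d : Distinguisher m n k) (γ : ℝ)
    (o : ℕ) (x : Fin n → Fin m) (j ρ : ℕ) : ℝ :=
  q.windowTerm (blockStart k o j) (blockStart k o j + blockLen k o n j) (d.blockWeight γ o j) j x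
    (window hm k ρ)

/-- The contribution of round `ρ` to the numerator. -/
noncomputable def hitTerm (hm : 0 < m) (q : LangModel m n) (d : Distinguisher m n k) (γ : ℝ)
    (o : ℕ) (x : Fin n → Fin m) (j : Fin n) (ρ : ℕ) : ℝ :=
  if ρ / m ^ ((j : ℕ) - blockStart k o j) % m = (x j : ℕ) then term hm q d γ o x j ρ else 0

/-- The shifted stream that the running copy of `Q` reads in round `ρ`. -/
def runStreamQ (hm : 0 < m) (k o : ℕ) (x : Fin n → Fin m) (j ρ : ℕ) (a : ℕ) : Unit → ℝ :=
  tokStream (guess hm k o x j ρ) (blockStart k o j + a)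

/-- The block start as a position in the text. -/
def startFin (k o : ℕ) (j : Fin n) : Fin n :=
  ⟨blockStart k o j, (blockStart_le (j : ℕ)).trans_lt j.2⟩

/-- The shifted stream that the running copy of `D` reads in round `ρ`. -/
def runStreamD (hm : 0 < m) (k o : ℕ) (x : Fin n → Fin m) (j : Fin n) (ρ : ℕ) (a : ℕ) :
    DistInput → ℝ :=
  distStream (startFin k o j) (guess hm k o x j ρ) (blockStart k o j + a)

/-- The state of the running copy of `Q` at the start of a round. -/
noncomputable def runInitQ (hm : 0 < m) (k o : ℕ) (Q : RNN Unit VQ) (x : Fin n → Fin m)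
    (j ρ : ℕ) : VQ → ℝ :=
  Q.restrict (Q.runFrom (tokStream (guess hm k o x j ρ)) Q.init (blockStart k o j * Q.time))

/-- The state of the running copy of `D` at the start of a round. -/
noncomputable def runInitD (hm : 0 < m) (k o : ℕ) (D : RNN DistInput VD) (x : Fin n → Fin m)
    (j ρ : ℕ) : VD → ℝ :=
  D.restrict (D.runFrom (idleStream (guess hm k o x j ρ)) D.init (blockStart k o j * D.time))

/-- The node values in step `s` of slot `u` of round `ρ` for the token at `j` are correct at the
nodes that are not hidden. -/
structure VisibleOK (hm : 0 < m) (q : LangModel m n) (d : Distinguisher m n k) (Q : RNN Unit VQ)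
    (D : RNN DistInput VD) (γ : ℝ) (o : ℕ) (x : Fin n → Fin m) (j : Fin n) (ρ u s : ℕ)
    (σ : Node Q D k → ℝ) : Prop where
  -- At the first step of a round the copies have not been loaded yet, so nothing is claimed about
  -- them.
  runQ : ¬(s = 0 ∧ u = 0) → ∀ v, Q.input v = none → σ (.inr (.runQ v)) =
    Q.runFrom (runStreamQ hm k o x j ρ) (runInitQ hm k o Q x j ρ)
      (progress Q.time (Q.time * blockLen k o n j - 1) u s) v
  runD : ¬(s = 0 ∧ u = 0) → ∀ v, D.input v = none → σ (.inr (.runD v)) =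
    D.runFrom (runStreamD hm k o x j ρ) (runInitD hm k o D x j ρ)
      (progress D.time (D.time * blockLen k o n j - 1) u s) v
  prd : ¬(s = 0 ∧ u = 0) → (acc Q D k .prd).eval σ =
    prdVal hm q d γ o x (slotLen Q D) Q.time D.time j ρ (u * slotLen Q D + s)
  den : ¬(ρ = 0 ∧ u = 0 ∧ s = 0) → (acc Q D k .den).eval σ =
    ∑ a ∈ Finset.range ρ, term hm q d γ o x j a
  num : ¬(ρ = 0 ∧ u = 0 ∧ s = 0) → (acc Q D k .num).eval σ =
    ∑ a ∈ Finset.range ρ, hitTerm hm q d γ o x j a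
  out : ρ = m ^ k → 0 < s → (acc Q D k .out).eval σ =
    (∑ a ∈ Finset.range (m ^ k), hitTerm hm q d γ o x j a) /
      ∑ a ∈ Finset.range (m ^ k), term hm q d γ o x j a

section

variable {x : Fin n → Fin m} {j : Fin n} {ρ u s : ℕ} {σ : Node Q D k → ℝ}

/-- When the end of the text shortens a block, the window has no tokens after it either; before the
offset the weight is constant. -/
theorem blockWeight_congr {j : ℕ} {x y : Fin n → Fin m}
    (h : ∀ l : Fin n, (l : ℕ) < blockStart k o j + blockLen k o n j → x l = y l) :
    d.blockWeight γ o j x = d.blockWeight γ o j y := by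
  unfold Distinguisher.blockWeight
  split_ifs with hj
  · rfl
  · refine d.weight_congr γ fun l hl => h l ?_
    rw [blockLen_of_le (by omega)]
    omega

theorem splice_window_of_ne (hm : 0 < m) {j : ℕ} (hρ : ρ ≠ m ^ k) :
    guess hm k o x j ρ = LangModel.splice (blockStart k o j)
      (blockStart k o j + blockLen k o n j) j x (window hm k ρ) := by
  rw [guess, if_neg hρ, add_zero]

/-- The expansions to base `m` of the round numbers run through every window once. -/
theorem sum_window (hm : 0 < m) (f : (Fin k → Fin m) → ℝ) :
    ∑ a ∈ Finset.range (m ^ k), f (window hm k a) = ∑ w, f w := by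
  rw [Finset.sum_range, ← Equiv.sum_comp (finFunctionFinEquiv (m := m) (n := k)).symm]
  refine Finset.sum_congr rfl fun a _ => ?_
  congr 1

theorem Setup.sum_term_pos (H : Setup q d Q D o ε) (hγ : 0 < γ) (x : Fin n → Fin m)
    (j : Fin n) : 0 < ∑ a ∈ Finset.range (m ^ k), term H.m_pos q d γ o x j a := by
  have : Nonempty (Fin m) := ⟨⟨0, H.m_pos⟩⟩
  unfold term
  rw [sum_window H.m_pos fun w => q.windowTerm (blockStart k o j)
    (blockStart k o j + blockLen k o n j) (d.blockWeight γ o j) j x w]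
  exact q.sum_windowTerm_pos _ (blockStart_add_le j.2)
    (Nat.add_le_add_left (blockLen_le H.o_lt) _) (fun _ _ => blockWeight_congr)
    (d.blockWeight_pos hγ o j) (blockStart_le _) (lt_blockStart_add H.k_pos j.2).le x

theorem Setup.sum_hitTerm_div (H : Setup q d Q D o ε) (hγ : 0 < γ) (x : Fin n → Fin m)
    (j : Fin n) : (∑ a ∈ Finset.range (m ^ k), hitTerm H.m_pos q d γ o x j a) /
      ∑ a ∈ Finset.range (m ^ k), term H.m_pos q d γ o x j a =
      (q.reweight (d.blockWeight γ o) (d.blockWeight_pos hγ o)).next x j := by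
  have : Nonempty (Fin m) := ⟨⟨0, H.m_pos⟩⟩
  have hlt := lt_blockStart_add (o := o) H.k_pos j.2
  have hle := blockLen_le (n := n) (j := j) H.o_lt
  have hb := blockStart_le (k := k) (o := o) (j : ℕ)
  rw [LangModel.next_reweight, ← q.sum_windowTerm_div (k := k) (d.blockWeight γ o j)
    (blockStart_add_le j.2) (Nat.add_le_add_left hle _) (fun _ _ => blockWeight_congr)
    (d.blockWeight_pos hγ o j) hb hlt (by omega) x, ← sum_window H.m_pos, ← sum_window H.m_pos]
  congr 1
  refine Finset.sum_congr rfl fun a _ => ?_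
  unfold hitTerm
  refine if_congr ?_ rfl rfl
  rw [Fin.ext_iff]
  rfl

theorem prdVal_nonneg (hm : 0 < m) (hγ : 0 < γ) {S TQ TD τ j : ℕ} :
    0 ≤ prdVal hm q d γ o x S TQ TD j ρ τ := by
  refine mul_nonneg (Finset.prod_nonneg fun l _ => q.next_nonneg _ _) ?_
  split_ifs
  · exact (d.blockWeight_pos hγ o j _).le
  · exact zero_le_one

theorem prdVal_one (hm : 0 < m) {S TQ TD j : ℕ} (hQ : 0 < TQ) (hD : 0 < TD) :
    prdVal hm q d γ o x S TQ TD j ρ 1 = 1 := by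
  unfold prdVal
  rw [if_neg (by omega), mul_one]
  refine Finset.prod_eq_one fun l hl => ?_
  have := (Finset.mem_filter.1 hl).2.2
  omega

/-- All reading takes place in slots below `k` and before the last tick, so the product is complete
when it is added. -/
theorem prdVal_end (hm : 0 < m) (ho : o < k) {S TQ TD : ℕ} (hQ : TQ + 4 ≤ S) (hD : TD + 4 ≤ S)
    {j : ℕ} (hρ : ρ ≠ m ^ k) :
    prdVal hm q d γ o x S TQ TD j ρ ((k - 1) * S + (S - 1)) = term hm q d γ o x j ρ := by
  have hle := blockLen_le (n := n) (j := j) ho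
  have hmul : ∀ a, a < k → a * S ≤ (k - 1) * S := fun a ha => Nat.mul_le_mul_right S (by omega)
  unfold prdVal term LangModel.windowTerm
  rw [← splice_window_of_ne hm hρ, if_pos]
  · congr 1
    refine Finset.prod_congr ?_ fun _ _ => rfl
    ext l
    simp only [Finset.mem_filter, Finset.mem_univ, true_and]
    refine and_iff_left_of_imp fun h => ?_
    have := hmul (l - blockStart k o j) (by omega)
    omega
  · have := hmul (blockLen k o n j - 1) (by omega)
    omega

theorem slot_tick_eq {S a b s t : ℕ} (hs : s < S) (ht : t < S) :
    a * S + s = b * S + t ↔ a = b ∧ s = t := by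
  constructor
  · intro h
    have h1 : (s + a * S) / S = (t + b * S) / S := by rw [add_comm s, add_comm t, h]
    rw [Nat.add_mul_div_right _ _ (by omega), Nat.add_mul_div_right _ _ (by omega),
      Nat.div_eq_of_lt hs, Nat.div_eq_of_lt ht] at h1
    have h2 : a = b := by omega
    subst h2
    exact ⟨rfl, by omega⟩
  · rintro ⟨rfl, rfl⟩
    rfl

/-- A slot and a tick determine the position that is read, so a step adds at most one factor of `q`
and at most one weight. -/
theorem prdVal_succ (hm : 0 < m) {S TQ TD j : ℕ} (hj : j < n) (hQ : TQ < S) (hD : TD < S)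
    (hlen : 0 < blockLen k o n j) (hs : s < S) {A B : ℝ}
    (hA : ∀ h : blockStart k o j + u < n, (s = TQ ∧ u < blockLen k o n j) ∧
      ¬u < j - blockStart k o j → A = q.next (guess hm k o x j ρ) ⟨blockStart k o j + u, h⟩)
    (hA' : ¬((s = TQ ∧ u < blockLen k o n j) ∧ ¬u < j - blockStart k o j) → A = 1)
    (hB : s = TD ∧ u + 1 = blockLen k o n j → B = d.blockWeight γ o j (guess hm k o x j ρ))
    (hB' : ¬(s = TD ∧ u + 1 = blockLen k o n j) → B = 1) :
    prdVal hm q d γ o x S TQ TD j ρ (u * S + s + 1) =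
      prdVal hm q d γ o x S TQ TD j ρ (u * S + s) * (A * B) := by
  have hb := blockStart_le (k := k) (o := o) j
  have hbn := blockStart_add_le (k := k) (o := o) hj
  unfold prdVal
  rw [mul_mul_mul_comm]
  congr 1
  · by_cases h : (s = TQ ∧ u < blockLen k o n j) ∧ ¬u < j - blockStart k o j
    · rw [hA (by omega) h]
      have hset : (Finset.univ.filter fun l : Fin n =>
          (j ≤ l ∧ (l : ℕ) < blockStart k o j + blockLen k o n j) ∧
            (l - blockStart k o j) * S + TQ < u * S + s + 1) =
          insert (⟨blockStart k o j + u, by omega⟩ : Fin n) (Finset.univ.filter fun l : Fin n =>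
          (j ≤ l ∧ (l : ℕ) < blockStart k o j + blockLen k o n j) ∧
            (l - blockStart k o j) * S + TQ < u * S + s) := by
        ext l
        simp only [Finset.mem_filter, Finset.mem_univ, true_and, Finset.mem_insert, Fin.ext_iff]
        rw [Nat.lt_succ_iff_lt_or_eq, slot_tick_eq hQ hs]
        constructor
        · rintro ⟨h1, h2 | h2⟩
          · exact Or.inr ⟨h1, h2⟩
          · exact Or.inl (by omega)
        · rintro (h1 | h1)
          · exact ⟨by omega, Or.inr (by omega)⟩
          · exact ⟨h1.1, Or.inl h1.2⟩
      rw [hset, Finset.prod_insert, mul_comm]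
      simp [h.1.1]
    · rw [hA' h, mul_one]
      refine Finset.prod_congr ?_ fun _ _ => rfl
      ext l
      simp only [Finset.mem_filter, Finset.mem_univ, true_and]
      rw [Nat.lt_succ_iff_lt_or_eq, slot_tick_eq hQ hs]
      refine and_congr_right fun h1 => or_iff_left fun h2 => h ?_
      omega
  · have hiff : (blockLen k o n j - 1) * S + TD < u * S + s + 1 ↔
        (blockLen k o n j - 1) * S + TD < u * S + s ∨ (blockLen k o n j - 1 = u ∧ TD = s) := by
      rw [Nat.lt_succ_iff_lt_or_eq, slot_tick_eq hD hs]
    by_cases h : s = TD ∧ u + 1 = blockLen k o n j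
    · have h1 : ¬(blockLen k o n j - 1) * S + TD < u * S + s := by
        rw [show blockLen k o n j - 1 = u by omega, h.1]
        omega
      rw [hB h, if_pos (hiff.2 (Or.inr (by omega))), if_neg h1, one_mul]
    · rw [hB' h, mul_one]
      exact if_congr (hiff.trans (or_iff_left fun h2 => h (by omega))) rfl rfl

theorem runFlag_iff {T l : ℕ} (hT : 0 < T) (hl : 0 < l) {P : Prop} :
    P ∧ T * u + s < T * l - 1 + 1 ↔ P ∧ T * u + s < T * l := by
  rw [Nat.sub_add_cancel (Nat.mul_pos hT hl)]

/-- Sufficiency of the hidden nodes of `Q` enters here: the running copy starts with zeros at all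
other nodes. -/
theorem Setup.yieldsQ (H : Setup q d Q D o ε) (hu : u < blockLen k o n j) :
    Q.Yields (runStreamQ H.m_pos k o x j ρ) (runInitQ H.m_pos k o Q x j ρ) (u + 1)
      (q.next (guess H.m_pos k o x j ρ)
        ⟨blockStart k o j + u, by have := blockStart_add_le (k := k) (o := o) j.2; omega⟩) := by
  have hn := blockStart_add_le (k := k) (o := o) j.2
  have h := (H.repQ (guess H.m_pos k o x j ρ) ⟨blockStart k o j + u, by omega⟩).2
    (blockStart k o j) (by simp only; omega) (runInitQ H.m_pos k o Q x j ρ)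
    (fun v hv => by
      unfold runInitQ RNN.restrict
      rw [if_pos hv]
      rfl)
  simp only [show blockStart k o j + u + 1 - blockStart k o j = u + 1 by omega] at h
  exact h

/-- The same for `D`, with the full window as its input. In the block before the offset only the
definedness of the steps is used. -/
theorem Setup.yieldsD (H : Setup q d Q D o ε) :
    D.Yields (runStreamD H.m_pos k o x j ρ) (runInitD H.m_pos k o D x j ρ)
      (min (blockStart k o j + k) n - blockStart k o j)
      (d.val (startFin k o j) (guess H.m_pos k o x j ρ)) := by
  have hn := (blockStart_le (k := k) (o := o) (j : ℕ)).trans_lt j.2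
  have hk := H.k_pos
  refine (H.repD (startFin k o j) (guess H.m_pos k o x j ρ)).2
    (blockStart k o j) (by simp only [startFin]; omega) (runInitD H.m_pos k o D x j ρ)
    fun v hv => ?_
  unfold runInitD RNN.restrict
  rw [if_pos hv, D.runFrom_congr_of_lt (l := blockStart k o j) D.init le_rfl]
  exact fun a ha => (distStream_eq_idleStream (i := startFin k o j) ha).symm

theorem Setup.runQ_step (H : Setup q d Q D o ε) (h : HiddenOK H.m_pos Q D o x j ρ u s σ)
    (h' : VisibleOK H.m_pos q d Q D γ o x j ρ u s σ) {v : VQ} (hv : Q.input v = none) :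
    (vTrans Q D k ε γ (.runQ v)).Defined σ ∧ (vTrans Q D k ε γ (.runQ v)).eval σ =
      Q.runFrom (runStreamQ H.m_pos k o x j ρ) (runInitQ H.m_pos k o Q x j ρ)
        (if (0 < s ∧ s < Q.time + 1) ∧ Q.time * u + s < Q.time * blockLen k o n j - 1 + 1
          then progress Q.time (Q.time * blockLen k o n j - 1) u s + 1
          else progress Q.time (Q.time * blockLen k o n j - 1) u s) v := by
  have hlt := lt_blockStart_add (o := o) H.k_pos j.2
  have hb := blockStart_le (k := k) (o := o) (j : ℕ)
  have hn := blockStart_add_le (k := k) (o := o) j.2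
  have hlen : 0 < blockLen k o n j := by omega
  have hT := Q.time_pos
  simp only [vTrans, if_pos hv]
  refine running_step H.ε_pos h'.runQ (fun hp a => ?_) ?_ h.eval_reset ?_ ?_ hv (fun hr => ?_)
    (fun t ht => ?_) (fun t ht => ?_)
  · rw [runFlag_iff hT hlen] at hp
    exact h.cur hp.1.1 (lt_of_mul_lt_mul_left (by omega : Q.time * u < _) hT.le)
  · rw [h.eval_runFlag]
    exact if_congr (runFlag_iff hT hlen).symm rfl rfl
  · simp [runFlag, stepFlag, ctl]
  · simp [reset, ctl]
  -- When the running copy is loaded, the saved one is still at the start of the block, even in the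
  -- last round.
  · have h1 : savTime m n k o Q.time j ρ u s = blockStart k o j * Q.time := by
      unfold savTime
      rw [hr.1, hr.2, progress_zero, ite_self, add_zero]
    have h2 : ∀ v, σ (.inl (.savQ v)) = Q.runFrom (tokStream (guess H.m_pos k o x j ρ)) Q.init
        (blockStart k o j * Q.time) v := by
      intro v
      rw [h.savQ, h1, Q.runFrom_congr_of_lt (l := blockStart k o j) Q.init le_rfl]
      intro a ha
      funext c
      exact (tokenValue_guess_of_lt (by omega)).symm
    exact apply_savNode h2 h.zero v
  · refine H.gap_runQ (guess H.m_pos k o x j ρ) (startFin k o j) t ?_ v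
    refine (ht.trans (Nat.sub_le _ _)).trans ?_
    rw [mul_comm n]
    exact Nat.mul_le_mul_left _ (by omega)
  · have hy := H.yieldsQ (x := x) (ρ := ρ) (j := j) (u := blockLen k o n j - 1) (by omega)
    refine hy.1 t ?_
    rw [Nat.sub_add_cancel hlen, mul_comm]
    omega

theorem Setup.runD_step (H : Setup q d Q D o ε) (h : HiddenOK H.m_pos Q D o x j ρ u s σ)
    (h' : VisibleOK H.m_pos q d Q D γ o x j ρ u s σ) {v : VD} (hv : D.input v = none) :
    (vTrans Q D k ε γ (.runD v)).Defined σ ∧ (vTrans Q D k ε γ (.runD v)).eval σ =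
      D.runFrom (runStreamD H.m_pos k o x j ρ) (runInitD H.m_pos k o D x j ρ)
        (if (0 < s ∧ s < D.time + 1) ∧ D.time * u + s < D.time * blockLen k o n j - 1 + 1
          then progress D.time (D.time * blockLen k o n j - 1) u s + 1
          else progress D.time (D.time * blockLen k o n j - 1) u s) v := by
  have hlt := lt_blockStart_add (o := o) H.k_pos j.2
  have hb := blockStart_le (k := k) (o := o) (j : ℕ)
  have hn := blockStart_add_le (k := k) (o := o) j.2
  have hle := blockLen_le (n := n) (j := j) H.o_lt
  have hlen : 0 < blockLen k o n j := by omega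
  have hT := D.time_pos
  simp only [vTrans, if_pos hv]
  refine running_step H.ε_pos h'.runD (fun hp a => ?_) ?_ h.eval_reset ?_ ?_ hv (fun hr => ?_)
    (fun t ht => ?_) (fun t ht => ?_)
  · rw [runFlag_iff hT hlen] at hp
    cases a with
    | token =>
      exact h.cur hp.1.1 (lt_of_mul_lt_mul_left (by omega : D.time * u < _) hT.le)
    | index =>
      refine h.start.trans ?_
      simp [runStreamD, distStream, startFin]
  · rw [h.eval_runFlag]
    exact if_congr (runFlag_iff hT hlen).symm rfl rfl
  · simp [runFlag, stepFlag, ctl]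
  · simp [reset, ctl]
  · have h1 : savTime m n k o D.time j ρ u s = blockStart k o j * D.time := by
      unfold savTime
      rw [hr.1, hr.2, progress_zero, ite_self, add_zero]
    have h2 : ∀ v, σ (.inl (.savD v)) = D.runFrom (idleStream (guess H.m_pos k o x j ρ)) D.init
        (blockStart k o j * D.time) v := by
      intro v
      rw [h.savD, h1, D.runFrom_congr_of_lt (l := blockStart k o j) D.init le_rfl]
      intro a ha
      funext c
      cases c with
      | token => exact (tokenValue_guess_of_lt (by omega)).symm
      | index => rfl
    exact apply_savNode h2 h.zero v
  · refine H.gap_runD (guess H.m_pos k o x j ρ) (startFin k o j) t ?_ v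
    refine (ht.trans (Nat.sub_le _ _)).trans ?_
    rw [mul_comm n]
    exact Nat.mul_le_mul_left _ (by omega)
  · refine (H.yieldsD (x := x) (ρ := ρ) (j := j)).1 t ?_
    have h1 : D.time * blockLen k o n j ≤
        (min (blockStart k o j + k) n - blockStart k o j) * D.time := by
      rw [mul_comm]
      exact Nat.mul_le_mul_right _ (by omega)
    omega

/-- The output of the running copy of `Q` when it is read. -/
theorem Setup.eval_outQ (H : Setup q d Q D o ε) (h : HiddenOK H.m_pos Q D o x j ρ u s σ)
    (h' : VisibleOK H.m_pos q d Q D γ o x j ρ u s σ) (hs : s = Q.time)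
    (hu : u < blockLen k o n j) (hn : blockStart k o j + u < n) :
    (node (routeRunQ Q D k Q.out)).eval σ =
      q.next (guess H.m_pos k o x j ρ) ⟨blockStart k o j + u, hn⟩ := by
  have hT := Q.time_pos
  have h1 := (H.yieldsQ (x := x) (ρ := ρ) (j := j) hu).2
  have h2 : progress Q.time (Q.time * blockLen k o n j - 1) u s = (u + 1) * Q.time - 1 := by
    have h3 := Nat.mul_le_mul_left Q.time (Nat.succ_le_of_lt hu)
    rw [Nat.succ_eq_add_one, mul_add, mul_one] at h3
    rw [progress, hs, mul_comm u, mul_comm (u + 1), mul_add]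
    omega
  have h3 := comp_route (R := Q) (σ := σ) (inp := fun _ => .inl (.ctl .cur))
    (nd := fun v => .inr (.runQ v)) (h'.runQ (by omega))
    (ξ := runStreamQ H.m_pos k o x j ρ u) (fun _ => h.cur (by omega) hu)
  rw [← h1, Nat.add_sub_cancel, ← h2, ← h3]
  rfl

/-- The output of the running copy of `D` when it is read. -/
theorem Setup.eval_outD (H : Setup q d Q D o ε) (h : HiddenOK H.m_pos Q D o x j ρ u s σ)
    (h' : VisibleOK H.m_pos q d Q D γ o x j ρ u s σ) (hs : s = D.time)
    (hu : u + 1 = blockLen k o n j) (hoj : o ≤ j) :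
    (node (routeRunD Q D k D.out)).eval σ =
      d.val (startFin k o j) (guess H.m_pos k o x j ρ) := by
  have hT := D.time_pos
  have h1 := (H.yieldsD (x := x) (ρ := ρ) (j := j)).2
  have hbn := blockStart_add_le (k := k) (o := o) j.2
  -- From the offset on, the block is the whole window up to the end of the text, so the last slot
  -- of the block is the one in which `D` has to answer.
  have h0 : min (blockStart k o j + k) n - blockStart k o j = u + 1 := by
    rw [hu, blockLen_of_le hoj]
    omega
  rw [h0] at h1
  have h2 : progress D.time (D.time * blockLen k o n j - 1) u s = (u + 1) * D.time - 1 := by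
    rw [progress, hs, ← hu, mul_comm u, mul_comm (u + 1), mul_add]
    omega
  have h3 := comp_route (R := D) (σ := σ) (inp := distInp Q D k .start)
    (nd := fun v => .inr (.runD v)) (h'.runD (by omega))
    (ξ := runStreamD H.m_pos k o x j ρ u) (fun c => by
      cases c with
      | token => exact h.cur (by omega) (by omega)
      | index =>
        refine h.start.trans ?_
        simp [runStreamD, distStream, startFin])
  rw [← h1, Nat.add_sub_cancel, ← h2, ← h3]
  rfl

theorem Setup.prd_step (H : Setup q d Q D o ε) (hγ : 0 < γ)
    (h : HiddenOK H.m_pos Q D o x j ρ u s σ)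
    (h' : VisibleOK H.m_pos q d Q D γ o x j ρ u s σ) (hs : s < slotLen Q D) :
    (accTrans Q D k γ .prd).eval σ =
      prdVal H.m_pos q d γ o x (slotLen Q D) Q.time D.time j ρ (u * slotLen Q D + s + 1) := by
  have hS := slotLen_ge Q D
  have hlt := lt_blockStart_add (o := o) H.k_pos j.2
  have hb := blockStart_le (k := k) (o := o) (j : ℕ)
  have hbn := blockStart_add_le (k := k) (o := o) j.2
  have h1 : (accTrans Q D k γ .prd).eval σ = _ := eval_ite h.eval_reset
  have hQ : (readQ Q D k).eval σ = _ :=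
    eval_and (eval_and (eval_eq h.tick (eval_nat σ Q.time)) (eval_lt h.slot h.len))
      (eval_not (eval_lt h.slot h.pos))
  have hD : (readD Q D k).eval σ = _ :=
    eval_and (eval_and (eval_eq h.tick (eval_nat σ D.time))
      (eval_eq (eval_add h.slot (eval_nat_one σ)) h.len)) h.flg
  rw [h1]
  by_cases hr : s = 0 ∧ u = 0
  · rw [if_pos hr, hr.1, hr.2, zero_mul, prdVal_one H.m_pos Q.time_pos D.time_pos]
    simp
  rw [if_neg hr, prdVal_succ H.m_pos j.2 (by omega) (by omega) (by omega) hs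
    (A := (ite (readQ Q D k) (node (routeRunQ Q D k Q.out)) one).eval σ)
    (B := (ite (readD Q D k) (reluL [(1, one), (γ - 1, node (routeRunD Q D k D.out))])
      one).eval σ)]
  · simp only [eval_prodL, List.map_cons, List.map_nil, List.prod_cons, List.prod_nil, mul_one]
    rw [h'.prd hr, max_eq_right]
    refine mul_nonneg (prdVal_nonneg H.m_pos hγ) (mul_nonneg ?_ ?_)
    · rw [eval_ite hQ]; exact le_max_left _ _
    · rw [eval_ite hD]; exact le_max_left _ _
  · intro hn hp
    rw [eval_ite hQ, if_pos hp, H.eval_outQ h h' hp.1.1 hp.1.2 hn]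
    exact max_eq_right (q.next_nonneg _ _)
  · intro hp
    rw [eval_ite hQ, if_neg hp]
    simp
  · intro hp
    rw [eval_ite hD]
    unfold Distinguisher.blockWeight
    by_cases hoj : o ≤ j
    · have hw := d.weight_pos hγ (blockStart k o j) (guess H.m_pos k o x j ρ)
      rw [if_pos ⟨hp, hoj⟩, if_neg (by omega), eval_reluL]
      simp only [linVal_cons, linVal_nil]
      rw [H.eval_outD h h' hp.1 hp.2 hoj]
      have he : d.weight γ (blockStart k o j) (guess H.m_pos k o x j ρ) =
          1 + (γ - 1) * d.val (startFin k o j) (guess H.m_pos k o x j ρ) :=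
        dif_pos (startFin k o j).2
      rw [he] at hw ⊢
      simp only [eval_one, one_mul, add_zero]
      rw [max_eq_right hw.le, max_eq_right hw.le]
    · rw [if_neg (fun h => hoj h.2), if_pos (by omega)]
      simp
  · intro hp
    rw [eval_ite hD, if_neg (fun h => hp h.1)]
    simp

/-- A step within the time for a token. -/
theorem Setup.visibleOK_step (H : Setup q d Q D o ε) (hγ : 0 < γ) {ρ' u' s' : ℕ}
    {σ' : Node Q D k → ℝ} (h : HiddenOK H.m_pos Q D o x j ρ u s σ)
    (h' : VisibleOK H.m_pos q d Q D γ o x j ρ u s σ)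
    (hσr : ∀ v, σ' (.inr (.runQ v)) = (vTrans Q D k ε γ (.runQ v)).eval σ)
    (hσd : ∀ v, σ' (.inr (.runD v)) = (vTrans Q D k ε γ (.runD v)).eval σ)
    (hσ : ∀ a ≠ Acc.inp, (acc Q D k a).eval σ' = (accTrans Q D k γ a).eval σ)
    (hs : s < slotLen Q D) (hρ : ρ ≤ m ^ k)
    (hlast : ¬((s = slotLen Q D - 1 ∧ u = k - 1) ∧ ρ = m ^ k))
    (hs' : s' = if s = slotLen Q D - 1 then 0 else s + 1)
    (hu' : u' = if s = slotLen Q D - 1 then if u = k - 1 then 0 else u + 1 else u)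
    (hρ' : ρ' = if s = slotLen Q D - 1 ∧ u = k - 1 then ρ + 1 else ρ) :
    VisibleOK H.m_pos q d Q D γ o x j ρ' u' s' σ' := by
  have hS := slotLen_ge Q D
  have hlt := lt_blockStart_add (o := o) H.k_pos j.2
  have hb := blockStart_le (k := k) (o := o) (j : ℕ)
  -- Unless a new round begins, the time within the round grows by one and the copies go on, also
  -- across slots.
  have hround : ¬(s' = 0 ∧ u' = 0) → ρ' = ρ ∧
      u' * slotLen Q D + s' = u * slotLen Q D + s + 1 ∧
      ∀ T c, T + 4 ≤ slotLen Q D → progress T c u' s' =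
        if (0 < s ∧ s < T + 1) ∧ T * u + s < c + 1 then progress T c u s + 1
        else progress T c u s := by
    intro hne
    by_cases h1 : s = slotLen Q D - 1
    · rw [if_pos h1] at hs' hu'
      by_cases h2 : u = k - 1
      · rw [if_pos h2] at hu'
        exact absurd ⟨hs', hu'⟩ hne
      · rw [if_neg h2] at hu'
        rw [if_neg (fun h => h2 h.2)] at hρ'
        refine ⟨hρ', ?_, fun T c hT => ?_⟩
        · rw [hu', hs', add_mul]
          omega
        · rw [hu', hs', if_neg (fun h => by omega), progress_slot_succ (s := s) (by omega)]
    · rw [if_neg h1] at hs' hu'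
      rw [if_neg (fun h => h1 h.1)] at hρ'
      refine ⟨hρ', by rw [hu', hs']; omega, fun T c hT => ?_⟩
      rw [hu', hs', progress_succ]
  -- The two sums differ only in the summand, so one argument serves both.
  have hadd : ∀ (T : ℕ → ℝ), (∀ a, 0 ≤ T a) → ∀ e f : TransExpr (Node Q D k),
      (¬(ρ = 0 ∧ u = 0 ∧ s = 0) → e.eval σ = ∑ a ∈ Finset.range ρ, T a) →
      (s = slotLen Q D - 1 ∧ u = k - 1 → ρ ≠ m ^ k → f.eval σ = T ρ) →
      (ite (ctl Q D k .first) (nat 0) (reluL [(1, e),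
        (1, prodL [roundEnd Q D k, not (ctl Q D k .fin), f])])).eval σ =
        ∑ a ∈ Finset.range ρ', T a := by
    intro T hT e f he hf
    rw [eval_ite h.first]
    split_ifs with h1
    · have : ρ' = 0 := by
        rw [hρ', if_neg (fun h => by omega)]
        exact h1.1
      simp [this]
    · simp only [eval_reluL, linVal_cons, linVal_nil, eval_prodL, List.map_cons, List.map_nil,
        List.prod_cons, List.prod_nil, one_mul, mul_one, add_zero]
      rw [h.eval_roundEnd, eval_not h.fin, he h1]
      have h0 : 0 ≤ ∑ a ∈ Finset.range ρ', T a := Finset.sum_nonneg fun a _ => hT a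
      have h2 : ∑ a ∈ Finset.range ρ', T a = ∑ a ∈ Finset.range ρ, T a +
          (if s = slotLen Q D - 1 ∧ u = k - 1 then 1 else 0) *
            ((if ¬ρ = m ^ k then 1 else 0) * f.eval σ) := by
        rw [hρ']
        split_ifs with h3 h4
        · exact absurd ⟨h3, h4⟩ hlast
        · rw [Finset.sum_range_succ, hf h3 h4]
          ring
        · simp
        · simp
      rw [← h2, max_eq_right h0, max_eq_right h0]
  have hterm : ∀ a, 0 ≤ term H.m_pos q d γ o x j a := fun a =>
    mul_nonneg (Finset.prod_nonneg fun l _ => q.next_nonneg _ _) (d.blockWeight_pos hγ o j _).le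
  have hprd : s = slotLen Q D - 1 ∧ u = k - 1 → ρ ≠ m ^ k →
      (acc Q D k .prd).eval σ = term H.m_pos q d γ o x j ρ := by
    intro h1 h2
    rw [h'.prd (by omega), h1.1, h1.2, prdVal_end H.m_pos H.o_lt hS.1 hS.2 h2]
  refine ⟨?_, ?_, ?_, fun _ => ?_, fun _ => ?_, ?_⟩
  · intro hne v hv
    obtain ⟨h1, -, h2⟩ := hround hne
    rw [hσr, (H.runQ_step h h' hv).2, h1, h2 _ _ hS.1]
  · intro hne v hv
    obtain ⟨h1, -, h2⟩ := hround hne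
    rw [hσd, (H.runD_step h h' hv).2, h1, h2 _ _ hS.2]
  · intro hne
    obtain ⟨h1, h2, -⟩ := hround hne
    rw [hσ _ (by decide), H.prd_step hγ h h' hs, h1, h2]
  · rw [hσ _ (by decide)]
    exact hadd _ hterm _ _ h'.den hprd
  · rw [hσ _ (by decide)]
    have hT : ∀ a, 0 ≤ hitTerm H.m_pos q d γ o x j a := fun a => by
      unfold hitTerm
      split_ifs
      · exact hterm a
      · exact le_rfl
    rw [← hadd _ hT (acc Q D k .num) (prodL [hit Q D k, acc Q D k .prd]) h'.num]
    · simp [accTrans, TransExpr.ite]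
    · intro h1 h2
      have hle := blockLen_le (n := n) (j := j) H.o_lt
      have h3 : (hit Q D k).eval σ = _ := eval_pick
        (e := fun i => eq (digit Q D k i) (acc Q D k .inp))
        ⟨(j : ℕ) - blockStart k o j, by omega⟩ h.pos
      have h4 : (acc Q D k .inp).eval σ = ((x j : ℕ) : ℝ) := by
        rw [h.inp, tokenValue, dif_pos j.2]
      simp only [eval_prodL, List.map_cons, List.map_nil, List.prod_cons, List.prod_nil, mul_one]
      rw [h3, eval_eq (h.digit _) h4, hprd h1 h2]
      unfold hitTerm
      split_ifs <;> simp
  · intro h1 h2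
    have h3 : ¬s = slotLen Q D - 1 := fun h3 => by
      rw [if_pos h3] at hs'
      omega
    have h4 : ρ = m ^ k := by
      rw [← h1, hρ', if_neg (fun h => h3 h.1)]
    have h5 := pow_pos H.m_pos k
    have h6 : ¬(ρ = 0 ∧ u = 0 ∧ s = 0) := by omega
    rw [hσ _ (by decide)]
    simp only [accTrans, eval_prodL, eval_recipL, List.map_cons, List.map_nil, List.prod_cons,
      List.prod_nil, linVal_cons, linVal_nil]
    rw [h'.num h6, h'.den h6, eval_not h.fin, h.fin, if_pos h4, if_neg (not_not.2 h4), h4]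
    simp [div_eq_mul_inv]

theorem Setup.defined_vTrans (H : Setup q d Q D o ε) (hγ : 0 < γ)
    (h : HiddenOK H.m_pos Q D o x j ρ u s σ)
    (h' : VisibleOK H.m_pos q d Q D γ o x j ρ u s σ) (v : VNode VQ VD k) :
    (vTrans Q D k ε γ v).Defined σ := by
  cases v with
  | runQ v =>
    by_cases hv : Q.input v = none
    · exact (H.runQ_step h h' hv).1
    · simp [vTrans, hv]
  | runD v =>
    by_cases hv : D.input v = none
    · exact (H.runD_step h h' hv).1
    · simp [vTrans, hv]
  | acc a =>
    cases a with
    | out =>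
      simp only [vTrans, accTrans, defined_prodL]
      simp only [List.mem_cons, List.not_mem_nil, or_false, forall_eq_or_imp, forall_eq, acc, ctl,
        defined_recipL, defined_prodL, defined_not, defined_node, true_and]
      have h1 := eval_not h.fin
      have h2 := h.fin
      simp only [ctl] at h1 h2
      simp only [linVal_cons, linVal_nil, eval_prodL, List.map_cons, List.map_nil, List.prod_cons,
        List.prod_nil]
      rw [h1, h2]
      -- In the last round the denominator is the complete sum, which is positive; before, it is
      -- `1`.
      by_cases h3 : ρ = m ^ k
      · have h5 := pow_pos H.m_pos k
        have h4 := h'.den (by omega)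
        simp only [acc] at h4
        rw [h4, h3]
        simpa using (H.sum_term_pos hγ x j).ne'
      · simp [h3]
    | num =>
      have h1 : (hit Q D k).Defined σ :=
        defined_pick _ _ (by simp [ctl]) fun i => by simp [digit, acc]
      simp [vTrans, accTrans, h1, roundEnd, slotEnd, ctl, acc]
    | inp | prd | den =>
      simp [vTrans, accTrans, reset, readQ, readD, roundEnd, slotEnd, ctl, acc]
  | pad i => simp [vTrans]

end

end Boost

/-! ### The clock, and the run on a whole text. -/

namespace Boost

open TransExpr

/-- The digits of the time within a token, in terms of those of the preceding step. -/
theorem clock_succ {S k : ℕ} (hS : 0 < S) (hk : 0 < k) (a : ℕ) :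
    (a + 1) % S = (if a % S = S - 1 then 0 else a % S + 1) ∧
      (a + 1) / S % k = (if a % S = S - 1 then if a / S % k = k - 1 then 0 else a / S % k + 1
        else a / S % k) ∧
      (a + 1) / S / k = if a % S = S - 1 ∧ a / S % k = k - 1 then a / S / k + 1
        else a / S / k := by
  obtain ⟨h1, h2⟩ := digit_zero_succ hS a
  obtain ⟨h3, h4⟩ := digit_zero_succ hk (a / S)
  refine ⟨h2, ?_, ?_⟩ <;> rw [h1]
  · split_ifs at h4 ⊢ <;> simp_all
  · by_cases h5 : a % S = S - 1
    · rw [if_pos h5, h3]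
      simp only [h5, true_and]
      split_ifs <;> rfl
    · simp [h5]

theorem clock_last {S k M a : ℕ} (hS : 0 < S) (hk : 0 < k) (ha : a < (M + 1) * k * S) :
    a + 1 = (M + 1) * k * S ↔ (a % S = S - 1 ∧ a / S % k = k - 1) ∧ a / S / k = M := by
  have h1 := (clock_succ hS hk a).2.2
  have h2 := Nat.div_add_mod a S
  have h3 := Nat.div_add_mod (a / S) k
  constructor
  · intro h
    rw [h, Nat.mul_div_cancel _ hS, Nat.mul_div_cancel _ hk] at h1
    have h4 : a / S / k < M + 1 := by
      rw [Nat.div_lt_iff_lt_mul hk, Nat.div_lt_iff_lt_mul hS]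
      exact ha
    split_ifs at h1 with h5
    · exact ⟨h5, by omega⟩
    · omega
  · rintro ⟨⟨h4, h5⟩, h6⟩
    rw [h6, h5] at h3
    have h7 : a / S + 1 = (M + 1) * k := by
      rw [← h3, mul_comm k, add_mul]
      omega
    rw [mul_comm S] at h2
    rw [← h7, add_mul]
    omega

variable {m n k o : ℕ} {VQ VD : Type} {q : LangModel m n} {d : Distinguisher m n k}
  {Q : RNN Unit VQ} {D : RNN DistInput VD} {ε γ : ℝ} {x : Fin n → Fin m}

/-- No clause says anything at the arrival of a token. Arbitrary values of the other nodes are thus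
allowed then, which is the sufficiency of the new hidden node set. -/
theorem visibleOK_zero (hm : 0 < m) (j : Fin n) (σ : Node Q D k → ℝ) :
    VisibleOK hm q d Q D γ o x j 0 0 0 σ where
  runQ h := absurd ⟨rfl, rfl⟩ h
  runD h := absurd ⟨rfl, rfl⟩ h
  prd h := absurd ⟨rfl, rfl⟩ h
  den h := absurd ⟨rfl, rfl, rfl⟩ h
  num h := absurd ⟨rfl, rfl, rfl⟩ h
  out _ h := absurd h (lt_irrefl 0)

/-- All node values are correct in step `a` for the token at `j`. -/
def TimeOK (hm : 0 < m) (q : LangModel m n) (d : Distinguisher m n k) (Q : RNN Unit VQ)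
    (D : RNN DistInput VD) (γ : ℝ) (o : ℕ) (x : Fin n → Fin m) (j : Fin n) (a : ℕ)
    (σ : Node Q D k → ℝ) : Prop :=
  HiddenOK hm Q D o x j (a / slotLen Q D / k) (a / slotLen Q D % k) (a % slotLen Q D) σ ∧
    VisibleOK hm q d Q D γ o x j (a / slotLen Q D / k) (a / slotLen Q D % k)
      (a % slotLen Q D) σ

section run

variable {l : ℕ} {f : ℝ} {hk : 0 < k}

theorem Setup.stepDefined (H : Setup q d Q D o ε) (hγ : 0 < γ) {j : Fin n} {a : ℕ}
    {ξ : Unit → ℝ} {st : Node Q D k → ℝ}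
    (h : TimeOK H.m_pos q d Q D γ o x j a ((net Q D m n k ε γ hk l f).view ξ st)) :
    (net Q D m n k ε γ hk l f).StepDefined ξ st := by
  rintro (v | v) -
  · exact H.defined_hTrans j.2 h.1 v
  · exact H.defined_vTrans hγ h.1 h.2 v

theorem Setup.timeOK_step (H : Setup q d Q D o ε) (hγ : 0 < γ) {j : Fin n} {a : ℕ}
    {st : Node Q D k → ℝ} (ha : a + 1 < (m ^ k + 1) * k * slotLen Q D)
    (h : TimeOK H.m_pos q d Q D γ o x j a
      ((net Q D m n k ε γ hk l f).view (tokStream x j) st)) :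
    TimeOK H.m_pos q d Q D γ o x j (a + 1) ((net Q D m n k ε γ hk l f).view (tokStream x j)
      ((net Q D m n k ε γ hk l f).step (tokStream x j) st)) := by
  have hS : 0 < slotLen Q D := Nat.succ_pos _
  obtain ⟨h1, h2, h3⟩ := clock_succ hS hk a
  have hlast := mt (clock_last hS hk (Nat.lt_of_succ_lt ha)).2 ha.ne
  have hρ : a / slotLen Q D / k ≤ m ^ k := by
    rw [← Nat.lt_add_one_iff, Nat.div_lt_iff_lt_mul hk, Nat.div_lt_iff_lt_mul hS]
    omega
  refine ⟨H.hiddenOK_step j.2 h.1 (fun _ => rfl) rfl (Nat.mod_lt _ hk) (Nat.mod_lt _ hS) hρ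
    hlast h1 h2 h3, H.visibleOK_step hγ h.1 h.2 (fun _ => rfl) (fun _ => rfl) (fun a ha => ?_)
    (Nat.mod_lt _ hS) hρ hlast h1 h2 h3⟩
  cases a with
  | inp => exact absurd rfl ha
  | prd | den | num | out => rfl

theorem Setup.timeOK_next (H : Setup q d Q D o ε) {j : Fin n} (hj : (j : ℕ) + 1 < n) {a : ℕ}
    {st : Node Q D k → ℝ} (ha : a + 1 = (m ^ k + 1) * k * slotLen Q D)
    (h : TimeOK H.m_pos q d Q D γ o x j a
      ((net Q D m n k ε γ hk l f).view (tokStream x j) st)) :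
    TimeOK H.m_pos q d Q D γ o x ⟨j + 1, hj⟩ 0
      ((net Q D m n k ε γ hk l f).view (tokStream x (j + 1))
        ((net Q D m n k ε γ hk l f).step (tokStream x j) st)) := by
  have hS : 0 < slotLen Q D := Nat.succ_pos _
  obtain ⟨⟨h1, h2⟩, h3⟩ := (clock_last hS hk (ha ▸ Nat.lt_succ_self a)).1 ha
  have h4 := h.1
  rw [h1, h2, h3] at h4
  unfold TimeOK
  simp only [Nat.zero_div, Nat.zero_mod]
  exact ⟨H.hiddenOK_next hj h4 (fun _ => rfl) rfl, visibleOK_zero _ _ _⟩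

/-- All node values are correct in a run that starts with correct hidden nodes at the arrival of
a token. -/
theorem Setup.timeOK_runFrom (H : Setup q d Q D o ε) (hγ : 0 < γ) {b : ℕ}
    {st : Node Q D k → ℝ} (hst : HiddenOK H.m_pos Q D o x b 0 0 0
      ((net Q D m n k ε γ hk l f).view (tokStream x b) st)) (t : ℕ)
    (ht : b + t / (net Q D m n k ε γ hk l f).time < n) :
    TimeOK H.m_pos q d Q D γ o x ⟨b + t / (net Q D m n k ε γ hk l f).time, ht⟩
      (t % (net Q D m n k ε γ hk l f).time)
      ((net Q D m n k ε γ hk l f).view (tokStream x (b + t / (net Q D m n k ε γ hk l f).time))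
        ((net Q D m n k ε γ hk l f).runFrom (fun a => tokStream x (b + a)) st t)) := by
  have hT := (net Q D m n k ε γ hk l f).time_pos
  induction t with
  | zero =>
    unfold TimeOK
    simp only [Nat.zero_div, Nat.zero_mod]
    exact ⟨hst, visibleOK_zero _ _ _⟩
  | succ t ih =>
    obtain ⟨h1, h2⟩ := digit_zero_succ hT t
    have h3 : b + t / (net Q D m n k ε γ hk l f).time < n := by omega
    have h4 := ih h3
    rw [RNN.runFrom]
    by_cases h5 : t % (net Q D m n k ε γ hk l f).time = (net Q D m n k ε γ hk l f).time - 1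
    · rw [if_pos h5] at h1 h2
      simp only [h1, h2]
      exact H.timeOK_next (by simp only; omega) (by
        change _ = (net Q D m n k ε γ hk l f).time
        omega) h4
    · rw [if_neg h5] at h1 h2
      simp only [h1, h2, add_zero]
      refine H.timeOK_step hγ ?_ h4
      have := Nat.mod_lt t hT
      change _ < (net Q D m n k ε γ hk l f).time
      omega

/-- The run may start at any token, from any state with correct hidden nodes, so both clauses of
`RNN.Computes` are instances. -/
theorem Setup.yields (H : Setup q d Q D o ε) (hγ : 0 < γ) {b c : ℕ} (hc : b + c < n)
    {st : Node Q D k → ℝ} (hst : HiddenOK H.m_pos Q D o x b 0 0 0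
      ((net Q D m n k ε γ hk l f).view (tokStream x b) st)) :
    (net Q D m n k ε γ hk l f).Yields (fun a => tokStream x (b + a)) st (c + 1)
      ((q.reweight (d.blockWeight γ o) (d.blockWeight_pos hγ o)).next x ⟨b + c, hc⟩) := by
  have hT := (net Q D m n k ε γ hk l f).time_pos
  have hS : 0 < slotLen Q D := Nat.succ_pos _
  have hS' : 4 ≤ slotLen Q D := Nat.le_add_left _ _
  constructor
  · intro t ht
    have h1 : t / (net Q D m n k ε γ hk l f).time < c + 1 := by
      rw [Nat.div_lt_iff_lt_mul hT]
      omega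
    exact H.stepDefined hγ (H.timeOK_runFrom hγ hst t (by omega))
  · set T := (net Q D m n k ε γ hk l f).time with hTdef
    have h1 : (c + 1) * T - 1 = (T - 1) + T * c := by
      rw [add_mul, mul_comm c]
      omega
    have h2 : ((c + 1) * T - 1) / T = c := by
      rw [h1, Nat.add_mul_div_left _ _ hT, Nat.div_eq_of_lt (by omega), zero_add]
    have h3 : ((c + 1) * T - 1) % T = T - 1 := by
      rw [h1, Nat.add_mul_mod_self_left, Nat.mod_eq_of_lt (by omega)]
    have h4 := H.timeOK_runFrom hγ hst ((c + 1) * T - 1) (by rw [← hTdef, h2]; exact hc)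
    simp only [← hTdef, h2, h3] at h4
    have h5 : T - 1 + 1 = (m ^ k + 1) * k * slotLen Q D := Nat.sub_add_cancel hT
    obtain ⟨⟨h6, h7⟩, h8⟩ := (clock_last hS hk (h5 ▸ Nat.lt_succ_self _)).1 h5
    rw [← H.sum_hitTerm_div hγ]
    exact h4.2.out h8 (by omega)

theorem initial_hiddenOK (hm : 0 < m) (hk : 0 < k) (x : Fin n → Fin m) :
    HiddenOK hm Q D o x 0 0 0 0 ((net Q D m n k ε γ hk (blockLen k o n 0)
      (if o ≤ 0 then 1 else 0)).view (tokStream x 0)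
        (initial Q D k (blockLen k o n 0) (if o ≤ 0 then 1 else 0))) := by
  have hpow := pow_pos hm k
  have hb : blockStart k o 0 = 0 := Nat.le_zero.1 (blockStart_le 0)
  constructor
  case inp => rfl
  case tick => exact Nat.cast_zero.symm
  case slot => exact Nat.cast_zero.symm
  case fin => exact (if_neg hpow.ne).symm
  case first => exact (if_pos ⟨rfl, rfl, rfl⟩).symm
  case pos => rw [hb]; exact Nat.cast_zero.symm
  case start => rw [hb]; exact Nat.cast_one.symm
  case len => rfl
  case flg => rfl
  case zero => rfl
  case digit =>
    intro i
    rw [Nat.zero_div, Nat.zero_mod]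
    exact Nat.cast_zero.symm
  case mem => exact fun i hi => absurd (hi.resolve_right (by simp)) (Nat.not_lt_zero _)
  case cur => exact fun h => absurd h (lt_irrefl 0)
  case savQ =>
    intro v
    have h : savTime m n k o Q.time 0 0 0 0 = 0 := by
      rw [savTime, hb, zero_mul, if_neg fun h => hpow.ne h.1.1]
    rw [h]
    rfl
  case savD =>
    intro v
    have h : savTime m n k o D.time 0 0 0 0 = 0 := by
      rw [savTime, hb, zero_mul, if_neg fun h => hpow.ne h.1.1]
    rw [h]
    rfl

theorem HiddenOK.congr {hm : 0 < m} {j ρ u s : ℕ} {σ σ' : Node Q D k → ℝ}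
    (h : HiddenOK hm Q D o x j ρ u s σ) (hσ : ∀ v, σ' (.inl v) = σ (.inl v))
    (hinp : (acc Q D k .inp).eval σ' = (acc Q D k .inp).eval σ) :
    HiddenOK hm Q D o x j ρ u s σ' where
  inp := hinp.trans h.inp
  tick := (hσ _).trans h.tick
  slot := (hσ _).trans h.slot
  fin := (hσ _).trans h.fin
  first := (hσ _).trans h.first
  pos := (hσ _).trans h.pos
  start := (hσ _).trans h.start
  len := (hσ _).trans h.len
  flg := (hσ _).trans h.flg
  zero := (hσ _).trans h.zero
  digit i := (hσ _).trans (h.digit i)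
  mem i hi := (hσ _).trans (h.mem i hi)
  cur h1 h2 := (hσ _).trans (h.cur h1 h2)
  savQ v := (hσ _).trans (h.savQ v)
  savD v := (hσ _).trans (h.savD v)

theorem Setup.representsLM (H : Setup q d Q D o ε) (hγ : 0 < γ) :
    (net Q D m n k ε γ hk (blockLen k o n 0) (if o ≤ 0 then 1 else 0)).RepresentsLM
      (q.reweight (d.blockWeight γ o) (d.blockWeight_pos hγ o)) := by
  intro x i
  have h0 := initial_hiddenOK (Q := Q) (D := D) (o := o) (ε := ε) (γ := γ) H.m_pos hk x
  constructor
  · have h1 := H.yields hγ (b := 0) (c := i) (by omega) h0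
    simp only [zero_add] at h1
    exact h1
  · intro j hj st hst
    have h1 := H.yields hγ (x := x) (b := j) (c := i - j) (hk := hk) (l := blockLen k o n 0)
      (f := if o ≤ 0 then 1 else 0) (st := st) (by omega) ?_
    · simp only [show j + (i - j) = i by omega,
        show (i : ℕ) - j + 1 = i + 1 - j by omega] at h1
      exact h1
    · have hT := (net Q D m n k ε γ hk (blockLen k o n 0) (if o ≤ 0 then 1 else 0)).time_pos
      -- The undisturbed run has correct hidden nodes at the arrival of `j`, and `st` shares them.
      have h2 := H.timeOK_runFrom hγ h0
        (j * (net Q D m n k ε γ hk (blockLen k o n 0) (if o ≤ 0 then 1 else 0)).time)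
        (by rw [Nat.mul_div_cancel _ hT]; omega)
      simp only [Nat.mul_div_cancel _ hT, Nat.mul_mod_left, zero_add] at h2
      have h3 := h2.1
      simp only [Nat.zero_div, Nat.zero_mod] at h3
      exact h3.congr (fun v => hst _ (Finset.mem_map.2 ⟨v, Finset.mem_univ v, rfl⟩)) rfl

end run

theorem exists_gap_run {ι V τ : Type} [Finite V] [Finite τ] (R : RNN ι V)
    (ξ : τ → ℕ → ι → ℝ) (s : τ → V → ℝ) (c : ℕ) :
    ∃ ε > 0, ∀ ε' ≤ ε, ∀ x, ∀ t ≤ c, ∀ v, Gap ε' (R.runFrom (ξ x) (s x) t v) := by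
  obtain ⟨ε, hε, h⟩ := exists_gap fun a : τ × Fin (c + 1) × V =>
    R.runFrom (ξ a.1) (s a.1) a.2.1 a.2.2
  exact ⟨ε, hε, fun ε' h' x t ht v => h ε' h' (x, ⟨t, by omega⟩, v)⟩

/-- Each of the four kinds of simulated runs takes finitely many values, and the least of the four
gaps serves all. The alphabet is nonempty because probabilities add up to `1`. -/
theorem exists_setup [Finite VQ] [Finite VD] (hk : 0 < k) (hn : 0 < n) (ho : o < k)
    (hQ : Q.RepresentsLM q) (hD : D.RepresentsDist d) : ∃ ε, Setup q d Q D o ε := by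
  have hm : 0 < m := by
    rcases Nat.eq_zero_or_pos m with rfl | hm
    · simpa using q.sum_eq_one [] (by simpa using hn)
    · exact hm
  obtain ⟨ε₁, h₁, g₁⟩ := exists_gap_run Q (fun x : Fin n → Fin m => tokStream x)
    (fun _ => Q.init) (n * Q.time)
  obtain ⟨ε₂, h₂, g₂⟩ := exists_gap_run D (fun x : Fin n → Fin m => idleStream x)
    (fun _ => D.init) (n * D.time)
  obtain ⟨ε₃, h₃, g₃⟩ := exists_gap_run Q
    (fun (x : (Fin n → Fin m) × Fin n) a => tokStream x.1 (x.2 + a))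
    (fun x => Q.restrict (Q.runFrom (tokStream x.1) Q.init (x.2 * Q.time))) (n * Q.time)
  obtain ⟨ε₄, h₄, g₄⟩ := exists_gap_run D
    (fun (x : (Fin n → Fin m) × Fin n) a => distStream x.2 x.1 (x.2 + a))
    (fun x => D.restrict (D.runFrom (idleStream x.1) D.init (x.2 * D.time))) (n * D.time)
  refine ⟨min (min ε₁ ε₂) (min ε₃ ε₄), hm, hk, ho,
    lt_min (lt_min h₁ h₂) (lt_min h₃ h₄), hQ, hD, ?_, ?_, ?_, ?_⟩
  · exact g₁ _ ((min_le_left _ _).trans (min_le_left _ _))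
  · exact g₂ _ ((min_le_left _ _).trans (min_le_right _ _))
  · exact fun x b => g₃ _ ((min_le_right _ _).trans (min_le_left _ _)) (x, b)
  · exact fun x b => g₄ _ ((min_le_right _ _).trans (min_le_right _ _)) (x, b)

end Boost

theorem lemma3 (k c : ℕ) (hk : 0 < k) :
    ∃ C : ℕ, ∀ (m n : ℕ) (_ : 0 < n) (p q : LangModel m n) (d : Distinguisher m n k)
      (VQ VD : Type) (_ : Fintype VQ) (_ : Fintype VD) (Q : RNN Unit VQ) (D : RNN DistInput VD),
      Q.CostLE c → D.CostLE c → Q.RepresentsLM q → D.RepresentsDist d →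
      ∃ (q' : LangModel m n) (V' : Type) (_ : Fintype V') (Q' : RNN Unit V'),
        Q'.RepresentsLM q' ∧
        Q'.CostLE C ∧
        Fintype.card V' = Fintype.card VQ + Q.hidden.card + Fintype.card VD + D.hidden.card
          + 7 * k + 25 ∧
        Q'.hidden.card = Q.hidden.card + D.hidden.card + 6 * k + 17 ∧
        Q'.time = (m ^ k + 1) * k * (max Q.time D.time + 4) ∧
        LangModel.loss p q' + ENNReal.ofReal (d.advantage p q ^ 2 / (4 * (k : ℝ)))
          ≤ LangModel.loss p q := by
  refine ⟨10000 * 2 ^ c + 1000 * k, ?_⟩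
  intro m n hn p q d VQ VD _ _ Q D hQc hDc hQ hD
  obtain ⟨o, ho, γ, hγ, hloss⟩ := d.exists_loss_reweight_le p q hk hn
  -- The offset has to be fixed first, since the simulation is set up for blocks at this offset.
  obtain ⟨ε, H⟩ := Boost.exists_setup hk hn ho hQ hD
  exact ⟨_, Boost.Node Q D k, inferInstance,
    Boost.net Q D m n k ε γ hk (Boost.blockLen k o n 0) (if o ≤ 0 then 1 else 0),
    H.representsLM hγ, Boost.costLE_net ε γ hQc hDc hk _ _, Boost.card_node Q D k,
    Boost.card_hidden_net Q D m n k ε γ hk _ _, rfl, hloss⟩
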